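/- **Machine.** Let $\mathcal L$ be a lattice of security labels with least element $\bot=$ public. Labelled values are written $v_\ell$. The abstract operations of the machine are: partial evaluation functions for opcodes (values to a value), branch conditions (values to a Boolean) and addresses (values to a value), two opcodes $succ,pred$, and a register $r_{sp}$. Operands $rv$ are registers or labelled values. Program points are values. A program $P$ is a fixed (public) partial map from program points to instructions $(r=op(o,\vec{rv},n'))$, $br(c,\vec{rv},n^{t},n^{f})$, $(r=load(\vec{rv},n'))$, $store(rv,\vec{rv},n')$, $jmpi(\vec{rv})$, $call(n_f,n_{ret})$, $ret$, $fence(n')$. A configuration is $(\rho,\mu,n,buf,\sigma)$: partial maps $\rho$ (registers) and $\mu$ (memory) to labelled values, the program point $n$, the reorder buffer $buf$ (a finite partial map from $\mathbb N$ to transient instructions) and the return stack buffer $\sigma$ (a finite partial map from $\mathbb N$ to commands push $n$ / pop). $C$ is *initial*, and also *terminal*, if its reorder buffer is empty. A temporary register $r_{ret}$, not accessible to programs, is used by $ret$. **Steps** $C\hookrightarrow_d^{o}C'$, with directive $d$ and a list $o$ of observations. At index $i$ a register resolves to the value of the latest assignment to it in $buf$ before $i$, if there is one and its value is known (resolved,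 or a load with a predicted value), and to $\rho(r)$ if there is none; a list of operands resolves pointwise; results and addresses carry the join of the labels of their operands. All execute steps at $i$ require that no fence precedes $i$ in $buf$. *Fetch* puts the transient form of $P(n)$ at index $\max(\mathrm{dom}\,buf)+1$ (with $\max\emptyset=0$) and moves to the next point; the directive is `fetch` for op, load, store, fence, call; `fetch: b` ($b$ Boolean) for $br$ (continue at the guessed branch); `fetch: n'` for $jmpi$ (continue at the guess $n'$). For $call$ at index $i$ the entries are: a call marker, $r_{sp}=op(succ,r_{sp})$, $store(n_{ret},[r_{sp}])$; moreover $\sigma(i):=$ push $n_{ret}$ and execution continues at $n_f$. For $ret$ they are: a ret marker, $r_{ret}=load([r_{sp}])$, $r_{sp}=op(pred,r_{sp})$, $jmpi([r_{ret}],n')$; moreover $\sigma(i):=$ pop, and execution continues at $n'$, where $n'$ is the top of the stack that the commands of $\sigma$, in order, produce (directive `fetch`), or the guess of `fetch: n'` if that stack is empty. *Execute.* `execute i` evaluates an op without observation. It evaluates a $br$ or $jmpi$ to its target $n_1$, with observation jump $(n_1)_\ell$; if $n_1$ is not the predicted point, then the observations are rollback, jump $(n_1)_\ell$, and all entries of $buf$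 and $\sigma$ at indices $\ge i$ are removed; in both cases $i$ becomes a resolved jump to $n_1$, and after a rollback execution continues at $n_1$. `execute i` on a load with address $a_\ell$ takes the value of the latest earlier store with resolved address $a$ (observation fwd $a_\ell$; that store's value must be resolved; annotation $\{j,a\}$, $j$ the store's index), or, if there is no such store, $\mu(a)$ (observation read $a_\ell$; annotation $\{\bot,a\}$). `execute i: fwd j` gives the unresolved load at $i$ the predicted value of any store at $j<i$ whose value is resolved, without observation. `execute i` on such a load, with predicted value $v$ and address $a_\ell$: if store $j$ has a resolved address $\ne a$, or a store strictly between $j$ and $i$ has resolved address $a$, it emits rollback, fwd $a_\ell$ and rolls back to the load; else, if store $j$ is still in $buf$, it emits fwd $a_\ell$ and resolves to $v$ with $\{j,a\}$; if $j$ is no longer in $buf$ and no earlier store in $buf$ has resolved address $a$, it compares $v$ with $\mu(a)$ (labels included): if they are equal it emits read $a_\ell$ and resolves with $\{\bot,a\}$, if $\mu(a)$ is defined and different it emits rollback, read $a_\ell$ and rolls back to the load. Rolling back to a load at index $k$ removes all entries of $buf$ and $\sigma$ at indices $\ge k$ and continues at the program point of that load. `execute i: value` resolves the value of a store without observation. `execute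 i: addr` resolves an unresolved store address to $a_\ell$ with observation fwd $a_\ell$; if some resolved load at $k>i$, annotated $\{j_k,a_k\}$, has $a_k=a$ and $j_k<i$ (where $\bot<i$), or $j_k=i$ and $a_k\neq a$, it emits rollback, fwd $a_\ell$ instead and also rolls back to the least such load. *Retire* applies to the entry of least index, and removes it: a resolved value is written to $\rho$, a store with resolved value and address $a_\ell$ to $\mu(a)$ with observation write $a_\ell$; resolved jumps and fences are just removed. A call marker retires together with the two following entries, when these are resolved ($\rho(r_{sp})$ and $\mu(a)$ are updated, observation write $a_\ell$); a ret marker together with the three following ones, when these are resolved ($\rho(r_{sp})$ is updated). **Executions.** $C\Downarrow_D^O C'$ means that the list $D$ of directives can be executed from $C$, ending in $C'$, where $O$ is the concatenation of the observations; $D$ is then *well-formed* for $C$. $N(D)$ is the number of retire directives in $D$. A *sequential execution* $C\Downarrow_{D,seq}^{O}C'$ is an execution from an initial to a terminal configuration in which every fetch takes place with an empty reorder buffer (each fetched instruction is executed and retired before the next fetch). **Low-equivalence.** $C\simeq C'$ if their register files and memories are defined at the same places, carry the same labels, and have the same values wherever the label is public, and they have the same program point, the same return stack buffer and the same set of occupied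 reorder buffer indices. **Speculative constant-time.** $C$ is SCT with respect to $D$ if for all $C'\simeq C$: whenever $C\Downarrow_D^O C_1$ there is $C_1'\simeq C_1$ with $C'\Downarrow_D^{O}C_1'$, and conversely, with the roles of $C$ and $C'$ exchanged. **Proposition.** Let $P$ be a program, $C$ an initial configuration and $D$ a well-formed schedule for $C$ such that $C$ is SCT with respect to $D$. If execution of $C$ under $D$ ends in a terminal configuration, then $C$ is sequentially constant-time for the $N(D)$ instructions that $D$ retires. That is: there is a sequential execution of $C$ that retires exactly $N(D)$ instructions; and for every $C'\simeq C$ and every schedule $D_s$ with $N(D_s)=N(D)$, whenever $C\Downarrow_{D_s,seq}^{O}C_2$ there is $C_2'\simeq C_2$ with $C'\Downarrow_{D_s,seq}^{O}C_2'$, and conversely, with the roles of $C$ and $C'$ exchanged. -/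

import Mathlib

namespace SpecCT

/-- Finite partial maps from indices to `α` (reorder buffers, return stack buffers). -/
@[ext] structure IdxMap (α : Type*) where
  get : ℕ → Option α
  finite : {i | get i ≠ none}.Finite

namespace IdxMap

variable {α : Type*}

/-- The empty map. -/
def empty : IdxMap α := ⟨fun _ => none, by simp⟩

/-- `m[i ↦ t]`. -/
def set (m : IdxMap α) (i : ℕ) (t : α) : IdxMap α where
  get := Function.update m.get i (some t)
  finite := (m.finite.insert i).subset fun j hj => by
    by_cases h : j = i
    · exact Or.inl h
    · right
      simpa [Function.update_of_ne h] using hj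

/-- `m[j : p j]`, the restriction of `m` to the indices that satisfy `p`. -/
def restrict (m : IdxMap α) (p : ℕ → Prop) [DecidablePred p] : IdxMap α where
  get := fun j => if p j then m.get j else none
  finite := m.finite.subset fun j hj => by
    by_cases h : p j <;> simp_all

/-- The set of indices on which the map is defined. -/
def dom (m : IdxMap α) : Set ℕ := {i | m.get i ≠ none}

/-- The least index of the domain; `0` for the empty map. -/
noncomputable def minIdx (m : IdxMap α) : ℕ := sInf m.dom

/-- The greatest index of the domain; `0` for the empty map. -/
noncomputable def maxIdx (m : IdxMap α) : ℕ := sSup m.dom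

/-- The entries of the map, in the order of their indices. -/
noncomputable def entries (m : IdxMap α) : List α :=
  (m.finite.toFinset.sort (· ≤ ·)).filterMap m.get

end IdxMap

/-- A value annotated with a security label. -/
abbrev LVal (V L : Type*) := V × L

/-- The join of the labels of a list of values (`⊥`, the label `public`, for the empty list). -/
def joinLabels {V L : Type*} [SemilatticeSup L] [OrderBot L] (vs : List (LVal V L)) : L :=
  (vs.map Prod.snd).foldr (· ⊔ ·) ⊥

/-- The operands `rv`: a register or a labelled value. -/
inductive Operand (R V L : Type*)
  | reg (r : R)
  | val (v : LVal V L)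

/-- The registers that occur in transient instructions: the architectural registers and
the temporary register `r_ret`, which holds the return address while a `ret` is in flight and
which programs cannot name. -/
inductive TReg (R : Type*)
  | arch (r : R)
  | ret

/-- An operand of a program instruction as an operand of a transient instruction. -/
def Operand.lift {R V L : Type*} : Operand R V L → Operand (TReg R) V L
  | .reg r => .reg (.arch r)
  | .val v => .val v

/-- The abstract operations of the machine: evaluation of opcodes, of branch conditions and of
addresses, the opcodes that advance and retract the stack pointer, and the stack pointer. -/
structure Machine (V R Op Cond : Type*) where
  evalOp : Op → List V → Option V
  evalCond : Cond → List V → Option Bool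
  addr : List V → Option V
  succ : Op
  pred : Op
  rsp : R

/-- Physical instructions. -/
inductive Instr (V L R Op Cond : Type*)
  | op (o : Op) (r : R) (rvs : List (Operand R V L)) (n' : V)
  | br (c : Cond) (rvs : List (Operand R V L)) (nTrue nFalse : V)
  | load (r : R) (rvs : List (Operand R V L)) (n' : V)
  | store (rv : Operand R V L) (rvs : List (Operand R V L)) (n' : V)
  | jmpi (rvs : List (Operand R V L))
  | call (nf nret : V)
  | ret
  | fence (n' : V)

/-- A program assigns instructions to (some) program points. It is public and is not modified by
execution, so it is kept apart from the data memory. -/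
abbrev Program (V L R Op Cond : Type*) := V → Option (Instr V L R Op Cond)

/-- The annotation `{j, a}` of a resolved load at program point `n`: the value was forwarded from
the store at index `j` (from memory if `dep = ⊥`), and the address was `a`. -/
structure LoadTag (V : Type*) where
  dep : WithBot ℕ
  addr : V
  pc : V

/-- The address of a transient store: operands, or a resolved address. -/
inductive StoreAddr (V L R : Type*)
  | unresolved (rvs : List (Operand (TReg R) V L))
  | resolved (a : LVal V L)

/-- Transient instructions. -/
inductive Transient (V L R Op Cond : Type*)
  /-- `r = op(o, rvs)` -/
  | op (r : TReg R) (o : Op) (rvs : List (Operand (TReg R) V L))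
  /-- `r = v`, with the annotation `{j, a}` at `n` if the value stems from a load -/
  | val (r : TReg R) (v : LVal V L) (tag : Option (LoadTag V))
  /-- `br(c, rvs, n₀, (nTrue, nFalse))`, predicted to `n₀` -/
  | br (c : Cond) (rvs : List (Operand (TReg R) V L)) (n₀ nTrue nFalse : V)
  /-- resolved conditional branch or indirect jump -/
  | jump (n₀ : V)
  /-- `r = load(rvs)` at program point `n` -/
  | load (r : TReg R) (rvs : List (Operand (TReg R) V L)) (n : V)
  /-- `r = load(rvs, (v, j))` at program point `n`: value `v` predicted to come from store `j` -/
  | loadPartial (r : TReg R) (rvs : List (Operand (TReg R) V L)) (v : LVal V L) (j : ℕ) (n : V)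
  /-- `store(rv, a)`; the value is resolved if `rv` is a value -/
  | store (rv : Operand (TReg R) V L) (a : StoreAddr V L R)
  /-- `jmpi(rvs, n₀)`, predicted to `n₀` -/
  | jmpi (rvs : List (Operand (TReg R) V L)) (n₀ : V)
  | call
  | ret
  | fence

namespace Transient

variable {V L R Op Cond : Type*}

/-- The register that a transient instruction assigns, if any. -/
def dest : Transient V L R Op Cond → Option (TReg R)
  | .op r _ _ => some r
  | .val r _ _ => some r
  | .load r _ _ => some r
  | .loadPartial r _ _ _ _ => some r
  | _ => none

/-- The value that an assignment provides to later instructions, if it is (at least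
predictively) known. -/
def value : Transient V L R Op Cond → Option (LVal V L)
  | .val _ v _ => some v
  | .loadPartial _ _ v _ _ => some v
  | _ => none

/-- The instruction is a store whose address is resolved to `a`. -/
def StoresTo (t : Transient V L R Op Cond) (a : V) : Prop :=
  ∃ rv l, t = .store rv (.resolved (a, l))

end Transient

/-- Commands recorded in the return stack buffer. -/
inductive RsbCmd (V : Type*)
  | push (n : V)
  | pop

/-- The effect of one command on the return stack (a list, top first). -/
def RsbCmd.apply {V : Type*} (st : List V) : RsbCmd V → List V
  | .push n => n :: st
  | .pop => st.tail

/-- The predicted return address: the top of the stack obtained by applying the commands of the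
return stack buffer in the order of their indices, if that stack is non-empty. -/
noncomputable def rsbTop {V : Type*} (rsb : IdxMap (RsbCmd V)) : Option V :=
  (rsb.entries.foldl RsbCmd.apply []).head?

/-- Configurations: registers, memory, program point, reorder buffer, return stack buffer. -/
structure Config (V L R Op Cond : Type*) where
  reg : R → Option (LVal V L)
  mem : V → Option (LVal V L)
  pc : V
  buf : IdxMap (Transient V L R Op Cond)
  rsb : IdxMap (RsbCmd V)

/-- Attacker directives. -/
inductive Directive (V : Type*)
  | fetch
  /-- `fetch: b`, with a guess for a conditional branch -/
  | fetchBranch (b : Bool)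
  /-- `fetch: n'`, with a guess for a jump target -/
  | fetchTarget (n' : V)
  /-- `execute i` -/
  | execute (i : ℕ)
  /-- `execute i : value` -/
  | executeValue (i : ℕ)
  /-- `execute i : addr` -/
  | executeAddr (i : ℕ)
  /-- `execute i : fwd j` -/
  | executeFwd (i j : ℕ)
  | retire

namespace Directive

variable {V : Type*}

/-- The fetch directives, with or without a guess. -/
def IsFetch : Directive V → Prop
  | .fetch => True
  | .fetchBranch _ => True
  | .fetchTarget _ => True
  | _ => False

/-- Test for the directive `retire`. -/
def isRetire : Directive V → Bool
  | .retire => true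
  | _ => false

end Directive

/-- The number `N` of instructions that a schedule retires. -/
def numRetired {V : Type*} (D : List (Directive V)) : ℕ := D.countP Directive.isRetire

/-- Observations. -/
inductive Obs (V L : Type*)
  | read (a : LVal V L)
  | fwd (a : LVal V L)
  | write (a : LVal V L)
  | jump (n : LVal V L)
  | rollback

section Semantics

variable {V L R Op Cond : Type*}

/-- The register resolve function at index `i`, extended to values, as a relation: the
latest assignment before `i` provides the value; if there is no pending assignment, the register
file does. -/
inductive Resolves (buf : IdxMap (Transient V L R Op Cond)) (reg : R → Option (LVal V L)) (i : ℕ) :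
    Operand (TReg R) V L → LVal V L → Prop
  | val (v : LVal V L) : Resolves buf reg i (.val v) v
  | pending {r : TReg R} {v : LVal V L} (j : ℕ) (t : Transient V L R Op Cond)
      (hj : j < i) (ht : buf.get j = some t) (hr : t.dest = some r)
      (hlast : ∀ k t', j < k → k < i → buf.get k = some t' → t'.dest ≠ some r)
      (hv : t.value = some v) : Resolves buf reg i (.reg r) v
  | file {r : R} {v : LVal V L}
      (hnone : ∀ k t', k < i → buf.get k = some t' → t'.dest ≠ some (.arch r))
      (hv : reg r = some v) : Resolves buf reg i (.reg (.arch r)) v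

/-- Pointwise lifting of `Resolves` to lists. -/
def ResolvesList (buf : IdxMap (Transient V L R Op Cond)) (reg : R → Option (LVal V L)) (i : ℕ)
    (rvs : List (Operand (TReg R) V L)) (vs : List (LVal V L)) : Prop :=
  List.Forall₂ (Resolves buf reg i) rvs vs

/-- There is no fence in the buffer before index `i`. -/
def NoFence (buf : IdxMap (Transient V L R Op Cond)) (i : ℕ) : Prop :=
  ∀ j t, j < i → buf.get j = some t → t ≠ .fence

/-- There is no store to the resolved address `a` in the buffer before index `i`. -/
def NoStoreTo (buf : IdxMap (Transient V L R Op Cond)) (i : ℕ) (a : V) : Prop :=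
  ∀ j t, j < i → buf.get j = some t → ¬ t.StoresTo a

/-- The operands of the instruction at index `i` resolve (and no fence blocks it) to an address
`a` with label `l`. -/
def ResolvesAddr (M : Machine V R Op Cond) [SemilatticeSup L] [OrderBot L]
    (C : Config V L R Op Cond) (i : ℕ) (rvs : List (Operand (TReg R) V L)) (a : LVal V L) : Prop :=
  NoFence C.buf i ∧ ∃ vs, ResolvesList C.buf C.reg i rvs vs ∧
    M.addr (vs.map Prod.fst) = some a.1 ∧ a.2 = joinLabels vs

/-- The buffer entry `k` is a resolved load that was wrong if the store at `i < k` turns out to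
have the address `a`: it should have received the value of that store (or of a later one), or it
received the value of that store although the addresses differ. -/
def Hazard (buf : IdxMap (Transient V L R Op Cond)) (i : ℕ) (a : V) (k : ℕ) (n : V) : Prop :=
  i < k ∧ ∃ r v tag, buf.get k = some (.val r v (some tag)) ∧ tag.pc = n ∧
    ((tag.addr = a ∧ tag.dep < (i : WithBot ℕ)) ∨ (tag.dep = (i : WithBot ℕ) ∧ tag.addr ≠ a))

/-- The index at which the next instruction is inserted. -/
noncomputable def freshIdx (C : Config V L R Op Cond) : ℕ := C.buf.maxIdx + 1

/-- The oldest entry of the reorder buffer is `t`, at index `i`. -/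
def Oldest (C : Config V L R Op Cond) (i : ℕ) (t : Transient V L R Op Cond) : Prop :=
  C.buf.minIdx = i ∧ C.buf.get i = some t

variable [DecidableEq V] [DecidableEq R] [SemilatticeSup L] [OrderBot L]

/-- One step `C ↪ C'` under a directive, with the observations that it produces. -/
inductive Step (M : Machine V R Op Cond) (P : Program V L R Op Cond) :
    Config V L R Op Cond → Directive V → List (Obs V L) → Config V L R Op Cond → Prop
  -- arithmetic operations
  | op_fetch {C : Config V L R Op Cond} {o r rvs n'}
      (hP : P C.pc = some (.op o r rvs n')) :
      Step M P C .fetch []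
        { C with
          pc := n'
          buf := C.buf.set (freshIdx C) (.op (.arch r) o (rvs.map Operand.lift)) }
  | op_execute {C : Config V L R Op Cond} {i r o rvs vs v}
      (hi : C.buf.get i = some (.op r o rvs)) (hf : NoFence C.buf i)
      (hrv : ResolvesList C.buf C.reg i rvs vs)
      (hv : M.evalOp o (vs.map Prod.fst) = some v) :
      Step M P C (.execute i) []
        { C with buf := C.buf.set i (.val r (v, joinLabels vs) none) }
  | val_retire {C : Config V L R Op Cond} {i r v tag}
      (hi : Oldest C i (.val (.arch r) v tag)) :
      Step M P C .retire []
        { C with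
          reg := Function.update C.reg r (some v)
          buf := C.buf.restrict (· ≠ i) }
  -- conditional branches
  | br_fetch {C : Config V L R Op Cond} {c rvs nTrue nFalse} (b : Bool)
      (hP : P C.pc = some (.br c rvs nTrue nFalse)) :
      Step M P C (.fetchBranch b) []
        { C with
          pc := if b then nTrue else nFalse
          buf := C.buf.set (freshIdx C)
            (.br c (rvs.map Operand.lift) (if b then nTrue else nFalse) nTrue nFalse) }
  | br_execute_correct {C : Config V L R Op Cond} {i c rvs n₀ nTrue nFalse vs b}
      (hi : C.buf.get i = some (.br c rvs n₀ nTrue nFalse)) (hf : NoFence C.buf i)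
      (hrv : ResolvesList C.buf C.reg i rvs vs)
      (hb : M.evalCond c (vs.map Prod.fst) = some b)
      (hn : (if b then nTrue else nFalse) = n₀) :
      Step M P C (.execute i) [.jump (n₀, joinLabels vs)]
        { C with buf := C.buf.set i (.jump n₀) }
  | br_execute_incorrect {C : Config V L R Op Cond} {i c rvs n₀ nTrue nFalse vs b n'}
      (hi : C.buf.get i = some (.br c rvs n₀ nTrue nFalse)) (hf : NoFence C.buf i)
      (hrv : ResolvesList C.buf C.reg i rvs vs)
      (hb : M.evalCond c (vs.map Prod.fst) = some b)
      (hn' : (if b then nTrue else nFalse) = n') (hn : n' ≠ n₀) :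
      Step M P C (.execute i) [.rollback, .jump (n', joinLabels vs)]
        { C with
          pc := n'
          buf := (C.buf.restrict (· < i)).set i (.jump n')
          rsb := C.rsb.restrict (· < i) }
  | jump_retire {C : Config V L R Op Cond} {i n₀} (hi : Oldest C i (.jump n₀)) :
      Step M P C .retire [] { C with buf := C.buf.restrict (· ≠ i) }
  -- indirect jumps
  | jmpi_fetch {C : Config V L R Op Cond} {rvs} (n' : V) (hP : P C.pc = some (.jmpi rvs)) :
      Step M P C (.fetchTarget n') []
        { C with
          pc := n'
          buf := C.buf.set (freshIdx C) (.jmpi (rvs.map Operand.lift) n') }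
  | jmpi_execute_correct {C : Config V L R Op Cond} {i rvs n₀ l}
      (hi : C.buf.get i = some (.jmpi rvs n₀)) (ha : ResolvesAddr M C i rvs (n₀, l)) :
      Step M P C (.execute i) [.jump (n₀, l)]
        { C with buf := C.buf.set i (.jump n₀) }
  | jmpi_execute_incorrect {C : Config V L R Op Cond} {i rvs n₀ n' l}
      (hi : C.buf.get i = some (.jmpi rvs n₀)) (ha : ResolvesAddr M C i rvs (n', l))
      (hn : n' ≠ n₀) :
      Step M P C (.execute i) [.rollback, .jump (n', l)]
        { C with
          pc := n'
          buf := (C.buf.restrict (· < i)).set i (.jump n')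
          rsb := C.rsb.restrict (· < i) }
  -- loads
  | load_fetch {C : Config V L R Op Cond} {r rvs n'}
      (hP : P C.pc = some (.load r rvs n')) :
      Step M P C .fetch []
        { C with
          pc := n'
          buf := C.buf.set (freshIdx C) (.load (.arch r) (rvs.map Operand.lift) C.pc) }
  | load_execute_nodep {C : Config V L R Op Cond} {i r rvs n a l v}
      (hi : C.buf.get i = some (.load r rvs n)) (ha : ResolvesAddr M C i rvs (a, l))
      (hs : NoStoreTo C.buf i a) (hv : C.mem a = some v) :
      Step M P C (.execute i) [.read (a, l)]
        { C with buf := C.buf.set i (.val r v (some ⟨⊥, a, n⟩)) }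
  | load_execute_forward {C : Config V L R Op Cond} {i r rvs n a l j v l'}
      (hi : C.buf.get i = some (.load r rvs n)) (ha : ResolvesAddr M C i rvs (a, l))
      (hji : j < i) (hj : C.buf.get j = some (.store (.val v) (.resolved (a, l'))))
      (hlast : ∀ k t, j < k → k < i → C.buf.get k = some t → ¬ t.StoresTo a) :
      Step M P C (.execute i) [.fwd (a, l)]
        { C with buf := C.buf.set i (.val r v (some ⟨(j : WithBot ℕ), a, n⟩)) }
  -- loads with predicted aliasing
  | load_execute_guess {C : Config V L R Op Cond} {i j r rvs n v sa}
      (hi : C.buf.get i = some (.load r rvs n)) (hf : NoFence C.buf i)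
      (hji : j < i) (hj : C.buf.get j = some (.store (.val v) sa)) :
      Step M P C (.executeFwd i j) []
        { C with buf := C.buf.set i (.loadPartial r rvs v j n) }
  | load_execute_addr_ok {C : Config V L R Op Cond} {i r rvs v j n a l sa}
      (hi : C.buf.get i = some (.loadPartial r rvs v j n))
      (ha : ResolvesAddr M C i rvs (a, l))
      (hj : C.buf.get j = some (.store (.val v) sa))
      (hsa : ∀ a' l', sa = .resolved (a', l') → a' = a)
      (hbetween : ∀ k t, j < k → k < i → C.buf.get k = some t → ¬ t.StoresTo a) :
      Step M P C (.execute i) [.fwd (a, l)]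
        { C with buf := C.buf.set i (.val r v (some ⟨(j : WithBot ℕ), a, n⟩)) }
  | load_execute_addr_hazard {C : Config V L R Op Cond} {i r rvs v j n a l}
      (hi : C.buf.get i = some (.loadPartial r rvs v j n))
      (ha : ResolvesAddr M C i rvs (a, l))
      (hz : (∃ rv a' l', C.buf.get j = some (.store rv (.resolved (a', l'))) ∧ a' ≠ a) ∨
        ∃ k t, j < k ∧ k < i ∧ C.buf.get k = some t ∧ t.StoresTo a) :
      Step M P C (.execute i) [.rollback, .fwd (a, l)]
        { C with
          pc := n
          buf := C.buf.restrict (· < i)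
          rsb := C.rsb.restrict (· < i) }
  | load_execute_mem_match {C : Config V L R Op Cond} {i r rvs v j n a l}
      (hi : C.buf.get i = some (.loadPartial r rvs v j n))
      (ha : ResolvesAddr M C i rvs (a, l))
      (hj : C.buf.get j = none) (hs : NoStoreTo C.buf i a) (hv : C.mem a = some v) :
      Step M P C (.execute i) [.read (a, l)]
        { C with buf := C.buf.set i (.val r v (some ⟨⊥, a, n⟩)) }
  | load_execute_mem_hazard {C : Config V L R Op Cond} {i r rvs v j n a l v'}
      (hi : C.buf.get i = some (.loadPartial r rvs v j n))
      (ha : ResolvesAddr M C i rvs (a, l))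
      (hj : C.buf.get j = none) (hs : NoStoreTo C.buf i a) (hv : C.mem a = some v')
      (hne : v' ≠ v) :
      Step M P C (.execute i) [.rollback, .read (a, l)]
        { C with
          pc := n
          buf := C.buf.restrict (· < i)
          rsb := C.rsb.restrict (· < i) }
  -- stores
  | store_fetch {C : Config V L R Op Cond} {rv rvs n'}
      (hP : P C.pc = some (.store rv rvs n')) :
      Step M P C .fetch []
        { C with
          pc := n'
          buf := C.buf.set (freshIdx C)
            (.store rv.lift (.unresolved (rvs.map Operand.lift))) }
  | store_execute_value {C : Config V L R Op Cond} {i rv sa v}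
      (hi : C.buf.get i = some (.store rv sa)) (hf : NoFence C.buf i)
      (hv : Resolves C.buf C.reg i rv v) :
      Step M P C (.executeValue i) []
        { C with buf := C.buf.set i (.store (.val v) sa) }
  | store_execute_addr_ok {C : Config V L R Op Cond} {i rv rvs a l}
      (hi : C.buf.get i = some (.store rv (.unresolved rvs)))
      (ha : ResolvesAddr M C i rvs (a, l))
      (hok : ∀ k n, ¬ Hazard C.buf i a k n) :
      Step M P C (.executeAddr i) [.fwd (a, l)]
        { C with buf := C.buf.set i (.store rv (.resolved (a, l))) }
  | store_execute_addr_hazard {C : Config V L R Op Cond} {i rv rvs a l k n}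
      (hi : C.buf.get i = some (.store rv (.unresolved rvs)))
      (ha : ResolvesAddr M C i rvs (a, l))
      (hk : Hazard C.buf i a k n) (hmin : ∀ k' n', k' < k → ¬ Hazard C.buf i a k' n') :
      Step M P C (.executeAddr i) [.rollback, .fwd (a, l)]
        { C with
          pc := n
          buf := (C.buf.restrict (· < k)).set i (.store rv (.resolved (a, l)))
          rsb := C.rsb.restrict (· < k) }
  | store_retire {C : Config V L R Op Cond} {i v a l}
      (hi : Oldest C i (.store (.val v) (.resolved (a, l)))) :
      Step M P C .retire [.write (a, l)]
        { C with
          mem := Function.update C.mem a (some v)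
          buf := C.buf.restrict (· ≠ i) }
  -- fences
  | fence_fetch {C : Config V L R Op Cond} {n'} (hP : P C.pc = some (.fence n')) :
      Step M P C .fetch []
        { C with
          pc := n'
          buf := C.buf.set (freshIdx C) .fence }
  | fence_retire {C : Config V L R Op Cond} {i} (hi : Oldest C i .fence) :
      Step M P C .retire [] { C with buf := C.buf.restrict (· ≠ i) }
  -- calls
  | call_fetch {C : Config V L R Op Cond} {nf nret i}
      (hP : P C.pc = some (.call nf nret)) (hi : i = freshIdx C) :
      Step M P C .fetch []
        { C with
          pc := nf
          buf := ((C.buf.set i .call).set (i + 1)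
            (.op (.arch M.rsp) M.succ [.reg (.arch M.rsp)])).set (i + 2)
            (.store (.val (nret, ⊥)) (.unresolved [.reg (.arch M.rsp)]))
          rsb := C.rsb.set i (.push nret) }
  | call_retire {C : Config V L R Op Cond} {i vsp tag v a l}
      (hi : Oldest C i .call)
      (h1 : C.buf.get (i + 1) = some (.val (.arch M.rsp) vsp tag))
      (h2 : C.buf.get (i + 2) = some (.store (.val v) (.resolved (a, l)))) :
      Step M P C .retire [.write (a, l)]
        { C with
          reg := Function.update C.reg M.rsp (some vsp)
          mem := Function.update C.mem a (some v)
          buf := C.buf.restrict (i + 2 < ·) }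
  -- returns
  | ret_fetch {C : Config V L R Op Cond} {i n'}
      (hP : P C.pc = some .ret) (ht : rsbTop C.rsb = some n') (hi : i = freshIdx C) :
      Step M P C .fetch []
        { C with
          pc := n'
          buf := (((C.buf.set i .ret).set (i + 1)
            (.load .ret [.reg (.arch M.rsp)] C.pc)).set (i + 2)
            (.op (.arch M.rsp) M.pred [.reg (.arch M.rsp)])).set (i + 3)
            (.jmpi [.reg .ret] n')
          rsb := C.rsb.set i .pop }
  | ret_fetch_empty {C : Config V L R Op Cond} {i} (n' : V)
      (hP : P C.pc = some .ret) (ht : rsbTop C.rsb = none) (hi : i = freshIdx C) :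
      Step M P C (.fetchTarget n') []
        { C with
          pc := n'
          buf := (((C.buf.set i .ret).set (i + 1)
            (.load .ret [.reg (.arch M.rsp)] C.pc)).set (i + 2)
            (.op (.arch M.rsp) M.pred [.reg (.arch M.rsp)])).set (i + 3)
            (.jmpi [.reg .ret] n')
          rsb := C.rsb.set i .pop }
  | ret_retire {C : Config V L R Op Cond} {i v₁ tag₁ v₂ tag₂ n'}
      (hi : Oldest C i .ret)
      (h1 : C.buf.get (i + 1) = some (.val .ret v₁ tag₁))
      (h2 : C.buf.get (i + 2) = some (.val (.arch M.rsp) v₂ tag₂))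
      (h3 : C.buf.get (i + 3) = some (.jump n')) :
      Step M P C .retire []
        { C with
          reg := Function.update C.reg M.rsp (some v₂)
          buf := C.buf.restrict (i + 3 < ·) }

/-- Execution of `C` under the schedule `D`, producing the trace `O` and ending in `C'`. -/
inductive Run (M : Machine V R Op Cond) (P : Program V L R Op Cond) :
    Config V L R Op Cond → List (Directive V) → List (Obs V L) → Config V L R Op Cond → Prop
  | nil (C : Config V L R Op Cond) : Run M P C [] [] C
  | cons {C C₁ C₂ : Config V L R Op Cond} {d D o O} (hstep : Step M P C d o C₁)
      (hrun : Run M P C₁ D O C₂) : Run M P C (d :: D) (o ++ O) C₂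

/-- `D` is a well-formed schedule for `C`: execution of `C` under `D` is possible. -/
def WellFormed (M : Machine V R Op Cond) (P : Program V L R Op Cond)
    (D : List (Directive V)) (C : Config V L R Op Cond) : Prop :=
  ∃ O C₁, Run M P C D O C₁

/-- A configuration is initial if its reorder buffer is empty. -/
def Config.IsInitial (C : Config V L R Op Cond) : Prop := C.buf.dom = ∅

/-- A configuration is terminal if its reorder buffer is empty. -/
def Config.IsTerminal (C : Config V L R Op Cond) : Prop := C.buf.dom = ∅

/-- An execution in which every fetch happens with an empty reorder buffer, that is, after all
instructions fetched before have been executed and retired. -/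
inductive SeqRun (M : Machine V R Op Cond) (P : Program V L R Op Cond) :
    Config V L R Op Cond → List (Directive V) → List (Obs V L) → Config V L R Op Cond → Prop
  | nil (C : Config V L R Op Cond) : SeqRun M P C [] [] C
  | cons {C C₁ C₂ : Config V L R Op Cond} {d D o O}
      (hfetch : d.IsFetch → C.buf.dom = ∅) (hstep : Step M P C d o C₁)
      (hrun : SeqRun M P C₁ D O C₂) : SeqRun M P C (d :: D) (o ++ O) C₂

/-- Sequential execution: from an initial configuration, under a sequential schedule, to a
terminal configuration. -/
def SeqExec (M : Machine V R Op Cond) (P : Program V L R Op Cond)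
    (C : Config V L R Op Cond) (D : List (Directive V)) (O : List (Obs V L))
    (C' : Config V L R Op Cond) : Prop :=
  C.IsInitial ∧ SeqRun M P C D O C' ∧ C'.IsTerminal

/-- Two contents of a register or memory cell are low-equivalent: both are undefined, or they
have the same label and, if this label is `public = ⊥`, the same value. -/
def LowEqCell (x y : Option (LVal V L)) : Prop :=
  x.map Prod.snd = y.map Prod.snd ∧ (x.map Prod.snd = some ⊥ → x = y)

/-- Low-equivalence of configurations: registers and memories coincide on public values. The
program point, the return stack buffer and the set of occupied indices of the
reorder buffer are public. -/
def LowEq (C C' : Config V L R Op Cond) : Prop :=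
  (∀ r, LowEqCell (C.reg r) (C'.reg r)) ∧ (∀ a, LowEqCell (C.mem a) (C'.mem a)) ∧
    C.pc = C'.pc ∧ C.rsb = C'.rsb ∧ C.buf.dom = C'.buf.dom

/-- Speculative constant-time of `C` with respect to the schedule `D`. -/
def SpeculativeConstantTime (M : Machine V R Op Cond) (P : Program V L R Op Cond)
    (D : List (Directive V)) (C : Config V L R Op Cond) : Prop :=
  ∀ C' : Config V L R Op Cond, LowEq C C' →
    (∀ O C₁, Run M P C D O C₁ → ∃ O' C₁', Run M P C' D O' C₁' ∧ LowEq C₁ C₁' ∧ O = O') ∧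
    (∀ O' C₁', Run M P C' D O' C₁' → ∃ O C₁, Run M P C D O C₁ ∧ LowEq C₁ C₁' ∧ O = O')

/-- Sequential constant-time of `C` for `N` retired instructions: sequential execution of `N`
instructions from `C` is possible, and under every sequential schedule `D` that retires `N`
instructions, `C` and every low-equivalent `C'` execute with equal traces to
low-equivalent final configurations. -/
def SequentiallyConstantTime (M : Machine V R Op Cond) (P : Program V L R Op Cond)
    (N : ℕ) (C : Config V L R Op Cond) : Prop :=
  (∃ D O C₂, numRetired D = N ∧ SeqExec M P C D O C₂) ∧
  ∀ C' : Config V L R Op Cond, LowEq C C' → ∀ D, numRetired D = N →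
    (∀ O C₂, SeqExec M P C D O C₂ →
      ∃ O' C₂', SeqExec M P C' D O' C₂' ∧ LowEq C₂ C₂' ∧ O = O') ∧
    (∀ O' C₂', SeqExec M P C' D O' C₂' →
      ∃ O C₂, SeqExec M P C D O C₂ ∧ LowEq C₂ C₂' ∧ O = O')

end Semantics

end SpecCT

/-! Whatever the schedule, the retired instructions form an execution in program order, and the
addresses and jump targets of that execution show up in the speculative trace. Equal speculative
traces therefore force equal addresses and targets for the first `numRetired D` instructions in
program order. Apart from labels, which low-equivalence fixes, a sequential execution reveals
nothing else.

The first claim is an invariant. `Correct M P C p` says that the buffer holds the instructions of a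
program path from `p`, each entry in a stage of execution that is justified by the entries before
it, the register file and the memory. Execute steps either refine entries, which keeps all
justifications valid, or roll back, which removes the entries that depend on a refuted guess
(`Step.of_execute`, `Correct.step`). Retiring the oldest instruction turns its justification into an
`ArchStep`, a step of a machine without speculation; the values that this step reveals are read off
the buffer by `bufLeak` (`Step.retire_group`, `Correct.retire`).

For the second claim, `LowEq` is too weak to be carried through a run, since of the buffers it
compares only the domains. `Sim` compares entries: they agree up to secret data, and their
annotations, resolved addresses and jump targets are equal. Steps under the same directive need not
preserve `Sim`, because an address may depend on a secret; but every address or target is observed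
at the moment it is resolved, and the kind of the observations, above all a leading `rollback`,
tells which rule was applied. So equal traces keep two runs in `Sim` (`Sim.step`). Related buffers
have equal `bufLeak`, and `chain_of_run` collects the retirements of both runs in a `Chain`: pairs
of program-order steps with the same revealed values.

It remains to pass from a `Chain` to sequential executions. In these the buffer holds the entries of
a single instruction (`InGroup`), and no instruction both loads and stores, so neither forwarding
nor value prediction occurs. Whatever an execute step computes, the current `ArchStep` of the chain
computes as well. Hence a step that is possible on one side is possible on the other, with the same
observations (`Sim.exists_execute`), and whole executions can be replayed (`Sim.exists_seqRun`). A
sequential execution exists because each `ArchStep` can be carried out by the machine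
(`ArchStep.exists_seqRun`), applied to the chain of `C` with itself. The exchanged roles are covered
by the symmetry of `Chain`. -/

namespace SpecCT

/-! ### Index maps: lookups, least and greatest index. -/

namespace IdxMap

variable {α : Type*}

@[simp] theorem get_set (m : IdxMap α) (i : ℕ) (t : α) (j : ℕ) :
    (m.set i t).get j = if j = i then some t else m.get j := by
  simp [IdxMap.set, Function.update_apply]

@[simp] theorem get_restrict (m : IdxMap α) (p : ℕ → Prop) [DecidablePred p] (j : ℕ) :
    (m.restrict p).get j = if p j then m.get j else none := rfl

theorem dom_eq_empty_iff {m : IdxMap α} : m.dom = ∅ ↔ ∀ k, m.get k = none := by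
  simp [dom, Set.eq_empty_iff_forall_notMem]

theorem minIdx_eq {m : IdxMap α} {i : ℕ} (h : ∀ k < i, m.get k = none) (hi : m.get i ≠ none) :
    m.minIdx = i := by
  refine le_antisymm (Nat.sInf_le hi) ?_
  by_contra hlt
  exact Nat.sInf_mem (s := m.dom) ⟨i, hi⟩ (h _ (not_le.1 hlt))

theorem maxIdx_add_one_eq {m : IdxMap α} {h : ℕ} (h1 : 1 ≤ h) (hn : ∀ k, h ≤ k → m.get k = none)
    (hs : m.get (h - 1) ≠ none) : m.maxIdx + 1 = h := by
  have hb : BddAbove m.dom := m.finite.bddAbove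
  have h2 : h - 1 ≤ m.maxIdx := le_csSup hb hs
  have h3 : m.maxIdx ∈ m.dom := Nat.sSup_mem ⟨_, hs⟩ hb
  have h4 : ¬ h ≤ m.maxIdx := fun hle => h3 (hn _ hle)
  omega

theorem get_of_maxIdx_lt {m : IdxMap α} {k : ℕ} (h : m.maxIdx < k) : m.get k = none := by
  by_contra hk
  exact absurd (le_csSup m.finite.bddAbove hk : k ≤ m.maxIdx) (not_le.2 h)

theorem maxIdx_of_dom_eq_empty {m : IdxMap α} (h : m.dom = ∅) : m.maxIdx = 0 := by
  simp [maxIdx, h]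

/-- Single entries retire by deletion of one index, calls and returns by a cut above their last
index. Below the oldest entry there is nothing to delete, so every retirement is a sequence of cuts,
as in `Config.pop`. -/
theorem restrict_ne_eq {m : IdxMap α} {i : ℕ} (h : ∀ j < i, m.get j = none) :
    m.restrict (· ≠ i) = m.restrict (i < ·) := by
  ext1
  funext j
  rcases lt_trichotomy i j with hj | rfl | hj
  · simp [hj, hj.ne']
  · simp
  · simp [hj.not_gt, h j hj]

end IdxMap

/-! ### Stages of execution of a buffer entry. -/

section Correctness

variable {V L R Op Cond : Type*}

namespace Transient

/-- The operands that an instruction reads. -/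
def operands : Transient V L R Op Cond → List (Operand (TReg R) V L)
  | .op _ _ rvs => rvs
  | .br _ rvs _ _ _ => rvs
  | .load _ rvs _ => rvs
  | .store rv (.unresolved rvs) => rv :: rvs
  | .jmpi rvs _ => rvs
  | _ => []

/-- The instruction is in the form in which it is fetched. -/
def IsSource : Transient V L R Op Cond → Prop
  | .val _ _ _ => False
  | .jump _ => False
  | .loadPartial _ _ _ _ _ => False
  | .store _ (.resolved _) => False
  | _ => True

/-- The addresses and jump targets that a resolved instruction reveals. -/
def leak : Transient V L R Op Cond → List V
  | .val _ _ (some tag) => [tag.addr]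
  | .jump n => [n]
  | .store _ (.resolved a) => [a.1]
  | _ => []

end Transient

theorem Operand.lift_ne_ret (rv : Operand R V L) : rv.lift ≠ .reg .ret := by
  cases rv <;> simp [Operand.lift]

/-! ### Resolution of operands -/

theorem Resolves.det {buf : IdxMap (Transient V L R Op Cond)} {reg : R → Option (LVal V L)}
    {i : ℕ} {rv : Operand (TReg R) V L} {v w : LVal V L} (h : Resolves buf reg i rv v)
    (h' : Resolves buf reg i rv w) : v = w := by
  cases h with
  | val v => cases h'; rfl
  | pending j t hj ht hr hlast hv =>
    cases h' with
    | pending j' t' hj' ht' hr' hlast' hv' =>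
      rcases lt_trichotomy j j' with hlt | rfl | hlt
      · exact absurd hr' (hlast _ _ hlt hj' ht')
      · simp_all
      · exact absurd hr (hlast' _ _ hlt hj ht)
    | file hnone hv' => exact absurd hr (hnone _ _ hj ht)
  | file hnone hv =>
    cases h' with
    | pending j' t' hj' ht' hr' hlast' hv' => exact absurd hr' (hnone _ _ hj' ht')
    | file hnone' hv' => simp_all

theorem Resolves.value_eq {buf : IdxMap (Transient V L R Op Cond)} {reg : R → Option (LVal V L)}
    {i j : ℕ} {r : TReg R} {v : LVal V L} {t : Transient V L R Op Cond}
    (h : Resolves buf reg i (.reg r) v) (hj : j < i) (ht : buf.get j = some t)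
    (hd : t.dest = some r)
    (hlast : ∀ k u, j < k → k < i → buf.get k = some u → u.dest ≠ some r) :
    t.value = some v := by
  cases h with
  | pending j' t' hj' ht' hd' hlast' hv =>
    rcases lt_trichotomy j j' with hlt | rfl | hlt
    · exact absurd hd' (hlast _ _ hlt hj' ht')
    · cases ht.symm.trans ht'
      exact hv
    · exact absurd hd (hlast' _ _ hlt hj ht)
  | file hnone => exact absurd hd (hnone _ _ hj ht)

theorem ResolvesList.det {buf : IdxMap (Transient V L R Op Cond)} {reg : R → Option (LVal V L)}
    {i : ℕ} {rvs : List (Operand (TReg R) V L)} {vs ws : List (LVal V L)}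
    (h : ResolvesList buf reg i rvs vs) (h' : ResolvesList buf reg i rvs ws) : vs = ws := by
  induction h generalizing ws with
  | nil => cases h'; rfl
  | cons h1 _ ih => cases h' with | cons h1' h2' => rw [h1.det h1', ih h2']

theorem resolvesList_singleton {buf : IdxMap (Transient V L R Op Cond)}
    {reg : R → Option (LVal V L)} {i : ℕ} {rv : Operand (TReg R) V L} {vs : List (LVal V L)} :
    ResolvesList buf reg i [rv] vs ↔ ∃ v, vs = [v] ∧ Resolves buf reg i rv v := by
  constructor
  · intro h
    cases h with | cons h1 h2 => cases h2; exact ⟨_, rfl, h1⟩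
  · rintro ⟨v, rfl, h⟩
    exact .cons h .nil

theorem ResolvesList.mono {buf buf' : IdxMap (Transient V L R Op Cond)}
    {reg reg' : R → Option (LVal V L)} {i i' : ℕ} {rvs : List (Operand (TReg R) V L)}
    {vs : List (LVal V L)} (h : ResolvesList buf reg i rvs vs)
    (H : ∀ rv ∈ rvs, ∀ v, Resolves buf reg i rv v → Resolves buf' reg' i' rv v) :
    ResolvesList buf' reg' i' rvs vs := by
  induction h with
  | nil => exact .nil
  | cons h1 _ ih =>
    exact .cons (H _ (by simp) _ h1) (ih fun rv hrv => H rv (by simp [hrv]))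

theorem resolves_arch_iff {buf : IdxMap (Transient V L R Op Cond)} {reg : R → Option (LVal V L)}
    {i : ℕ} {r : R} {v : LVal V L}
    (h : ∀ k t, k < i → buf.get k = some t → t.dest ≠ some (.arch r)) :
    Resolves buf reg i (.reg (.arch r)) v ↔ reg r = some v := by
  refine ⟨fun hr => ?_, fun hr => .file h hr⟩
  cases hr with
  | pending j t hj ht hr hlast hv => exact absurd hr (h _ _ hj ht)
  | file _ hv => exact hv

/-- Operands evaluated in a register file. -/
def ArchResolves (Op Cond : Type*) (reg : R → Option (LVal V L)) :
    List (Operand (TReg R) V L) → List (LVal V L) → Prop :=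
  ResolvesList (IdxMap.empty : IdxMap (Transient V L R Op Cond)) reg 0

theorem resolves_lift_congr {buf buf' : IdxMap (Transient V L R Op Cond)}
    {reg : R → Option (LVal V L)} {i i' : ℕ} {rv : Operand R V L} {v : LVal V L}
    (h : ∀ k < i, buf.get k = none) (h' : ∀ k < i', buf'.get k = none) :
    Resolves buf reg i rv.lift v ↔ Resolves buf' reg i' rv.lift v := by
  cases rv with
  | reg r =>
    rw [Operand.lift, resolves_arch_iff (fun k t hk ht => by simp [h k hk] at ht),
      resolves_arch_iff (fun k t hk ht => by simp [h' k hk] at ht)]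
  | val w =>
    constructor <;> (intro h; cases h; exact .val _)

theorem resolvesList_iff_archResolves {buf : IdxMap (Transient V L R Op Cond)}
    {reg : R → Option (LVal V L)} {i : ℕ} {rvs : List (Operand R V L)} {vs : List (LVal V L)}
    (h : ∀ k < i, buf.get k = none) :
    ResolvesList buf reg i (rvs.map Operand.lift) vs ↔
      ArchResolves Op Cond reg (rvs.map Operand.lift) vs := by
  unfold ArchResolves ResolvesList
  rw [List.forall₂_map_left_iff, List.forall₂_map_left_iff]
  simp only [resolves_lift_congr h (buf' := IdxMap.empty) (i' := 0) (by simp)]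

/-- `t'` provides at least what `t` provides to later operands. -/
structure Provides (t t' : Transient V L R Op Cond) : Prop where
  dest : t'.dest = t.dest
  value : ∀ v, t.value = some v → t'.value = some v

/-- `t'` looks to loads like `t`. -/
structure StoreLike (t t' : Transient V L R Op Cond) : Prop where
  storesTo : ∀ a, t'.StoresTo a → t.StoresTo a
  store : ∀ v sa, t = .store (.val v) sa → t' = .store (.val v) sa

/-- Before index `k`, the same indices are occupied, with related entries. -/
def BufRel (r : Transient V L R Op Cond → Transient V L R Op Cond → Prop)
    (buf buf' : IdxMap (Transient V L R Op Cond)) (k : ℕ) : Prop :=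
  ∀ j < k, Option.Rel r (buf.get j) (buf'.get j)

theorem BufRel.some_left {r : Transient V L R Op Cond → Transient V L R Op Cond → Prop}
    {buf buf' : IdxMap (Transient V L R Op Cond)} {k j : ℕ} {t : Transient V L R Op Cond}
    (h : BufRel r buf buf' k) (hj : j < k) (ht : buf.get j = some t) :
    ∃ t', buf'.get j = some t' ∧ r t t' := by
  have := h j hj
  rw [ht] at this
  generalize hx : buf'.get j = x at this
  cases this with | some h => exact ⟨_, rfl, h⟩

theorem BufRel.some_right {r : Transient V L R Op Cond → Transient V L R Op Cond → Prop}
    {buf buf' : IdxMap (Transient V L R Op Cond)} {k j : ℕ} {t : Transient V L R Op Cond}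
    (h : BufRel r buf buf' k) (hj : j < k) (ht : buf'.get j = some t) :
    ∃ t', buf.get j = some t' ∧ r t' t := by
  have := h j hj
  rw [ht] at this
  generalize hx : buf.get j = x at this
  cases this with | some h => exact ⟨_, rfl, h⟩

theorem BufRel.of_eq {r : Transient V L R Op Cond → Transient V L R Op Cond → Prop}
    (hr : ∀ t, r t t) {buf buf' : IdxMap (Transient V L R Op Cond)} {k : ℕ}
    (h : ∀ j < k, buf'.get j = buf.get j) : BufRel r buf buf' k := by
  intro j hj
  rw [h j hj]
  cases buf.get j with
  | none => exact .none
  | some t => exact .some (hr t)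

theorem BufRel.set {r : Transient V L R Op Cond → Transient V L R Op Cond → Prop}
    (hr : ∀ t, r t t) {buf : IdxMap (Transient V L R Op Cond)} {i k : ℕ}
    {t t' : Transient V L R Op Cond} (hi : buf.get i = some t) (h : r t t') :
    BufRel r buf (buf.set i t') k := by
  intro j _
  by_cases hji : j = i
  · subst hji
    simpa [hi] using h
  · rw [IdxMap.get_set, if_neg hji]
    cases buf.get j with
    | none => exact .none
    | some t => exact .some (hr t)

theorem Provides.refl (t : Transient V L R Op Cond) : Provides t t := ⟨rfl, fun _ h => h⟩

theorem StoreLike.refl (t : Transient V L R Op Cond) : StoreLike t t :=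
  ⟨fun _ h => h, fun _ _ h => h⟩

/-- Resolution depends only on destinations and on values already known. A refinement keeps all
destinations, so the latest assignment stays at the same index, and it never alters a known value.
-/
theorem Resolves.mono {buf buf' : IdxMap (Transient V L R Op Cond)}
    {reg : R → Option (LVal V L)} {k : ℕ} (hb : BufRel Provides buf buf' k)
    {rv : Operand (TReg R) V L} {v : LVal V L} (h : Resolves buf reg k rv v) :
    Resolves buf' reg k rv v := by
  cases h with
  | val => exact .val _
  | pending j t hj ht hr hlast hv =>
    obtain ⟨t', ht', hp⟩ := hb.some_left hj ht
    refine .pending j t' hj ht' (hp.dest.trans hr) (fun m u hm hk hu => ?_) (hp.value _ hv)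
    obtain ⟨u', hu', hp'⟩ := hb.some_right hk hu
    rw [hp'.dest]
    exact hlast _ _ hm hk hu'
  | file hnone hv =>
    refine .file (fun m u hk hu => ?_) hv
    obtain ⟨u', hu', hp'⟩ := hb.some_right hk hu
    rw [hp'.dest]
    exact hnone _ _ hk hu'

/-! ### Correctness of the entries of the reorder buffer -/

/-- The value `v` is what a load at index `k` from address `a` has to receive, as far as the
resolved store addresses tell: it comes from the store at `dep`, or from memory. -/
def LoadOK (buf : IdxMap (Transient V L R Op Cond)) (mem : V → Option (LVal V L)) (k : ℕ)
    (v : LVal V L) (dep : WithBot ℕ) (a : V) : Prop :=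
  (∃ (j : ℕ) (sa : StoreAddr V L R), dep = (j : WithBot ℕ) ∧ j < k ∧
    buf.get j = some (.store (.val v) sa) ∧ (∀ a' l, sa = .resolved (a', l) → a' = a) ∧
    ∀ m t, j < m → m < k → buf.get m = some t → ¬ t.StoresTo a) ∨
  ((∀ m : ℕ, m < k → buf.get m ≠ none → dep < (m : WithBot ℕ)) ∧ NoStoreTo buf k a ∧
    mem a = some v)

/-- Without a store in front of the load only the memory alternative remains. This is the situation
of a load that belongs to the oldest instruction. -/
theorem LoadOK.mem_eq {buf : IdxMap (Transient V L R Op Cond)} {mem : V → Option (LVal V L)}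
    {k : ℕ} {v : LVal V L} {dep : WithBot ℕ} {a : V} (h : LoadOK buf mem k v dep a)
    (hs : ∀ j < k, ∀ rv sa, buf.get j ≠ some (.store rv sa)) : mem a = some v := by
  rcases h with ⟨j, sa, -, hj, h, -⟩ | ⟨-, -, h⟩
  · exact absurd h (hs _ hj _ _)
  · exact h

/-- A `StoreLike` refinement resolves no new store address and leaves stores with a resolved value
untouched. So the provider survives and no conflicting store appears after it. Resolving an address
is the delicate case, left to `LoadOK.resolve_store`. -/
theorem LoadOK.mono {buf buf' : IdxMap (Transient V L R Op Cond)}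
    {mem : V → Option (LVal V L)} {k : ℕ} (hb : BufRel StoreLike buf buf' k)
    {v : LVal V L} {dep : WithBot ℕ} {a : V} (h : LoadOK buf mem k v dep a) :
    LoadOK buf' mem k v dep a := by
  rcases h with ⟨j, sa, hd, hj, hs, ha, hb'⟩ | ⟨hd, hn, hm⟩
  · left
    obtain ⟨t', ht', hp⟩ := hb.some_left hj hs
    rw [hp.store _ _ rfl] at ht'
    refine ⟨j, sa, hd, hj, ht', ha, fun m t hm hk ht hst => ?_⟩
    obtain ⟨u', hu', hp'⟩ := hb.some_right hk ht
    exact hb' _ _ hm hk hu' (hp'.storesTo _ hst)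
  · right
    refine ⟨fun m hk hm => ?_, fun m t hk ht hst => ?_, hm⟩
    · obtain ⟨t, ht⟩ := Option.ne_none_iff_exists'.1 hm
      obtain ⟨u', hu', -⟩ := hb.some_right hk ht
      exact hd m hk (by simp [hu'])
    · obtain ⟨u', hu', hp'⟩ := hb.some_right hk ht
      exact hn _ _ hk hu' (hp'.storesTo _ hst)

/-- The two cases of the hazard test are the two ways to spoil a load: a store after the provider
turns out to have the address of the load (`h1`), or the provider itself turns out to have another
address (`h2`). In the memory alternative `dep` is below all occupied indices before the load, which
makes `h1` applicable to every earlier store. -/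
theorem LoadOK.resolve_store {buf buf' : IdxMap (Transient V L R Op Cond)}
    {mem : V → Option (LVal V L)} {i k : ℕ} {rv : Operand (TReg R) V L}
    {rvs : List (Operand (TReg R) V L)} {a : V} {l : L}
    (hi : buf.get i = some (.store rv (.unresolved rvs)))
    (hb : ∀ m < k, buf'.get m =
      if m = i then some (.store rv (.resolved (a, l))) else buf.get m)
    {v : LVal V L} {dep : WithBot ℕ} {a' : V} (h : LoadOK buf mem k v dep a')
    (h1 : i < k → ¬ (a' = a ∧ dep < (i : WithBot ℕ)))
    (h2 : i < k → ¬ (dep = (i : WithBot ℕ) ∧ a' ≠ a)) : LoadOK buf' mem k v dep a' := by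
  rcases h with ⟨j, sa, rfl, hj, hs, ha, hbt⟩ | ⟨hd, hn, hm⟩
  · left
    have hb' : ∀ m t, j < m → m < k → buf'.get m = some t → ¬ t.StoresTo a' := by
      intro m t hjm hmk ht hst
      rw [hb m hmk] at ht
      by_cases hmi : m = i
      · subst hmi
        obtain ⟨rv', l', e⟩ := hst
        simp only [if_true, Option.some.injEq] at ht
        subst ht
        simp only [Transient.store.injEq, StoreAddr.resolved.injEq, Prod.mk.injEq] at e
        exact h1 hmk ⟨e.2.1.symm, by exact_mod_cast hjm⟩
      · rw [if_neg hmi] at ht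
        exact hbt m t hjm hmk ht hst
    by_cases hji : j = i
    · subst hji
      rw [hi] at hs
      simp only [Option.some.injEq, Transient.store.injEq] at hs
      obtain ⟨rfl, rfl⟩ := hs
      refine ⟨j, .resolved (a, l), rfl, hj, by simp [hb j hj], ?_, hb'⟩
      rintro a'' l'' e
      simp only [StoreAddr.resolved.injEq, Prod.mk.injEq] at e
      rw [← e.1]
      by_contra hne
      exact h2 hj ⟨rfl, Ne.symm hne⟩
    · exact ⟨j, sa, rfl, hj, by simp [hb j hj, hji, hs], ha, hb'⟩
  · right
    refine ⟨fun m hmk hm' => hd m hmk ?_, fun m t hmk ht hst => ?_, hm⟩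
    · rw [hb m hmk] at hm'
      by_cases hmi : m = i
      · simp [hmi, hi]
      · simpa [hmi] using hm'
    · rw [hb m hmk] at ht
      by_cases hmi : m = i
      · subst hmi
        obtain ⟨rv', l', e⟩ := hst
        simp only [if_true, Option.some.injEq] at ht
        subst ht
        simp only [Transient.store.injEq, StoreAddr.resolved.injEq, Prod.mk.injEq] at e
        exact h1 hmk ⟨e.2.1.symm, hd m hmk (by simp [hi])⟩
      · rw [if_neg hmi] at ht
        exact hn m t hmk ht hst

/-- The values revealed by the `len` entries from index `i` on. -/
def bufLeak (buf : IdxMap (Transient V L R Op Cond)) (i len : ℕ) : List V :=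
  (List.range len).flatMap fun k => ((buf.get (i + k)).map Transient.leak).getD []

theorem bufLeak_one {buf : IdxMap (Transient V L R Op Cond)} {i : ℕ}
    {t : Transient V L R Op Cond} (h : buf.get i = some t) : bufLeak buf i 1 = t.leak := by
  simp [bufLeak, h]

theorem Oldest.eq {C : Config V L R Op Cond} {i j : ℕ} {t t' : Transient V L R Op Cond} (hlo : ∀ j < i, C.buf.get j = none)
    (hi : C.buf.get i = some t) (h : Oldest C j t') : j = i ∧ t' = t := by
  obtain ⟨h1, h2⟩ := h
  rw [IdxMap.minIdx_eq hlo (by simp [hi])] at h1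
  subst h1
  rw [hi] at h2
  cases h2
  exact ⟨rfl, rfl⟩

theorem oldest_one {C : Config V L R Op Cond} {t : Transient V L R Op Cond}
    (h0 : C.buf.get 0 = none) (h1 : C.buf.get 1 = some t) : Oldest C 1 t :=
  ⟨IdxMap.minIdx_eq (fun k hk => by obtain rfl : k = 0 := by omega
                                    exact h0) (by simp [h1]), h1⟩

variable [SemilatticeSup L] [OrderBot L]

/-- The entry `t` at index `k` is a correct stage of the execution of the fetched entry `s`. -/
inductive EntryOK (M : Machine V R Op Cond) (buf : IdxMap (Transient V L R Op Cond))
    (reg mem : _ → Option (LVal V L)) (k : ℕ) :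
    Transient V L R Op Cond → Transient V L R Op Cond → Prop
  | refl {s : Transient V L R Op Cond} (hs : s.IsSource) : EntryOK M buf reg mem k s s
  | op {r o rvs vs v} (hrv : ResolvesList buf reg k rvs vs)
      (hv : M.evalOp o (vs.map Prod.fst) = some v) :
      EntryOK M buf reg mem k (.op r o rvs) (.val r (v, joinLabels vs) none)
  | br {c rvs n₀ nTrue nFalse vs b} (hrv : ResolvesList buf reg k rvs vs)
      (hb : M.evalCond c (vs.map Prod.fst) = some b)
      (hn : (if b then nTrue else nFalse) = n₀) :
      EntryOK M buf reg mem k (.br c rvs n₀ nTrue nFalse) (.jump n₀)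
  | jmpi {rvs n₀ vs} (hrv : ResolvesList buf reg k rvs vs)
      (ha : M.addr (vs.map Prod.fst) = some n₀) :
      EntryOK M buf reg mem k (.jmpi rvs n₀) (.jump n₀)
  | loadPartial {r rvs v j n} (hj : j < k) :
      EntryOK M buf reg mem k (.load r rvs n) (.loadPartial r rvs v j n)
  | loadVal {r rvs n vs a dep v} (hrv : ResolvesList buf reg k rvs vs)
      (ha : M.addr (vs.map Prod.fst) = some a) (hl : LoadOK buf mem k v dep a) :
      EntryOK M buf reg mem k (.load r rvs n) (.val r v (some ⟨dep, a, n⟩))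
  | store {rv rvs rv' sa} (hv : rv' = rv ∨ ∃ v, Resolves buf reg k rv v ∧ rv' = .val v)
      (ha : sa = .unresolved rvs ∨ ∃ vs a l, ResolvesList buf reg k rvs vs ∧
        M.addr (vs.map Prod.fst) = some a ∧ sa = .resolved (a, l)) :
      EntryOK M buf reg mem k (.store rv (.unresolved rvs)) (.store rv' sa)

/-- `H1` concerns only the operands of `s`, because the temporary register can lose its value: the
register file has no place for it when the load of a `ret` retires. -/
theorem EntryOK.mono {M : Machine V R Op Cond} {buf buf' : IdxMap (Transient V L R Op Cond)}
    {reg mem reg' mem' : _ → Option (LVal V L)} {k : ℕ} {s t : Transient V L R Op Cond}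
    (h : EntryOK M buf reg mem k s t)
    (H1 : ∀ rv ∈ s.operands, ∀ v, Resolves buf reg k rv v → Resolves buf' reg' k rv v)
    (H2 : ∀ r v tag, t = .val r v (some tag) → LoadOK buf mem k v tag.dep tag.addr →
      LoadOK buf' mem' k v tag.dep tag.addr) : EntryOK M buf' reg' mem' k s t := by
  cases h with
  | refl hs => exact .refl hs
  | op hrv hv => exact .op (hrv.mono H1) hv
  | br hrv hb hn => exact .br (hrv.mono H1) hb hn
  | jmpi hrv ha => exact .jmpi (hrv.mono H1) ha
  | loadPartial hj => exact .loadPartial hj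
  | loadVal hrv ha hl => exact .loadVal (hrv.mono H1) ha (H2 _ _ _ rfl hl)
  | store hv ha =>
    refine .store (hv.imp_right fun ⟨v, h, e⟩ => ⟨v, H1 _ (by simp [Transient.operands]) _ h, e⟩)
      (ha.imp_right fun ⟨vs, a, l, h, e⟩ => ⟨vs, a, l, h.mono fun rv hrv => H1 rv ?_, e⟩)
    simp [Transient.operands, hrv]

/-- The buffer of `C` holds at index `k` a correct stage of the execution of `s`; the temporary
register is read only by the last entry of a `ret`. -/
def Entry (M : Machine V R Op Cond) (C : Config V L R Op Cond) (k : ℕ)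
    (s : Transient V L R Op Cond) : Prop :=
  (∃ t, C.buf.get k = some t ∧ EntryOK M C.buf C.reg C.mem k s t) ∧
    (.reg .ret ∈ s.operands → ∃ j t, j + 2 = k ∧ C.buf.get j = some t ∧ t.dest = some .ret)

theorem Entry.get_ne_none {M : Machine V R Op Cond} {C : Config V L R Op Cond} {k : ℕ}
    {s : Transient V L R Op Cond} (h : Entry M C k s) : C.buf.get k ≠ none := by
  obtain ⟨⟨t, ht, -⟩, -⟩ := h
  simp [ht]

/-- Correctness of an entry is kept when earlier entries are refined. -/
theorem Entry.mono {M : Machine V R Op Cond} {C C₁ : Config V L R Op Cond} {k : ℕ}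
    {s : Transient V L R Op Cond} (h : Entry M C k s) (hreg : C₁.reg = C.reg)
    (hk : C₁.buf.get k = C.buf.get k) (hb : BufRel Provides C.buf C₁.buf k)
    (H2 : ∀ r v tag, C.buf.get k = some (.val r v (some tag)) →
      LoadOK C.buf C.mem k v tag.dep tag.addr → LoadOK C₁.buf C₁.mem k v tag.dep tag.addr) :
    Entry M C₁ k s := by
  obtain ⟨⟨t, ht, hok⟩, hret⟩ := h
  refine ⟨⟨t, hk.trans ht, hok.mono (fun rv _ v hv => hreg ▸ hv.mono hb)
    fun r v tag e => H2 r v tag (ht.trans (congrArg some e))⟩, fun hr => ?_⟩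
  obtain ⟨j, u, hj, hu, hd⟩ := hret hr
  obtain ⟨u', hu', hp⟩ := hb.some_left (by omega) hu
  exact ⟨j, u', hj, hu', hp.dest.trans hd⟩

theorem Entry.of_eq {M : Machine V R Op Cond} {C C₁ : Config V L R Op Cond} {k : ℕ}
    {s : Transient V L R Op Cond} (h : Entry M C k s) (hreg : C₁.reg = C.reg)
    (hmem : C₁.mem = C.mem) (hk : ∀ j ≤ k, C₁.buf.get j = C.buf.get j) : Entry M C₁ k s :=
  h.mono hreg (hk k le_rfl) (.of_eq .refl fun j hj => hk j hj.le)
    fun _ _ _ _ hl => hmem ▸ hl.mono (.of_eq .refl fun j hj => hk j hj.le)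

/-- Replacing the entry at `i` by a refined one, without resolving a store address, keeps all
entries correct. -/
theorem Entry.set {M : Machine V R Op Cond} {C : Config V L R Op Cond} {i k : ℕ}
    {s t t' : Transient V L R Op Cond} (h : Entry M C k s) (hi : C.buf.get i = some t)
    (hp : Provides t t') (hl : StoreLike t t')
    (hok : EntryOK M C.buf C.reg C.mem i s t → EntryOK M C.buf C.reg C.mem i s t') :
    Entry M { C with buf := C.buf.set i t' } k s := by
  by_cases hki : k = i
  · subst hki
    obtain ⟨⟨u, hu, huok⟩, hret⟩ := h
    obtain rfl : t = u := by simpa [hi] using hu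
    refine ⟨⟨t', by simp, (hok huok).mono (fun rv _ v hv => hv.mono (.set .refl hi hp))
      fun r v tag _ hl' => hl'.mono (.set .refl hi hl)⟩, fun hr => ?_⟩
    obtain ⟨j, u, hj, hu, hd⟩ := hret hr
    exact ⟨j, u, hj, by simp [hu]; omega, hd⟩
  · exact h.mono rfl (by simp [hki]) (.set .refl hi hp)
      fun r v tag _ hl' => hl'.mono (.set .refl hi hl)

end Correctness

/-! ### The buffer as a path of the program. -/

section Layout

variable {V L R Op Cond : Type*} [SemilatticeSup L] [OrderBot L]

/-- Fetching at `p` can insert the entries `srcs` and continue at `n`. -/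
inductive Fetched (M : Machine V R Op Cond) (P : Program V L R Op Cond) :
    V → List (Transient V L R Op Cond) → V → Prop
  | op {p o r rvs n'} (hP : P p = some (.op o r rvs n')) :
      Fetched M P p [.op (.arch r) o (rvs.map Operand.lift)] n'
  | br {p c rvs nTrue nFalse} (b : Bool) (hP : P p = some (.br c rvs nTrue nFalse)) :
      Fetched M P p [.br c (rvs.map Operand.lift) (if b then nTrue else nFalse) nTrue nFalse]
        (if b then nTrue else nFalse)
  | jmpi {p rvs} (n' : V) (hP : P p = some (.jmpi rvs)) :
      Fetched M P p [.jmpi (rvs.map Operand.lift) n'] n'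
  | load {p r rvs n'} (hP : P p = some (.load r rvs n')) :
      Fetched M P p [.load (.arch r) (rvs.map Operand.lift) p] n'
  | store {p rv rvs n'} (hP : P p = some (.store rv rvs n')) :
      Fetched M P p [.store rv.lift (.unresolved (rvs.map Operand.lift))] n'
  | fence {p n'} (hP : P p = some (.fence n')) : Fetched M P p [.fence] n'
  | call {p nf nret} (hP : P p = some (.call nf nret)) :
      Fetched M P p [.call, .op (.arch M.rsp) M.succ [.reg (.arch M.rsp)],
        .store (.val (nret, ⊥)) (.unresolved [.reg (.arch M.rsp)])] nf
  | ret {p} (n' : V) (hP : P p = some .ret) :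
      Fetched M P p [.ret, .load .ret [.reg (.arch M.rsp)] p,
        .op (.arch M.rsp) M.pred [.reg (.arch M.rsp)], .jmpi [.reg .ret] n'] n'

theorem Fetched.isSource {M : Machine V R Op Cond} {P : Program V L R Op Cond} {p n : V}
    {srcs : List (Transient V L R Op Cond)} (h : Fetched M P p srcs n)
    {s : Transient V L R Op Cond} (hs : s ∈ srcs) : s.IsSource := by
  cases h <;> simp at hs
  case call => rcases hs with rfl | rfl | rfl <;> trivial
  case ret => rcases hs with rfl | rfl | rfl | rfl <;> trivial
  all_goals subst hs; trivial

/-- From index `i` on, the buffer of `C` holds correct entries for the instructions on a path of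
the program that starts at `p`. The marker of a `ret` may be left over from a rollback to the load
of this `ret`. -/
inductive Layout (M : Machine V R Op Cond) (P : Program V L R Op Cond)
    (C : Config V L R Op Cond) : ℕ → V → Prop
  | done {i p} (h : ∀ k, i ≤ k → C.buf.get k = none) (hpc : C.pc = p) : Layout M P C i p
  | group {i p srcs n} (hf : Fetched M P p srcs n)
      (he : ∀ k s, srcs[k]? = some s → Entry M C (i + k) s)
      (rest : Layout M P C (i + srcs.length) n) : Layout M P C i p
  | stuck {i p} (hP : P p = some .ret) (he : Entry M C i .ret)
      (rest : Layout M P C (i + 1) p) : Layout M P C i p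

variable {M : Machine V R Op Cond} {P : Program V L R Op Cond} {C C₁ : Config V L R Op Cond}

theorem Fetched.length_pos {p n : V} {srcs : List (Transient V L R Op Cond)}
    (h : Fetched M P p srcs n) : 0 < srcs.length := by
  cases h <;> simp

/-- Two fetches at the same point differ at most in the predicted target. -/
theorem Fetched.length_eq {p n n' : V} {srcs srcs' : List (Transient V L R Op Cond)}
    (h : Fetched M P p srcs n) (h' : Fetched M P p srcs' n') : srcs.length = srcs'.length := by
  cases h <;> cases h' <;> simp_all

/-- Refining entries keeps the layout. -/
theorem Layout.mono {i : ℕ} {p : V} (h : Layout M P C i p) (hpc : C₁.pc = C.pc)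
    (hn : ∀ k, C.buf.get k = none → C₁.buf.get k = none)
    (he : ∀ k s, Entry M C k s → Entry M C₁ k s) : Layout M P C₁ i p := by
  induction h with
  | done h hp => exact .done (fun k hk => hn k (h k hk)) (hpc.trans hp)
  | group hf h _ ih => exact .group hf (fun k s hs => he _ _ (h k s hs)) ih
  | stuck hP h _ ih => exact .stuck hP (he _ _ h) ih

/-- The form needed for retirement, which keeps only the entries beyond the retired group. -/
theorem Layout.mono_from {i : ℕ} {p : V} (h : Layout M P C i p) (hpc : C₁.pc = C.pc)
    (hn : ∀ k, i ≤ k → C.buf.get k = none → C₁.buf.get k = none)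
    (he : ∀ k s, i ≤ k → Entry M C k s → Entry M C₁ k s) : Layout M P C₁ i p := by
  induction h with
  | done h hp => exact .done (fun k hk => hn k hk (h k hk)) (hpc.trans hp)
  | group hf h _ ih =>
    exact .group hf (fun k s hs => he _ _ (by omega) (h k s hs))
      (ih (fun k hk => hn k (by omega)) fun k s hk => he k s (by omega))
  | stuck hP h _ ih =>
    exact .stuck hP (he _ _ le_rfl h)
      (ih (fun k hk => hn k (by omega)) fun k s hk => he k s (by omega))

/-- The occupied indices are contiguous. -/
theorem Layout.exists_end {i : ℕ} {p : V} (h : Layout M P C i p) :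
    ∃ e, i ≤ e ∧ (∀ k, e ≤ k → C.buf.get k = none) ∧
      ∀ k, i ≤ k → k < e → C.buf.get k ≠ none := by
  induction h with
  | @done i p h hp => exact ⟨i, le_rfl, h, fun k _ _ => by omega⟩
  | @group i p srcs n hf h _ ih =>
    obtain ⟨e, he, hn, hs⟩ := ih
    refine ⟨e, by omega, hn, fun k hk hke => ?_⟩
    by_cases hki : k < i + srcs.length
    · have := (h (k - i) srcs[k - i] (by rw [List.getElem?_eq_getElem])).get_ne_none
      rwa [Nat.add_sub_cancel' hk] at this
    · exact hs k (by omega) hke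
  | @stuck i p hP h _ ih =>
    obtain ⟨e, he, hn, hs⟩ := ih
    refine ⟨e, by omega, hn, fun k hk hke => ?_⟩
    by_cases hki : k = i
    · exact hki ▸ h.get_ne_none
    · exact hs k (by omega) hke

/-- The new group takes the place of the final `done`, whose point is the current program point.
Since the indices from `i` to `e` are exactly the occupied ones, this `done` must sit at `e`. -/
theorem Layout.append {i e : ℕ} {p : V} {srcs : List (Transient V L R Op Cond)}
    (h : Layout M P C i p) (hie : i ≤ e) (hn : ∀ k, e ≤ k → C.buf.get k = none)
    (hs : ∀ k, i ≤ k → k < e → C.buf.get k ≠ none)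
    (hold : ∀ k s, k < e → Entry M C k s → Entry M C₁ k s)
    (hf : Fetched M P C.pc srcs C₁.pc)
    (hnew : ∀ k s, srcs[k]? = some s → Entry M C₁ (e + k) s)
    (hnone : ∀ k, e + srcs.length ≤ k → C₁.buf.get k = none) : Layout M P C₁ i p := by
  induction h with
  | @done i p h hp =>
    obtain rfl : i = e := by
      by_contra hne
      exact hs i le_rfl (by omega) (h i le_rfl)
    subst hp
    exact .group hf hnew (.done hnone rfl)
  | @group i p srcs' n hf' h' _ ih =>
    have key : ∀ k, k < srcs'.length → i + k < e := by
      intro k hk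
      by_contra hle
      exact (h' k srcs'[k] (by rw [List.getElem?_eq_getElem])).get_ne_none (hn _ (by omega))
    have hl := hf'.length_pos
    have := key (srcs'.length - 1) (by omega)
    refine .group hf' (fun k s hk => hold _ _ (key k ?_) (h' k s hk))
      (ih (by omega) fun k hk => hs k (by omega))
    exact (List.getElem?_eq_some_iff.1 hk).1
  | @stuck i p hP h' _ ih =>
    have : i < e := by
      by_contra hle
      exact h'.get_ne_none (hn _ (by omega))
    exact .stuck hP (hold _ _ this h') (ih (by omega) fun k hk => hs k (by omega))

/-- A load is a whole instruction or the second entry of a `ret`. Either way it records the point of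
its instruction, so a rollback to it restarts that instruction; in the second case the marker stays
in front. -/
theorem Fetched.load_eq {p n q : V} {srcs : List (Transient V L R Op Cond)} {m : ℕ}
    {r : TReg R} {rvs : List (Operand (TReg R) V L)}
    (h : Fetched M P p srcs n) (hm : srcs[m]? = some (.load r rvs q)) :
    q = p ∧ (m = 0 ∨ m = 1 ∧ P p = some .ret ∧ srcs[0]? = some .ret) := by
  cases h <;> rcases m with _ | _ | _ | _ | m <;> simp_all

/-- Rollback to a load keeps the layout. -/
theorem Layout.cut {i k : ℕ} {p q : V} (h : Layout M P C i p) (hik : i ≤ k)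
    (hk : C.buf.get k ≠ none) (hsrc : ∀ s, Entry M C k s → ∃ r rvs, s = .load r rvs q)
    (hold : ∀ j s, j < k → Entry M C j s → Entry M C₁ j s)
    (hnone : ∀ j, k ≤ j → C₁.buf.get j = none) (hpc : C₁.pc = q) : Layout M P C₁ i p := by
  induction h with
  | @done i p h hp => exact absurd (h k hik) hk
  | @group i p srcs n hf h' _ ih =>
    by_cases hlt : k < i + srcs.length
    · obtain ⟨m, rfl⟩ := Nat.exists_eq_add_of_le hik
      have hm : srcs[m]? = some srcs[m] := by rw [List.getElem?_eq_getElem]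
      obtain ⟨r, rvs, hs⟩ := hsrc _ (h' m _ hm)
      obtain ⟨rfl, rfl | ⟨rfl, hP, h0⟩⟩ := hf.load_eq (hm.trans (congrArg some hs))
      · exact .done hnone hpc
      -- The marker lies before the cut and stays in the buffer, while the program point is again
      -- that of the `ret`.
      · exact .stuck hP (hold _ _ (by omega) (h' 0 _ h0)) (.done hnone hpc)
    · refine .group hf (fun j s hj => hold _ _ ?_ (h' j s hj)) (ih (by omega))
      have := (List.getElem?_eq_some_iff.1 hj).1
      omega
  | @stuck i p hP h' _ ih =>
    by_cases hki : k = i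
    · subst hki
      obtain ⟨r, rvs, hs⟩ := hsrc _ h'
      cases hs
    · exact .stuck hP (hold _ _ (by omega) h') (ih (by omega))

/-- The entry `t` is the last one of an instruction, and the prediction that it contains can be
changed to `n'`, giving `t'`. -/
def Retargets (M : Machine V R Op Cond) (P : Program V L R Op Cond)
    (t t' : Transient V L R Op Cond) (n' : V) : Prop :=
  ∀ p srcs n m, Fetched M P p srcs n → srcs[m]? = some t →
    m + 1 = srcs.length ∧ Fetched M P p (srcs.set m t') n'

theorem retargets_br {c : Cond} {rvs : List (Operand (TReg R) V L)} {n₀ nTrue nFalse : V}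
    (b : Bool) : Retargets M P (.br c rvs n₀ nTrue nFalse)
      (.br c rvs (if b then nTrue else nFalse) nTrue nFalse) (if b then nTrue else nFalse) := by
  intro p srcs n m hf hm
  cases hf with
  | br b' hP =>
    rcases m with _ | m
    · simp only [List.getElem?_cons_zero, Option.some.injEq, Transient.br.injEq] at hm
      obtain ⟨rfl, rfl, -, rfl, rfl⟩ := hm
      exact ⟨rfl, .br b hP⟩
    · simp at hm
  | _ => rcases m with _ | _ | _ | _ | m <;> simp_all

/-- Such an entry is an indirect jump or closes a `ret`. `Fetched` allows any predicted target for a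
`ret`, whatever the return stack buffer says, so a mispredicted return can be regarded as fetched
with the right target. -/
theorem retargets_jmpi {rvs : List (Operand (TReg R) V L)} {n₀ : V} (n' : V) :
    Retargets M P (.jmpi rvs n₀) (.jmpi rvs n') n' := by
  intro p srcs n m hf hm
  cases hf with
  | jmpi _ hP =>
    rcases m with _ | m
    · simp only [List.getElem?_cons_zero, Option.some.injEq, Transient.jmpi.injEq] at hm
      obtain ⟨rfl, -⟩ := hm
      exact ⟨rfl, .jmpi n' hP⟩
    · simp at hm
  | ret _ hP =>
    rcases m with _ | _ | _ | _ | m <;> simp at hm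
    obtain ⟨rfl, -⟩ := hm
    exact ⟨rfl, .ret n' hP⟩
  | _ => rcases m with _ | _ | _ | _ | m <;> simp_all

/-- Rollback of a mispredicted jump keeps the layout. -/
theorem Layout.cut_jump {i k : ℕ} {p n' : V} {t t' : Transient V L R Op Cond}
    (h : Layout M P C i p) (hik : i ≤ k) (hk : C.buf.get k ≠ none)
    (hsrc : ∀ s, Entry M C k s → s = t) (hnr : t ≠ .ret) (ht : Retargets M P t t' n')
    (hold : ∀ j s, j < k → Entry M C j s → Entry M C₁ j s) (hnew : Entry M C k t → Entry M C₁ k t')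
    (hnone : ∀ j, k < j → C₁.buf.get j = none) (hpc : C₁.pc = n') : Layout M P C₁ i p := by
  induction h with
  | @done i p h hp => exact absurd (h k hik) hk
  | @group i p srcs n hf h' _ ih =>
    by_cases hlt : k < i + srcs.length
    · obtain ⟨m, rfl⟩ := Nat.exists_eq_add_of_le hik
      have hml : m < srcs.length := by omega
      have hm : srcs[m]? = some srcs[m] := by rw [List.getElem?_eq_getElem]
      have hs := hsrc _ (h' m _ hm)
      rw [hs] at hm
      obtain ⟨hl, hf'⟩ := ht _ _ _ _ hf hm
      -- After the rollback the buffer is as if the right target had been guessed at the fetch; the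
      -- jump ends its group, so the group is still whole.
      refine .group hf' (fun j s hj => ?_) (.done (fun j hj => hnone j ?_) hpc)
      · have hj' := (List.getElem?_eq_some_iff.1 hj).1
        rw [List.length_set] at hj'
        by_cases hjm : j = m
        · subst hjm
          rw [List.getElem?_set_self hml] at hj
          cases hj
          exact hnew (h' _ _ hm)
        · rw [List.getElem?_set_ne (Ne.symm hjm)] at hj
          exact hold _ _ (by omega) (h' j s hj)
      · rw [List.length_set] at hj
        omega
    · refine .group hf (fun j s hj => hold _ _ ?_ (h' j s hj)) (ih (by omega))
      have := (List.getElem?_eq_some_iff.1 hj).1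
      omega
  | @stuck i p hP h' _ ih =>
    by_cases hki : k = i
    · subst hki
      exact absurd (hsrc _ h').symm hnr
    · exact .stuck hP (hold _ _ (by omega) h') (ih (by omega))

/-! ### Resolving a store address -/

/-- A store assigns no register, so operands resolve as before. Only resolved loads can become
wrong, and the two cases of `Hazard` are what `LoadOK.resolve_store` needs excluded. -/
theorem Entry.resolve_store {i k : ℕ} {rv : Operand (TReg R) V L}
    {rvs : List (Operand (TReg R) V L)} {a : V} {l : L} {s : Transient V L R Op Cond}
    (h : Entry M C k s) (hi : C.buf.get i = some (.store rv (.unresolved rvs)))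
    (ha : ResolvesAddr M C i rvs (a, l)) (hno : ∀ n, ¬ Hazard C.buf i a k n)
    (hreg : C₁.reg = C.reg) (hmem : C₁.mem = C.mem)
    (hb : ∀ m ≤ k, C₁.buf.get m =
      if m = i then some (.store rv (.resolved (a, l))) else C.buf.get m) : Entry M C₁ k s := by
  have hbr : BufRel Provides C.buf C₁.buf k := by
    intro m hm
    rw [hb m hm.le]
    by_cases hmi : m = i
    · subst hmi
      simpa [hi] using ⟨rfl, by simp [Transient.value]⟩
    · rw [if_neg hmi]
      cases C.buf.get m with
      | none => exact .none
      | some t => exact .some (.refl t)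
  by_cases hki : k = i
  · subst hki
    obtain ⟨⟨t, ht, hok⟩, hret⟩ := h
    rw [hi] at ht
    cases ht
    refine ⟨⟨.store rv (.resolved (a, l)), by simp [hb k le_rfl], ?_⟩, fun hr => ?_⟩
    · obtain ⟨-, vs, hvs, hav, -⟩ := ha
      have hvs' : ResolvesList C₁.buf C₁.reg k rvs vs :=
        hvs.mono fun rv _ v hv => hreg ▸ hv.mono hbr
      cases hok with
      | refl => exact .store (.inl rfl) (.inr ⟨vs, a, l, hvs', hav, rfl⟩)
      | store hv ha' =>
        rcases ha' with ha' | ⟨_, _, _, _, _, ha'⟩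
        · simp only [StoreAddr.unresolved.injEq] at ha'
          subst ha'
          exact .store (hv.imp_right fun ⟨v, h, e⟩ => ⟨v, hreg ▸ h.mono hbr, e⟩)
            (.inr ⟨vs, a, l, hvs', hav, rfl⟩)
        · cases ha'
    · obtain ⟨j, u, hj, hu, hd⟩ := hret hr
      obtain ⟨u', hu', hp⟩ := hbr.some_left (by omega) hu
      exact ⟨j, u', hj, hu', hp.dest.trans hd⟩
  · refine h.mono hreg (by simp [hb k le_rfl, hki]) hbr fun r v tag ht hl => ?_
    rw [hmem]
    exact hl.resolve_store hi (fun m hm => hb m hm.le)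
      (fun hik hz => hno tag.pc ⟨hik, r, v, tag, ht, rfl, .inl hz⟩)
      (fun hik hz => hno tag.pc ⟨hik, r, v, tag, ht, rfl, .inr hz⟩)

end Layout

/-! ### Fetch and execute steps preserve correctness. -/

section Steps

variable {V L R Op Cond : Type*} [SemilatticeSup L] [OrderBot L]
  {M : Machine V R Op Cond} {P : Program V L R Op Cond} {C C₁ : Config V L R Op Cond}

/-- Program operands cannot name the temporary register. Only the final jump of a `ret` reads it,
two entries after the load that assigns it. -/
theorem Fetched.ret_mem_operands {p n : V} {srcs : List (Transient V L R Op Cond)}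
    (h : Fetched M P p srcs n) {m : ℕ} {s : Transient V L R Op Cond} (hm : srcs[m]? = some s)
    (hs : .reg .ret ∈ s.operands) :
    ∃ j t, j + 2 = m ∧ srcs[j]? = some t ∧ t.dest = some .ret := by
  cases h with
  | ret n' hP =>
    rcases m with _ | _ | _ | _ | m <;> simp at hm
    · subst hm; simp [Transient.operands] at hs
    · subst hm; simp [Transient.operands] at hs
    · subst hm; simp [Transient.operands] at hs
    · exact ⟨1, _, rfl, rfl, rfl⟩
  | call hP =>
    rcases m with _ | _ | _ | m <;> simp at hm <;> subst hm <;> simp [Transient.operands] at hs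
  | _ =>
    rcases m with _ | m <;> simp at hm
    subst hm
    simp [Transient.operands, Operand.lift_ne_ret, (Operand.lift_ne_ret _).symm] at hs

/-- The entries that a fetch inserts are correct. -/
theorem Fetched.entry {p n : V} {srcs : List (Transient V L R Op Cond)}
    (h : Fetched M P p srcs n) {i : ℕ} (hb : ∀ m s, srcs[m]? = some s → C.buf.get (i + m) = some s)
    {m : ℕ} {s : Transient V L R Op Cond} (hm : srcs[m]? = some s) : Entry M C (i + m) s := by
  refine ⟨⟨s, hb _ _ hm, .refl (h.isSource (List.mem_of_getElem? hm))⟩, fun hs => ?_⟩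
  obtain ⟨j, t, rfl, ht, hd⟩ := h.ret_mem_operands hm hs
  exact ⟨i + j, t, by omega, hb _ _ ht, hd⟩

/-- The buffer of `C` holds correct entries for a path of the program that starts at `p`. -/
def Correct (M : Machine V R Op Cond) (P : Program V L R Op Cond) (C : Config V L R Op Cond)
    (p : V) : Prop :=
  ∃ i, 1 ≤ i ∧ (∀ k < i, C.buf.get k = none) ∧ Layout M P C i p

/-- `C₁` refines the entries of `C`. -/
structure Refines (M : Machine V R Op Cond) (C C₁ : Config V L R Op Cond) : Prop where
  pc : C₁.pc = C.pc
  get : ∀ k, C.buf.get k = none → C₁.buf.get k = none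
  entry : ∀ k s, Entry M C k s → Entry M C₁ k s

/-- `C₁` arises from `C` by the rollback of a mispredicted jump at index `i`. -/
structure JumpRollback (M : Machine V R Op Cond) (P : Program V L R Op Cond)
    (C C₁ : Config V L R Op Cond) (i : ℕ) (t t' : Transient V L R Op Cond) : Prop where
  get : ∀ k, C.buf.get k = none → C₁.buf.get k = none
  get_self : C.buf.get i = some t
  src : ∀ s, Entry M C i s → s = t
  ne_ret : t ≠ .ret
  retargets : Retargets M P t t' C₁.pc
  entry : ∀ j s, j < i → Entry M C j s → Entry M C₁ j s
  entry_self : Entry M C i t → Entry M C₁ i t'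
  get_gt : ∀ j, i < j → C₁.buf.get j = none

/-- `C₁` arises from `C` by a rollback to the load at index `k`. -/
structure LoadRollback (M : Machine V R Op Cond) (C C₁ : Config V L R Op Cond) (k : ℕ) : Prop where
  get : ∀ k, C.buf.get k = none → C₁.buf.get k = none
  get_self : C.buf.get k ≠ none
  src : ∀ s, Entry M C k s → ∃ r rvs, s = .load r rvs C₁.pc
  entry : ∀ j s, j < k → Entry M C j s → Entry M C₁ j s
  get_ge : ∀ j, k ≤ j → C₁.buf.get j = none
  cause : (∃ r rvs v j n, C.buf.get k = some (.loadPartial r rvs v j n)) ∨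
    ∃ i rv sa, C.buf.get i = some (.store rv sa)

theorem Correct.refine {p : V} (h : Correct M P C p) (hr : Refines M C C₁) : Correct M P C₁ p := by
  obtain ⟨lo, h1, hlo, hL⟩ := h
  exact ⟨lo, h1, fun k hk => hr.get k (hlo k hk), hL.mono hr.pc hr.get hr.entry⟩

theorem Correct.jumpRollback {p : V} {i : ℕ} {t t' : Transient V L R Op Cond}
    (h : Correct M P C p) (hr : JumpRollback M P C C₁ i t t') : Correct M P C₁ p := by
  obtain ⟨lo, h1, hlo, hL⟩ := h
  have hi : C.buf.get i ≠ none := by simp [hr.get_self]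
  exact ⟨lo, h1, fun k hk => hr.get k (hlo k hk), hL.cut_jump (not_lt.1 fun hlt => hi (hlo i hlt))
    hi hr.src hr.ne_ret hr.retargets hr.entry hr.entry_self hr.get_gt rfl⟩

theorem Correct.loadRollback {p : V} {k : ℕ} (h : Correct M P C p)
    (hr : LoadRollback M C C₁ k) : Correct M P C₁ p := by
  obtain ⟨lo, h1, hlo, hL⟩ := h
  exact ⟨lo, h1, fun j hj => hr.get j (hlo j hj),
    hL.cut (not_lt.1 fun hlt => hr.get_self (hlo k hlt)) hr.get_self hr.src hr.entry hr.get_ge rfl⟩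

theorem refines_set {i : ℕ} {t t' : Transient V L R Op Cond} (hi : C.buf.get i = some t)
    (he : ∀ k s, Entry M C k s → Entry M { C with buf := C.buf.set i t' } k s) :
    Refines M C { C with buf := C.buf.set i t' } := by
  refine ⟨rfl, fun k hk => ?_, he⟩
  have : k ≠ i := by rintro rfl; simp [hi] at hk
  simp [this, hk]

theorem Entry.entryOK {i : ℕ} {s t : Transient V L R Op Cond} (h : Entry M C i s)
    (hi : C.buf.get i = some t) : EntryOK M C.buf C.reg C.mem i s t := by
  obtain ⟨⟨u, hu, huok⟩, -⟩ := h
  rw [hi] at hu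
  cases hu
  exact huok

theorem storeLike_of_ne {V L R Op Cond : Type*} {t t' : Transient V L R Op Cond}
    (h : ∀ rv sa, t ≠ .store rv sa)
    (h' : ∀ rv sa, t' ≠ .store rv sa) : StoreLike t t' :=
  ⟨fun _ ⟨_, _, e⟩ => absurd e (h' _ _), fun _ _ e => absurd e (h _ _)⟩

/-- Operands resolve through the entries before `i`, which the rollback keeps. So the evaluation
that refutes the guess justifies the new target in the new buffer. -/
theorem jumpRollback_of_execute {i : ℕ} {n' : V} {t t' : Transient V L R Op Cond}
    (hi : C.buf.get i = some t) (hsrc : ∀ s, EntryOK M C.buf C.reg C.mem i s t → s = t)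
    (hnr : t ≠ .ret) (ht : Retargets M P t t' n') (hops : t'.operands = t.operands)
    (hok : EntryOK M C.buf C.reg C.mem i t' (.jump n')) :
    JumpRollback M P C { C with
      pc := n'
      buf := (C.buf.restrict (· < i)).set i (.jump n')
      rsb := C.rsb.restrict (· < i) } i t t' := by
  have heq : ∀ j < i, ((C.buf.restrict (· < i)).set i (.jump n')).get j = C.buf.get j :=
    fun j hj => by simp [hj, hj.ne]
  have hbr : BufRel Provides C.buf ((C.buf.restrict (· < i)).set i (.jump n')) i :=
    .of_eq .refl heq
  refine ⟨fun k hk => ?_, hi, fun s hs => hsrc s (hs.entryOK hi), hnr, ht,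
    fun j s hj hs => hs.of_eq rfl rfl fun m hm => heq m (by omega), fun hs => ?_,
    fun j hj => by simp [hj.ne', hj.not_gt]⟩
  · have : k ≠ i := by rintro rfl; simp [hi] at hk
    simp [this, hk]
  · refine ⟨⟨.jump n', by simp, hok.mono (fun rv _ v hv => hv.mono hbr)
      fun _ _ _ e => by cases e⟩, fun hr => ?_⟩
    obtain ⟨j, u, hj, hu, hd⟩ := hs.2 (hops ▸ hr)
    exact ⟨j, u, hj, (heq j (by omega)).trans hu, hd⟩

/-- Correctness of an entry refers only to earlier entries, so a prefix of a correct buffer is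
correct; and an entry with a predicted value can only stem from a load at its recorded point. -/
theorem loadRollback_of_execute {n : V} {i j : ℕ} {r : TReg R} {v : LVal V L}
    {rvs : List (Operand (TReg R) V L)} (hi : C.buf.get i = some (.loadPartial r rvs v j n)) :
    LoadRollback M C { C with
      pc := n
      buf := C.buf.restrict (· < i)
      rsb := C.rsb.restrict (· < i) } i := by
  refine ⟨fun j hj => by simp [hj], by simp [hi], fun s hs => ?_, fun j s hj hs => ?_,
    fun j hj => by simp [hj.not_gt], .inl ⟨_, _, _, _, _, hi⟩⟩
  · cases hs.entryOK hi with
    | loadPartial => exact ⟨_, _, rfl⟩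
    | refl hs => exact hs.elim
  · exact hs.of_eq rfl rfl fun m hm => by simp [show m < i by omega]

variable [DecidableEq V] [DecidableEq R]

/-- What a fetch does. -/
theorem Step.of_isFetch {d : Directive V} {o : List (Obs V L)} (h : Step M P C d o C₁)
    (hd : d.IsFetch) : ∃ srcs, Fetched M P C.pc srcs C₁.pc ∧ C₁.reg = C.reg ∧ C₁.mem = C.mem ∧
      o = [] ∧ ∀ k, C₁.buf.get k =
        if k < freshIdx C then C.buf.get k else srcs[k - freshIdx C]? := by
  have key : ∀ k, freshIdx C ≤ k → C.buf.get k = none := fun k hk =>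
    IdxMap.get_of_maxIdx_lt hk
  have one : ∀ (t : Transient V L R Op Cond) (k : ℕ), (C.buf.set (freshIdx C) t).get k =
      if k < freshIdx C then C.buf.get k else [t][k - freshIdx C]? := by
    intro t k
    rw [IdxMap.get_set]
    rcases lt_trichotomy k (freshIdx C) with hk | rfl | hk
    · simp [hk, hk.ne]
    · simp
    · obtain ⟨m, rfl⟩ := Nat.exists_eq_add_of_lt hk
      simp [key _ hk.le, hk.ne', show freshIdx C + m + 1 - freshIdx C = m + 1 by omega]
  cases h with
  | op_fetch hP => exact ⟨_, .op hP, rfl, rfl, rfl, one _⟩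
  | br_fetch b hP => exact ⟨_, .br b hP, rfl, rfl, rfl, one _⟩
  | jmpi_fetch n' hP => exact ⟨_, .jmpi n' hP, rfl, rfl, rfl, one _⟩
  | load_fetch hP => exact ⟨_, .load hP, rfl, rfl, rfl, one _⟩
  | store_fetch hP => exact ⟨_, .store hP, rfl, rfl, rfl, one _⟩
  | fence_fetch hP => exact ⟨_, .fence hP, rfl, rfl, rfl, one _⟩
  | call_fetch hP hi =>
    subst hi
    refine ⟨_, .call hP, rfl, rfl, rfl, fun k => ?_⟩
    by_cases hk : k < freshIdx C
    · simp [hk, show k ≠ freshIdx C by omega, show k ≠ freshIdx C + 1 by omega,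
        show k ≠ freshIdx C + 2 by omega]
    · obtain ⟨m, rfl⟩ := Nat.exists_eq_add_of_le (not_lt.1 hk)
      rcases m with _ | _ | _ | m <;> simp [key]
  | ret_fetch hP ht hi | ret_fetch_empty _ hP ht hi =>
    subst hi
    refine ⟨_, .ret _ hP, rfl, rfl, rfl, fun k => ?_⟩
    by_cases hk : k < freshIdx C
    · simp [hk, show k ≠ freshIdx C by omega, show k ≠ freshIdx C + 1 by omega,
        show k ≠ freshIdx C + 2 by omega, show k ≠ freshIdx C + 3 by omega]
    · obtain ⟨m, rfl⟩ := Nat.exists_eq_add_of_le (not_lt.1 hk)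
      rcases m with _ | _ | _ | _ | m <;> simp [key]
  | _ => exact hd.elim

/-- The fresh index is the end of the layout, unless the buffer is empty: then numbering restarts at
`1`, wherever the layout stood before. Both cases are instances of `main`. -/
theorem Correct.fetch {p : V} {d : Directive V} {o : List (Obs V L)} (h : Correct M P C p)
    (hstep : Step M P C d o C₁) (hd : d.IsFetch) : Correct M P C₁ p := by
  obtain ⟨i, hi, hlo, hL⟩ := h
  obtain ⟨srcs, hf, hreg, hmem, -, hb⟩ := hstep.of_isFetch hd
  obtain ⟨e, hie, hn, hs⟩ := hL.exists_end
  have main : ∀ j, 1 ≤ j → (∀ k < j, C.buf.get k = none) → Layout M P C j p → j ≤ freshIdx C →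
      (∀ k, j ≤ k → k < freshIdx C → C.buf.get k ≠ none) → Correct M P C₁ p := by
    intro j hj hlo' hL' hje hs'
    refine ⟨j, hj, fun k hk => ?_, hL'.append hje
      (fun k hk => IdxMap.get_of_maxIdx_lt hk) hs' (fun k s hk hE => ?_) hf
      (fun k s hk => hf.entry (fun m s hm => ?_) hk) fun k hk => ?_⟩
    · rw [hb, if_pos (by omega), hlo' k hk]
    · exact hE.of_eq hreg hmem fun m hm => by rw [hb, if_pos (by omega)]
    · rw [hb, if_neg (by omega), Nat.add_sub_cancel_left, hm]
    · rw [hb, if_neg (by omega), List.getElem?_eq_none (by omega)]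
  rcases hie.eq_or_lt with rfl | hlt
  · have hall : ∀ k, C.buf.get k = none := fun k =>
      if hk : k < i then hlo k hk else hn k (by omega)
    have hfr : freshIdx C = 1 := by
      rw [freshIdx, IdxMap.maxIdx_of_dom_eq_empty (IdxMap.dom_eq_empty_iff.2 hall)]
    refine main 1 le_rfl (fun k _ => hall k) ?_ (by omega) fun k _ _ => by omega
    cases hL with
    | done _ hpc => exact .done (fun k _ => hall k) hpc
    | group hf' he _ =>
      exact absurd (hall _) (he 0 _ (List.getElem?_eq_getElem hf'.length_pos)).get_ne_none
    | stuck _ he _ => exact absurd (hall _) he.get_ne_none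
  · have hfr : freshIdx C = e :=
      IdxMap.maxIdx_add_one_eq (by omega) hn (hs (e - 1) (by omega) (by omega))
    exact main i hi hlo hL (by omega) fun k hk hke => hs k hk (by omega)


theorem Step.reg_mem_eq {d : Directive V} {o : List (Obs V L)} (h : Step M P C d o C₁)
    (hd : d ≠ .retire) : C₁.reg = C.reg ∧ C₁.mem = C.mem := by
  cases h <;> first | exact ⟨rfl, rfl⟩ | exact absurd rfl hd

/-- An execute step refines entries or rolls back to a jump or a load. -/
theorem Step.of_execute {d : Directive V} {o : List (Obs V L)} (h : Step M P C d o C₁)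
    (hf : ¬ d.IsFetch) (hd : d ≠ .retire) :
    Refines M C C₁ ∨ (∃ i t t', JumpRollback M P C C₁ i t t') ∨ ∃ k, LoadRollback M C C₁ k := by
  cases h with
  | op_execute hi hf hrv hv =>
    refine .inl (refines_set hi fun k s hs => hs.set hi ⟨rfl, by simp [Transient.value]⟩
      (storeLike_of_ne (by simp) (by simp)) fun hok => ?_)
    cases hok
    exact .op hrv hv
  | br_execute_correct hi hf hrv hb hn =>
    refine .inl (refines_set hi fun k s hs => hs.set hi ⟨rfl, by simp [Transient.value]⟩
      (storeLike_of_ne (by simp) (by simp)) fun hok => ?_)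
    cases hok
    exact .br hrv hb hn
  | br_execute_incorrect hi hf hrv hb hn' hn =>
    subst hn'
    exact .inr (.inl ⟨_, _, _, jumpRollback_of_execute hi (fun s hs => by cases hs; rfl) (by simp) (retargets_br _) rfl
      (.br hrv hb rfl)⟩)
  | jmpi_execute_correct hi ha =>
    obtain ⟨-, vs, hrv, ha, -⟩ := ha
    refine .inl (refines_set hi fun k s hs => hs.set hi ⟨rfl, by simp [Transient.value]⟩
      (storeLike_of_ne (by simp) (by simp)) fun hok => ?_)
    cases hok
    exact .jmpi hrv ha
  | @jmpi_execute_incorrect i rvs n₀ n' l hi ha hn =>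
    obtain ⟨-, vs, hrv, ha, -⟩ := ha
    exact .inr (.inl ⟨_, _, _, jumpRollback_of_execute hi (fun s hs => by cases hs; rfl) (by simp) (retargets_jmpi n') rfl
      (.jmpi hrv ha)⟩)
  | load_execute_nodep hi ha hs hv =>
    obtain ⟨-, vs, hrv, ha, -⟩ := ha
    refine .inl (refines_set hi fun k s hs' => hs'.set hi ⟨rfl, by simp [Transient.value]⟩
      (storeLike_of_ne (by simp) (by simp)) fun hok => ?_)
    cases hok
    -- The annotation `⊥` lies below every index, as the memory alternative demands.
    exact .loadVal hrv ha (.inr ⟨fun m _ _ => WithBot.bot_lt_coe m, hs, hv⟩)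
  | load_execute_forward hi ha hji hj hlast =>
    obtain ⟨-, vs, hrv, ha, -⟩ := ha
    refine .inl (refines_set hi fun k s hs' => hs'.set hi ⟨rfl, by simp [Transient.value]⟩
      (storeLike_of_ne (by simp) (by simp)) fun hok => ?_)
    cases hok
    exact .loadVal hrv ha (.inl ⟨_, _, rfl, hji, hj, by rintro _ _ ⟨⟩; rfl, hlast⟩)
  | load_execute_guess hi hf hji hj =>
    refine .inl (refines_set hi fun k s hs' => hs'.set hi ⟨rfl, by simp [Transient.value]⟩
      (storeLike_of_ne (by simp) (by simp)) fun hok => ?_)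
    cases hok
    exact .loadPartial hji
  | load_execute_addr_ok hi ha hj hsa hbetween =>
    obtain ⟨-, vs, hrv, ha, -⟩ := ha
    refine .inl (refines_set hi fun k s hs' => hs'.set hi ⟨rfl, by simp [Transient.value]⟩
      (storeLike_of_ne (by simp) (by simp)) fun hok => ?_)
    cases hok with
    | refl hs => exact hs.elim
    -- That the store precedes the load is remembered by `loadPartial` from the prediction. The
    -- address of the store may still be unresolved.
    | loadPartial hjk => exact .loadVal hrv ha (.inl ⟨_, _, rfl, hjk, hj, hsa, hbetween⟩)
  | load_execute_addr_hazard hi ha hz => exact .inr (.inr ⟨_, loadRollback_of_execute hi⟩)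
  | load_execute_mem_match hi ha hj hs hv =>
    obtain ⟨-, vs, hrv, ha, -⟩ := ha
    refine .inl (refines_set hi fun k s hs' => hs'.set hi ⟨rfl, by simp [Transient.value]⟩
      (storeLike_of_ne (by simp) (by simp)) fun hok => ?_)
    cases hok with
    | refl hs => exact hs.elim
    | loadPartial hjk =>
      exact .loadVal hrv ha (.inr ⟨fun m _ _ => WithBot.bot_lt_coe m, hs, hv⟩)
  | load_execute_mem_hazard hi ha hj hs hv hne => exact .inr (.inr ⟨_, loadRollback_of_execute hi⟩)
  | @store_execute_value i rv sa v hi hf hv =>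
    refine .inl (refines_set hi fun k s hs => hs.set hi ⟨rfl, by simp [Transient.value]⟩ ⟨?_, ?_⟩ fun hok => ?_)
    · rintro a ⟨rv, l, e⟩
      cases e
      exact ⟨_, l, rfl⟩
    -- A value that is already resolved resolves only to itself.
    · rintro v sa e
      cases e
      cases hv
      rfl
    · cases hok with
      | refl hs =>
        cases sa with
        | resolved => exact hs.elim
        | unresolved => exact .store (.inr ⟨_, hv, rfl⟩) (.inl rfl)
      | store hv' ha =>
        refine .store ?_ ha
        rcases hv' with rfl | ⟨v, hv', rfl⟩
        · exact .inr ⟨_, hv, rfl⟩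
        · cases hv
          exact .inr ⟨_, hv', rfl⟩
  | store_execute_addr_ok hi ha hok =>
    refine .inl (refines_set hi fun k s hs => hs.resolve_store hi ha (hok k) rfl rfl fun m _ => ?_)
    simp
  | @store_execute_addr_hazard i rv rvs a l k n hi ha hk hmin =>
    obtain ⟨hik, r, v, tag, hk, rfl, -⟩ := hk
    refine .inr (.inr ⟨k, fun j hj => ?_, by simp [hk], fun s hs => ?_, fun j s hj hs => ?_,
      fun j hj => ?_, .inr ⟨_, _, _, hi⟩⟩)
    · have : j ≠ i := by rintro rfl; rw [hi] at hj; cases hj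
      simp [this, hj]
    · cases hs.entryOK hk with
      | loadVal => exact ⟨_, _, rfl⟩
      | refl hs => exact hs.elim
    -- The rollback goes to the least hazard, so the entries that are kept have none.
    · refine hs.resolve_store hi ha (fun n => hmin j n hj) rfl rfl fun m hm => ?_
      simp [show m < k from lt_of_le_of_lt hm hj]
    · simp [hj.not_gt, show j ≠ i from (lt_of_lt_of_le hik hj).ne']
  | _ => first | exact absurd rfl hd | exact absurd trivial hf

/-- All steps but retirement keep the buffer correct for the same program point. -/
theorem Correct.step {p : V} {d : Directive V} {o : List (Obs V L)} (h : Correct M P C p)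
    (hstep : Step M P C d o C₁) (hd : d ≠ .retire) : Correct M P C₁ p := by
  by_cases hf : d.IsFetch
  · exact h.fetch hstep hf
  · rcases hstep.of_execute hf hd with hr | ⟨i, t, t', hr⟩ | ⟨k, hr⟩
    · exact h.refine hr
    · exact h.jumpRollback hr
    · exact h.loadRollback hr

end Steps

/-! ### Retirement of single entries, and execution in program order. -/

section Retire

variable {V L R Op Cond : Type*} [DecidableEq V] [DecidableEq R] {C C₁ : Config V L R Op Cond}

/-! ### Retiring a single entry -/

/-- The register file after the entry `t` has been retired. -/
def Transient.commitReg (t : Transient V L R Op Cond) (reg : R → Option (LVal V L)) :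
    R → Option (LVal V L) :=
  match t with
  | .val (.arch r) v _ => Function.update reg r (some v)
  | _ => reg

/-- The memory after the entry `t` has been retired. -/
def Transient.commitMem (t : Transient V L R Op Cond) (mem : V → Option (LVal V L)) :
    V → Option (LVal V L) :=
  match t with
  | .store (.val v) (.resolved (a, _)) => Function.update mem a (some v)
  | _ => mem

/-- The execution of the entry is complete. -/
def Transient.IsComplete : Transient V L R Op Cond → Prop
  | .val _ _ _ => True
  | .jump _ => True
  | .store (.val _) (.resolved _) => True
  | .call => True
  | .ret => True
  | .fence => True
  | _ => False

/-- The configuration after the entry `t` at the index `i` has been retired. -/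
def Config.pop (C : Config V L R Op Cond) (i : ℕ) (t : Transient V L R Op Cond) :
    Config V L R Op Cond :=
  { C with
    reg := t.commitReg C.reg
    mem := t.commitMem C.mem
    buf := C.buf.restrict (i < ·) }

/-- If the retired entry was the latest assignment, its value is now found in the register file. The
temporary register has no place there, so for it `hret` demands a later assignment. -/
theorem Resolves.pop {i k : ℕ} {t : Transient V L R Op Cond} (hlo : ∀ j < i, C.buf.get j = none)
    (hi : C.buf.get i = some t) (ht : t.IsComplete) (hik : i < k) {rv : Operand (TReg R) V L}
    {v : LVal V L} (h : Resolves C.buf C.reg k rv v)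
    (hret : rv = .reg .ret → t.dest = some .ret →
      ∃ j u, i < j ∧ j < k ∧ C.buf.get j = some u ∧ u.dest = some .ret) :
    Resolves (C.pop i t).buf (C.pop i t).reg k rv v := by
  have hget : ∀ m u, (C.buf.restrict (i < ·)).get m = some u → i < m ∧ C.buf.get m = some u := by
    intro m u hm
    simpa using hm
  cases h with
  | val => exact .val _
  | @pending r _ j u hj hu hr hlast hv =>
    rcases lt_trichotomy j i with hji | rfl | hji
    · simp [hlo j hji] at hu
    · rw [hi] at hu
      cases hu
      cases r with
      | arch r =>
        refine .file (fun m u hm hu => hlast _ _ (hget _ _ hu).1 hm (hget _ _ hu).2) ?_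
        cases t <;> simp [Transient.IsComplete, Transient.dest] at ht hr
        subst hr
        simp only [Transient.value, Option.some.injEq] at hv
        subst hv
        simp [Config.pop, Transient.commitReg]
      | ret =>
        obtain ⟨m, u, h1, h2, h3, h4⟩ := hret rfl hr
        exact absurd h4 (hlast _ _ h1 h2 h3)
    · exact .pending j u hj (by simp [Config.pop, hji, hu]) hr
        (fun m u hm hmk hu => hlast _ _ hm hmk (hget _ _ hu).2) hv
  | @file r _ hnone hv =>
    refine .file (fun m u hmk hu => hnone _ _ hmk (hget _ _ hu).2) ?_
    have h1 := hnone _ _ hik hi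
    simp only [Config.pop]
    unfold Transient.commitReg
    split
    · rename_i r' v' _
      have : r ≠ r' := by rintro rfl; simp [Transient.dest] at h1
      rw [Function.update_of_ne this, hv]
    · exact hv

/-- When the providing store retires, the first alternative becomes the second: a complete store has
a resolved address, hence that of the load, its value is now in memory, and its index is below all
that remain. In the memory alternative the retired entry is no store to `a`, so the cell is
unchanged. -/
theorem LoadOK.pop {i k : ℕ} {t : Transient V L R Op Cond} (hlo : ∀ j < i, C.buf.get j = none)
    (hi : C.buf.get i = some t) (ht : t.IsComplete) (hik : i < k) {v : LVal V L}
    {dep : WithBot ℕ} {a : V} (h : LoadOK C.buf C.mem k v dep a) :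
    LoadOK (C.pop i t).buf (C.pop i t).mem k v dep a := by
  have hget : ∀ m u, (C.buf.restrict (i < ·)).get m = some u → i < m ∧ C.buf.get m = some u := by
    intro m u hm
    simpa using hm
  rcases h with ⟨j, sa, rfl, hj, hs, ha, hb⟩ | ⟨hd, hn, hm⟩
  · rcases lt_trichotomy j i with hji | rfl | hji
    · simp [hlo j hji] at hs
    · right
      rw [hi] at hs
      cases hs
      cases sa with
      | unresolved => exact ht.elim
      | resolved al =>
        obtain ⟨a', l⟩ := al
        obtain rfl := ha _ _ rfl
        refine ⟨fun m _ hm => ?_, fun m u hm hu => hb m u (hget _ _ hu).1 hm (hget _ _ hu).2, ?_⟩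
        · have : j < m := by by_contra hle; simp [Config.pop, hle] at hm
          exact_mod_cast this
        · simp [Config.pop, Transient.commitMem]
    · left
      exact ⟨j, sa, rfl, hj, by simp [Config.pop, hji, hs], ha,
        fun m u hm hmk hu => hb m u hm hmk (hget _ _ hu).2⟩
  · right
    refine ⟨fun m hmk hm => hd m hmk ?_, fun m u hmk hu => hn m u hmk (hget _ _ hu).2, ?_⟩
    · intro h0
      simp [Config.pop, h0] at hm
    · have h1 := hn _ _ hik hi
      simp only [Config.pop]
      unfold Transient.commitMem
      split
      · rename_i v' a' l
        have : a ≠ a' := by rintro rfl; exact h1 ⟨_, _, rfl⟩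
        rw [Function.update_of_ne this, hm]
      · exact hm

variable [SemilatticeSup L] [OrderBot L]

/-- One instruction executed in program order, with the addresses and jump targets that its
execution reveals. -/
inductive ArchStep (M : Machine V R Op Cond) (P : Program V L R Op Cond)
    (reg : R → Option (LVal V L)) (mem : V → Option (LVal V L)) (p : V) :
    List V → (R → Option (LVal V L)) → (V → Option (LVal V L)) → V → Prop
  | op {o r rvs n' vs v} (hP : P p = some (.op o r rvs n'))
      (hrv : ArchResolves Op Cond reg (rvs.map Operand.lift) vs)
      (hv : M.evalOp o (vs.map Prod.fst) = some v) :
      ArchStep M P reg mem p [] (Function.update reg r (some (v, joinLabels vs))) mem n'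
  | br {c rvs nTrue nFalse vs b n'} (hP : P p = some (.br c rvs nTrue nFalse))
      (hrv : ArchResolves Op Cond reg (rvs.map Operand.lift) vs)
      (hb : M.evalCond c (vs.map Prod.fst) = some b)
      (hn : (if b then nTrue else nFalse) = n') : ArchStep M P reg mem p [n'] reg mem n'
  | jmpi {rvs vs n'} (hP : P p = some (.jmpi rvs))
      (hrv : ArchResolves Op Cond reg (rvs.map Operand.lift) vs)
      (ha : M.addr (vs.map Prod.fst) = some n') :
      ArchStep M P reg mem p [n'] reg mem n'
  | load {r rvs n' vs a v} (hP : P p = some (.load r rvs n'))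
      (hrv : ArchResolves Op Cond reg (rvs.map Operand.lift) vs)
      (ha : M.addr (vs.map Prod.fst) = some a) (hv : mem a = some v) :
      ArchStep M P reg mem p [a] (Function.update reg r (some v)) mem n'
  | store {rv rvs n' vs a v} (hP : P p = some (.store rv rvs n'))
      (hval : ArchResolves Op Cond reg [rv.lift] [v])
      (hrv : ArchResolves Op Cond reg (rvs.map Operand.lift) vs)
      (ha : M.addr (vs.map Prod.fst) = some a) :
      ArchStep M P reg mem p [a] reg (Function.update mem a (some v)) n'
  | fence {n'} (hP : P p = some (.fence n')) : ArchStep M P reg mem p [] reg mem n'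
  | call {nf nret w v a} (hP : P p = some (.call nf nret)) (hsp : reg M.rsp = some w)
      (hv : M.evalOp M.succ [w.1] = some v) (ha : M.addr [v] = some a) :
      ArchStep M P reg mem p [a] (Function.update reg M.rsp (some (v, joinLabels [w])))
        (Function.update mem a (some (nret, ⊥))) nf
  | ret {w a u v n'} (hP : P p = some .ret) (hsp : reg M.rsp = some w)
      (ha : M.addr [w.1] = some a) (hu : mem a = some u)
      (hv : M.evalOp M.pred [w.1] = some v) (hn : M.addr [u.1] = some n') :
      ArchStep M P reg mem p [a, n'] (Function.update reg M.rsp (some (v, joinLabels [w])))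
        mem n'

variable {M : Machine V R Op Cond} {P : Program V L R Op Cond}

/-- Two runs of the same instruction that reveal the same values continue at the same point. -/
theorem ArchStep.next_eq {reg reg₁ reg' reg₁' : R → Option (LVal V L)}
    {mem mem₁ mem' mem₁' : V → Option (LVal V L)} {p n n' : V} {l : List V}
    (h : ArchStep M P reg mem p l reg₁ mem₁ n)
    (h' : ArchStep M P reg' mem' p l reg₁' mem₁' n') : n = n' := by
  cases h <;> cases h' <;> simp_all

/-- Identifies the instruction that a sequential execution retires with the next link of a `Chain`.
-/
theorem ArchStep.det {reg reg₁ reg₁' : R → Option (LVal V L)}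
    {mem mem₁ mem₁' : V → Option (LVal V L)} {p n n' : V} {l l' : List V}
    (h : ArchStep M P reg mem p l reg₁ mem₁ n)
    (h' : ArchStep M P reg mem p l' reg₁' mem₁' n') :
    reg₁ = reg₁' ∧ mem₁ = mem₁' ∧ n = n' := by
  cases h with
  | op hP hrv hv =>
    cases h' with
    | op hP' hrv' hv' =>
      simp only [hP, Option.some.injEq, Instr.op.injEq] at hP'
      obtain ⟨rfl, rfl, rfl, rfl⟩ := hP'
      cases hrv.det hrv'
      simp_all
    | _ => simp_all
  | br hP hrv hv hn =>
    cases h' with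
    | br hP' hrv' hv' hn' =>
      simp only [hP, Option.some.injEq, Instr.br.injEq] at hP'
      obtain ⟨rfl, rfl, rfl, rfl⟩ := hP'
      cases hrv.det hrv'
      simp_all
    | _ => simp_all
  | jmpi hP hrv ha =>
    cases h' with
    | jmpi hP' hrv' ha' =>
      simp only [hP, Option.some.injEq, Instr.jmpi.injEq] at hP'
      cases hP'
      cases hrv.det hrv'
      simp_all
    | _ => simp_all
  | load hP hrv ha hv =>
    cases h' with
    | load hP' hrv' ha' hv' =>
      simp only [hP, Option.some.injEq, Instr.load.injEq] at hP'
      obtain ⟨rfl, rfl, rfl⟩ := hP'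
      cases hrv.det hrv'
      simp_all
    | _ => simp_all
  | store hP hval hrv ha =>
    cases h' with
    | store hP' hval' hrv' ha' =>
      simp only [hP, Option.some.injEq, Instr.store.injEq] at hP'
      obtain ⟨rfl, rfl, rfl⟩ := hP'
      cases hrv.det hrv'
      cases hval.det hval'
      simp_all
    | _ => simp_all
  | _ => cases h' <;> simp_all

/-- Retiring the oldest entry keeps the later entries correct. -/
theorem Entry.pop {i k : ℕ} {s t : Transient V L R Op Cond} (h : Entry M C k s)
    (hlo : ∀ j < i, C.buf.get j = none) (hi : C.buf.get i = some t) (ht : t.IsComplete)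
    (hik : i < k) (hret : t.dest = some .ret → i + 2 < k) : Entry M (C.pop i t) k s := by
  obtain ⟨⟨u, hu, hok⟩, hr⟩ := h
  refine ⟨⟨u, by simp [Config.pop, hik, hu], hok.mono (fun rv hrv v hv => hv.pop hlo hi ht hik ?_)
    fun _ _ _ _ hl => hl.pop hlo hi ht hik⟩, fun hs => ?_⟩
  -- The assignment to the temporary register that this entry relies on sits at `k - 2`, beyond the
  -- retired index.
  · rintro rfl hd
    obtain ⟨j, w, hj, hw, hwd⟩ := hr hrv
    exact ⟨j, w, by have := hret hd; omega, by omega, hw, hwd⟩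
  · obtain ⟨j, w, hj, hw, hwd⟩ := hr hs
    refine ⟨j, w, hj, ?_, hwd⟩
    have : i < j := by
      rcases lt_trichotomy i j with h | rfl | h
      · exact h
      · rw [hi] at hw
        cases hw
        have := hret hwd
        omega
      · simp [hlo j h] at hw
    simp [Config.pop, this, hw]

end Retire

/-! ### Retirement of whole instructions. -/

section RetireGroup

variable {V L R Op Cond : Type*} [DecidableEq V] [DecidableEq R] [SemilatticeSup L] [OrderBot L]
  {M : Machine V R Op Cond} {P : Program V L R Op Cond} {C C₁ : Config V L R Op Cond}

/-- What a retirement does. -/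
theorem Step.of_retire {i : ℕ} {t : Transient V L R Op Cond} {o : List (Obs V L)}
    (hlo : ∀ j < i, C.buf.get j = none) (hi : C.buf.get i = some t)
    (h : Step M P C .retire o C₁) :
    (t.IsComplete ∧ t ≠ .call ∧ t ≠ .ret ∧ t.dest ≠ some .ret ∧ C₁ = C.pop i t) ∨
    (t = .call ∧ ∃ vsp tag v a l, C.buf.get (i + 1) = some (.val (.arch M.rsp) vsp tag) ∧
      C.buf.get (i + 2) = some (.store (.val v) (.resolved (a, l))) ∧
      C₁ = ((C.pop i .call).pop (i + 1) (.val (.arch M.rsp) vsp tag)).pop (i + 2)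
        (.store (.val v) (.resolved (a, l)))) ∨
    (t = .ret ∧ ∃ v₁ tag₁ v₂ tag₂ n', C.buf.get (i + 1) = some (.val .ret v₁ tag₁) ∧
      C.buf.get (i + 2) = some (.val (.arch M.rsp) v₂ tag₂) ∧
      C.buf.get (i + 3) = some (.jump n') ∧
      C₁ = (((C.pop i .ret).pop (i + 1) (.val .ret v₁ tag₁)).pop (i + 2)
        (.val (.arch M.rsp) v₂ tag₂)).pop (i + 3) (.jump n')) := by
  cases h with
  | val_retire h | jump_retire h | store_retire h | fence_retire h =>
    obtain ⟨rfl, rfl⟩ := h.eq hlo hi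
    left
    simp [Transient.IsComplete, Transient.dest, Config.pop, Transient.commitReg,
      Transient.commitMem, IdxMap.restrict_ne_eq hlo]
  | call_retire h h1 h2 =>
    obtain ⟨rfl, rfl⟩ := h.eq hlo hi
    refine .inr (.inl ⟨rfl, _, _, _, _, _, h1, h2, ?_⟩)
    simp only [Config.pop, Transient.commitReg, Transient.commitMem, Config.mk.injEq, true_and,
      and_true]
    ext1
    funext j
    simp only [IdxMap.get_restrict]
    split_ifs <;> first | rfl | omega
  | ret_retire h h1 h2 h3 =>
    obtain ⟨rfl, rfl⟩ := h.eq hlo hi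
    refine .inr (.inr ⟨rfl, _, _, _, _, _, h1, h2, h3, ?_⟩)
    simp only [Config.pop, Transient.commitReg, Transient.commitMem, Config.mk.injEq, true_and,
      and_true]
    ext1
    funext j
    simp only [IdxMap.get_restrict]
    split_ifs <;> first | rfl | omega

/-- `C₁` arises from `C` by retiring the `len` entries from index `i` on; later entries stay
correct. -/
structure RetiredTo (M : Machine V R Op Cond) (C : Config V L R Op Cond) (i len : ℕ)
    (C₁ : Config V L R Op Cond) : Prop where
  pc : C₁.pc = C.pc
  get : ∀ k, C₁.buf.get k = if k < i + len then none else C.buf.get k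
  entry : ∀ k s, i + len ≤ k → Entry M C k s → Entry M C₁ k s

theorem retiredTo_pop {i : ℕ} {t : Transient V L R Op Cond} (hlo : ∀ j < i, C.buf.get j = none)
    (hi : C.buf.get i = some t) (ht : t.IsComplete) (hd : t.dest ≠ some .ret) :
    RetiredTo M C i 1 (C.pop i t) := by
  refine ⟨rfl, fun k => ?_, fun k s hk hs => hs.pop hlo hi ht hk (absurd · hd)⟩
  simp only [Config.pop, IdxMap.get_restrict]
  split_ifs <;> first | rfl | omega

/-- Retiring a group of entries is a step of the execution in program order. -/
theorem Step.retire_group {i : ℕ} {p n : V} {srcs : List (Transient V L R Op Cond)}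
    {o : List (Obs V L)} (hlo : ∀ j < i, C.buf.get j = none) (hf : Fetched M P p srcs n)
    (he : ∀ k s, srcs[k]? = some s → Entry M C (i + k) s) (h : Step M P C .retire o C₁) :
    ArchStep M P C.reg C.mem p (bufLeak C.buf i srcs.length) C₁.reg C₁.mem n ∧
      RetiredTo M C i srcs.length C₁ := by
  obtain ⟨s, h0⟩ : ∃ s, srcs[0]? = some s := ⟨_, List.getElem?_eq_getElem hf.length_pos⟩
  obtain ⟨⟨t, hi, hok⟩, -⟩ := he 0 _ h0
  rw [Nat.add_zero] at hi hok
  have hR := h.of_retire hlo hi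
  cases hf with
  | op hP =>
    cases h0
    cases hok with
    | refl => simp [Transient.IsComplete] at hR
    | op hrv hv =>
      simp at hR
      obtain ⟨hc, hd, rfl⟩ := hR
      refine ⟨?_, retiredTo_pop hlo hi hc hd⟩
      refine (bufLeak_one hi).symm ▸ .op hP ((resolvesList_iff_archResolves hlo).1 hrv) hv
  | br b hP =>
    cases h0
    cases hok with
    | refl => simp [Transient.IsComplete] at hR
    | br hrv hb hn =>
      simp at hR
      obtain ⟨hc, hd, rfl⟩ := hR
      refine ⟨?_, retiredTo_pop hlo hi hc hd⟩
      refine (bufLeak_one hi).symm ▸ .br hP ((resolvesList_iff_archResolves hlo).1 hrv) hb hn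
  | jmpi n' hP =>
    cases h0
    cases hok with
    | refl => simp [Transient.IsComplete] at hR
    | jmpi hrv ha =>
      simp at hR
      obtain ⟨hc, hd, rfl⟩ := hR
      refine ⟨?_, retiredTo_pop hlo hi hc hd⟩
      refine (bufLeak_one hi).symm ▸ .jmpi hP ((resolvesList_iff_archResolves hlo).1 hrv) ha
  | load hP =>
    cases h0
    cases hok with
    | refl => simp [Transient.IsComplete] at hR
    | loadPartial => simp [Transient.IsComplete] at hR
    | loadVal hrv ha hl =>
      simp at hR
      obtain ⟨hc, hd, rfl⟩ := hR
      refine ⟨?_, retiredTo_pop hlo hi hc hd⟩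
      have hm := hl.mem_eq fun j hj rv sa hs => by simp [hlo j hj] at hs
      refine (bufLeak_one hi).symm ▸ .load hP ((resolvesList_iff_archResolves hlo).1 hrv) ha hm
  | @store rv rvs n' hP =>
    cases h0
    cases hok with
    | refl => cases rv <;> simp [Transient.IsComplete, Operand.lift] at hR
    | @store _ _ rv' sa hv ha =>
      rcases ha with rfl | ⟨vs, a, l, hrv, ha, rfl⟩
      · cases rv' <;> simp [Transient.IsComplete] at hR
      cases rv' with
      | reg r => simp [Transient.IsComplete] at hR
      | val v =>
        simp at hR
        obtain ⟨hc, hd, rfl⟩ := hR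
        refine ⟨?_, retiredTo_pop hlo hi hc hd⟩
        have hval : Resolves C.buf C.reg i rv.lift v := by
          rcases hv with hv | ⟨v', hv, e⟩
          · exact hv ▸ .val v
          · cases e
            exact hv
        refine (bufLeak_one hi).symm ▸ .store hP ((resolvesList_iff_archResolves (rvs := [rv]) hlo).1
          (resolvesList_singleton.2 ⟨v, rfl, hval⟩))
          ((resolvesList_iff_archResolves hlo).1 hrv) ha
  | fence hP =>
    cases h0
    cases hok
    simp at hR
    obtain ⟨hc, hd, rfl⟩ := hR
    refine ⟨?_, retiredTo_pop hlo hi hc hd⟩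
    refine (bufLeak_one hi).symm ▸ .fence hP
  | @call _ nret hP =>
    cases h0
    cases hok
    rcases hR with ⟨-, hne, -⟩ | ⟨-, vsp, tag, v, a, l, h1, h2, rfl⟩ | ⟨e, -⟩
    · exact absurd rfl hne
    swap
    · cases e
    have e1 := (he 1 _ rfl).entryOK h1
    have e2 := (he 2 _ rfl).entryOK h2
    have hlo1 : ∀ j < i + 1, (C.pop i .call).buf.get j = none := fun j hj => by
      simp [Config.pop]; omega
    have hlo2 : ∀ j < i + 2, ((C.pop i .call).pop (i + 1)
        (.val (.arch M.rsp) vsp tag)).buf.get j = none := fun j hj => by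
      simp [Config.pop]; omega
    have g1 : (C.pop i .call).buf.get (i + 1) = some (.val (.arch M.rsp) vsp tag) := by
      simp [Config.pop, h1]
    have g2 : ((C.pop i .call).pop (i + 1) (.val (.arch M.rsp) vsp tag)).buf.get (i + 2) =
        some (.store (.val v) (.resolved (a, l))) := by
      simp [Config.pop, h2]
    refine ⟨?_, rfl, fun k => ?_, fun k s hk hs => ?_⟩
    · have hl : bufLeak C.buf i 3 = [a] := by
        cases e1
        simp [bufLeak, List.range_succ, hi, h1, h2, Transient.leak]
      cases e1 with
      | op hrv hv =>
        obtain ⟨w, rfl, hw⟩ := resolvesList_singleton.1 hrv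
        rw [resolves_arch_iff] at hw
        · cases e2 with
          | store hval ha =>
            rcases ha with ha | ⟨vs, a', l', hrv', ha, e⟩
            · cases ha
            cases e
            obtain ⟨w', rfl, hw'⟩ := resolvesList_singleton.1 hrv'
            -- The address of the store is computed from the new stack pointer, the pending result
            -- of the entry before.
            obtain rfl := hw'.det (.pending (i + 1) _ (by omega) h1 rfl
              (fun k _ _ _ => by omega) rfl)
            have hval' : v = (nret, ⊥) := by
              rcases hval with hval | ⟨v', hval, e⟩
              · cases hval; rfl
              · cases hval; cases e; rfl
            subst hval'
            exact hl ▸ .call hP hw hv ha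
        · intro k u hk hu
          rcases Nat.lt_succ_iff_lt_or_eq.1 hk with hk | rfl
          · simp [hlo k hk] at hu
          · rw [hi] at hu
            cases hu
            simp [Transient.dest]
    · simp only [Config.pop, IdxMap.get_restrict, List.length_cons, List.length_nil]
      split_ifs <;> first | rfl | omega
    · simp only [List.length_cons, List.length_nil] at hk
      exact ((hs.pop hlo hi trivial (by omega) (by simp [Transient.dest])).pop hlo1 g1 trivial
        (by omega) (by simp [Transient.dest])).pop hlo2 g2 trivial (by omega)
        (by simp [Transient.dest])
  | ret n' hP =>
    cases h0
    cases hok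
    rcases hR with ⟨-, -, hne, -⟩ | ⟨e, -⟩ | ⟨-, v₁, tag₁, v₂, tag₂, n'', h1, h2, h3, rfl⟩
    · exact absurd rfl hne
    · cases e
    have e1 := (he 1 _ rfl).entryOK h1
    have e2 := (he 2 _ rfl).entryOK h2
    have e3 := (he 3 _ rfl).entryOK h3
    have hlo1 : ∀ j < i + 1, (C.pop i .ret).buf.get j = none := fun j hj => by
      simp [Config.pop]; omega
    have hlo2 : ∀ j < i + 2, ((C.pop i .ret).pop (i + 1) (.val .ret v₁ tag₁)).buf.get j = none :=
      fun j hj => by simp [Config.pop]; omega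
    have hlo3 : ∀ j < i + 3, (((C.pop i .ret).pop (i + 1) (.val .ret v₁ tag₁)).pop (i + 2)
        (.val (.arch M.rsp) v₂ tag₂)).buf.get j = none := fun j hj => by
      simp [Config.pop]; omega
    have g1 : (C.pop i .ret).buf.get (i + 1) = some (.val .ret v₁ tag₁) := by
      simp [Config.pop, h1]
    have g2 : ((C.pop i .ret).pop (i + 1) (.val .ret v₁ tag₁)).buf.get (i + 2) =
        some (.val (.arch M.rsp) v₂ tag₂) := by
      simp [Config.pop, h2]
    have g3 : (((C.pop i .ret).pop (i + 1) (.val .ret v₁ tag₁)).pop (i + 2)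
        (.val (.arch M.rsp) v₂ tag₂)).buf.get (i + 3) = some (.jump n'') := by
      simp [Config.pop, h3]
    -- Neither the marker nor the load into the temporary register assigns the stack pointer, so the
    -- load and the `pred` operation both read it from the register file.
    have hsp : ∀ m ≤ 2, ∀ w, Resolves C.buf C.reg (i + m) (.reg (.arch M.rsp)) w →
        C.reg M.rsp = some w := by
      intro m hm w hw
      rwa [resolves_arch_iff] at hw
      intro k u hk hu
      rcases lt_trichotomy k i with hki | rfl | hki
      · simp [hlo k hki] at hu
      · rw [hi] at hu
        cases hu
        simp [Transient.dest]
      · obtain rfl : k = i + 1 := by omega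
        rw [h1] at hu
        cases hu
        simp [Transient.dest]
    refine ⟨?_, rfl, fun k => ?_, fun k s hk hs => ?_⟩
    · cases e1 with
      | @loadVal _ _ _ vs a dep _ hrv ha hl =>
        obtain ⟨w, rfl, hw⟩ := resolvesList_singleton.1 hrv
        have hm : C.mem a = some v₁ := hl.mem_eq fun j hj rv sa hs => by
          rcases Nat.lt_succ_iff_lt_or_eq.1 hj with hj | rfl
          · simp [hlo j hj] at hs
          · simp [hi] at hs
        cases e2 with
        | op hrv2 hv =>
          obtain ⟨w', rfl, hw'⟩ := resolvesList_singleton.1 hrv2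
          obtain rfl : w = w' := by
            have := (hsp 1 (by omega) _ hw).symm.trans (hsp 2 le_rfl _ hw')
            simpa using this
          cases e3 with
          | jmpi hrv3 hn =>
            obtain ⟨u, rfl, hu⟩ := resolvesList_singleton.1 hrv3
            obtain rfl := hu.det (.pending (i + 1) _ (by omega) h1 rfl (fun k t' hk1 hk2 ht' => by
              obtain rfl : k = i + 2 := by omega
              rw [h2] at ht'
              cases ht'
              simp [Transient.dest]) rfl)
            have hl : bufLeak C.buf i 4 = [a, n] := by
              simp [bufLeak, List.range_succ, hi, h1, h2, h3, Transient.leak]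
            exact hl ▸ .ret hP (hsp 1 (by omega) _ hw) ha hm hv hn
    · simp only [Config.pop, IdxMap.get_restrict, List.length_cons, List.length_nil]
      split_ifs <;> first | rfl | omega
    · simp only [List.length_cons, List.length_nil] at hk
      -- Later entries start at `i + 4`, more than two places after the load at `i + 1`, so none of
      -- them reads the temporary register from it.
      exact (((hs.pop hlo hi trivial (by omega) (by simp [Transient.dest])).pop hlo1 g1 trivial
        (by omega) (fun _ => by omega)).pop hlo2 g2 trivial (by omega)
        (by simp [Transient.dest])).pop hlo3 g3 trivial (by omega) (by simp [Transient.dest])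

/-- Retirement in a correct configuration. -/
theorem Correct.retire {p : V} {o : List (Obs V L)} (h : Correct M P C p)
    (hstep : Step M P C .retire o C₁) : ∃ i srcs n, Fetched M P p srcs n ∧
      (∀ k < i, C.buf.get k = none) ∧ C.buf.get i ≠ none ∧
      ArchStep M P C.reg C.mem p (bufLeak C.buf i srcs.length) C₁.reg C₁.mem n ∧
      Correct M P C₁ n := by
  obtain ⟨i, h1, hlo, hL⟩ := h
  cases hL with
  | done hn hpc =>
    have hall : ∀ k, C.buf.get k = none := fun k =>
      if hk : k < i then hlo k hk else hn k (by omega)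
    cases hstep <;> rename_i h <;> simp [Oldest, hall] at h
  | group hf he rest =>
    obtain ⟨ha, hr⟩ := hstep.retire_group hlo hf he
    refine ⟨i, _, _, hf, hlo, ?_, ha, i + _, ?_, fun k hk => ?_, rest.mono_from hr.pc
      (fun k hk hn => ?_) hr.entry⟩
    · exact (he 0 _ (List.getElem?_eq_getElem hf.length_pos)).get_ne_none
    · omega
    · rw [hr.get, if_pos hk]
    · rw [hr.get, hn, ite_self]
  | stuck hP he rest =>
    obtain ⟨⟨t, ht, hok⟩, -⟩ := he
    cases hok
    rcases hstep.of_retire hlo ht with ⟨-, -, hne, -⟩ | ⟨e, -⟩ | ⟨-, v, tag, -, -, -, h1, -⟩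
    · exact absurd rfl hne
    · cases e
    -- A leftover marker cannot retire: the entry behind it, if there is one, is again a `ret`
    -- marker and not a resolved load.
    cases rest with
    | done hn hpc => simp [hn] at h1
    | stuck hP he _ => cases he.entryOK h1
    | group hf he _ =>
      have hs := he 0 _ (List.getElem?_eq_getElem hf.length_pos)
      cases hf <;> simp_all
      cases hs.entryOK h1

end RetireGroup

/-! ### Low-equivalence of buffer contents. -/

section LowEquivalence

variable {V L R Op Cond : Type*} [SemilatticeSup L] [OrderBot L]

/-- Low-equivalence of labelled values. -/
def LowEqVal (v v' : LVal V L) : Prop := v.2 = v'.2 ∧ (v.2 = ⊥ → v = v')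

theorem LowEqVal.refl (v : LVal V L) : LowEqVal v v := ⟨rfl, fun _ => rfl⟩

theorem LowEqVal.symm {v v' : LVal V L} (h : LowEqVal v v') : LowEqVal v' v :=
  ⟨h.1.symm, fun e => (h.2 (h.1.trans e)).symm⟩

theorem LowEqCell.symm {x y : Option (LVal V L)} (h : LowEqCell x y) : LowEqCell y x :=
  ⟨h.1.symm, fun e => (h.2 (h.1.trans e)).symm⟩

theorem lowEqCell_some {v v' : LVal V L} : LowEqCell (some v) (some v') ↔ LowEqVal v v' := by
  simp [LowEqCell, LowEqVal]

theorem LowEqCell.exists_of_some {x y : Option (LVal V L)} {v : LVal V L} (h : LowEqCell x y)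
    (hx : x = some v) : ∃ v', y = some v' ∧ LowEqVal v v' := by
  subst hx
  cases y with
  | none => exact absurd h.1 (by simp)
  | some v' => exact ⟨v', rfl, lowEqCell_some.1 h⟩

theorem LowEqCell.update {α : Type*} [DecidableEq α] {f f' : α → Option (LVal V L)}
    (h : ∀ x, LowEqCell (f x) (f' x)) {v v' : LVal V L} (hv : LowEqVal v v') (a x : α) :
    LowEqCell (Function.update f a (some v) x) (Function.update f' a (some v') x) := by
  by_cases hx : x = a
  · subst hx
    simpa using lowEqCell_some.2 hv
  · simpa [Function.update_of_ne hx] using h x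

theorem joinLabels_cons (v : LVal V L) (vs : List (LVal V L)) :
    joinLabels (v :: vs) = v.2 ⊔ joinLabels vs := rfl

theorem joinLabels_eq {vs vs' : List (LVal V L)} (h : List.Forall₂ LowEqVal vs vs') :
    joinLabels vs = joinLabels vs' := by
  induction h with
  | nil => rfl
  | cons h _ ih => rw [joinLabels_cons, joinLabels_cons, h.1, ih]

/-- A join is `⊥` only if every label is, and on public values low-equivalence is equality. -/
theorem eq_of_joinLabels_eq_bot {vs vs' : List (LVal V L)} (h : List.Forall₂ LowEqVal vs vs')
    (hb : joinLabels vs = ⊥) : vs = vs' := by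
  induction h with
  | nil => rfl
  | cons h _ ih =>
    rw [joinLabels_cons, sup_eq_bot_iff] at hb
    rw [h.2 hb.1, ih hb.2]

/-- Results computed from low-equivalent operands are low-equivalent. -/
theorem lowEqVal_of_eval {f : List V → Option V} {vs vs' : List (LVal V L)} {v v' : V}
    (h : List.Forall₂ LowEqVal vs vs') (hv : f (vs.map Prod.fst) = some v)
    (hv' : f (vs'.map Prod.fst) = some v') :
    LowEqVal (v, joinLabels vs) (v', joinLabels vs') := by
  refine ⟨joinLabels_eq h, fun hb => ?_⟩
  cases eq_of_joinLabels_eq_bot h hb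
  simp_all

/-- Low-equivalence of operands. -/
inductive OperandSim : Operand (TReg R) V L → Operand (TReg R) V L → Prop
  | reg (r : TReg R) : OperandSim (.reg r) (.reg r)
  | val {v v' : LVal V L} (h : LowEqVal v v') : OperandSim (.val v) (.val v')

/-- Low-equivalence of transient instructions: they differ only in secret data. -/
inductive TransientSim : Transient V L R Op Cond → Transient V L R Op Cond → Prop
  | op (r o rvs) : TransientSim (.op r o rvs) (.op r o rvs)
  | val (r tag) {v v'} (h : LowEqVal v v') : TransientSim (.val r v tag) (.val r v' tag)
  | br (c rvs n₀ nTrue nFalse) :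
      TransientSim (.br c rvs n₀ nTrue nFalse) (.br c rvs n₀ nTrue nFalse)
  | jump (n) : TransientSim (.jump n) (.jump n)
  | load (r rvs n) : TransientSim (.load r rvs n) (.load r rvs n)
  | loadPartial (r rvs j n) {v v'} (h : LowEqVal v v') :
      TransientSim (.loadPartial r rvs v j n) (.loadPartial r rvs v' j n)
  | store (sa) {rv rv'} (h : OperandSim rv rv') : TransientSim (.store rv sa) (.store rv' sa)
  | jmpi (rvs n) : TransientSim (.jmpi rvs n) (.jmpi rvs n)
  | call : TransientSim .call .call
  | ret : TransientSim .ret .ret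
  | fence : TransientSim .fence .fence

theorem OperandSim.symm {rv rv' : Operand (TReg R) V L} (h : OperandSim rv rv') :
    OperandSim rv' rv := by
  cases h with
  | reg r => exact .reg r
  | val h => exact .val h.symm

theorem OperandSim.refl (rv : Operand (TReg R) V L) : OperandSim rv rv := by
  cases rv with
  | reg r => exact .reg r
  | val v => exact .val (.refl v)

namespace TransientSim

variable {t t' : Transient V L R Op Cond}

theorem symm (h : TransientSim t t') : TransientSim t' t := by
  cases h <;> constructor
  all_goals first | exact LowEqVal.symm ‹_› | exact OperandSim.symm ‹_›

theorem dest_eq (h : TransientSim t t') : t'.dest = t.dest := by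
  cases h <;> rfl

/-- The relation lets only data differ; annotations, resolved addresses and jump targets are shared.
-/
theorem leak_eq (h : TransientSim t t') : t'.leak = t.leak := by
  cases h with
  | val r tag h => cases tag <;> rfl
  | store sa h => cases sa <;> rfl
  | _ => rfl

theorem value_some (h : TransientSim t t') {v : LVal V L} (hv : t.value = some v) :
    ∃ v', t'.value = some v' ∧ LowEqVal v v' := by
  cases h <;> simp [Transient.value] at hv ⊢
  all_goals subst hv; assumption

theorem storesTo (h : TransientSim t t') {a : V} (hs : t.StoresTo a) : t'.StoresTo a := by
  obtain ⟨rv, l, rfl⟩ := hs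
  cases h
  exact ⟨_, l, rfl⟩

end TransientSim

/-- Low-equivalence of reorder buffers. -/
def BufSim (buf buf' : IdxMap (Transient V L R Op Cond)) : Prop :=
  ∀ i, Option.Rel TransientSim (buf.get i) (buf'.get i)

namespace BufSim

variable {buf buf' : IdxMap (Transient V L R Op Cond)}

theorem symm (h : BufSim buf buf') : BufSim buf' buf := by
  intro i
  have := h i
  generalize buf.get i = x at *
  generalize buf'.get i = y at *
  cases this with
  | none => exact .none
  | some h => exact .some h.symm

theorem exists_of_some (h : BufSim buf buf') {i : ℕ} {t : Transient V L R Op Cond}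
    (ht : buf.get i = some t) : ∃ t', buf'.get i = some t' ∧ TransientSim t t' := by
  have := h i
  rw [ht] at this
  generalize buf'.get i = y at *
  cases this with | some h => exact ⟨_, rfl, h⟩

theorem get_eq_none (h : BufSim buf buf') {i : ℕ} (hi : buf.get i = none) :
    buf'.get i = none := by
  have := h i
  rw [hi] at this
  generalize buf'.get i = y at *
  cases this
  rfl

theorem dom_eq (h : BufSim buf buf') : buf.dom = buf'.dom := by
  ext i
  exact ⟨fun hi hn => hi (h.symm.get_eq_none hn), fun hi hn => hi (h.get_eq_none hn)⟩

theorem set (h : BufSim buf buf') (i : ℕ) {t t' : Transient V L R Op Cond}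
    (ht : TransientSim t t') : BufSim (buf.set i t) (buf'.set i t') := by
  intro j
  rw [IdxMap.get_set, IdxMap.get_set]
  split_ifs
  · exact .some ht
  · exact h j

theorem restrict (h : BufSim buf buf') (p : ℕ → Prop) [DecidablePred p] :
    BufSim (buf.restrict p) (buf'.restrict p) := by
  intro j
  rw [IdxMap.get_restrict, IdxMap.get_restrict]
  split_ifs
  · exact h j
  · exact .none

theorem bufLeak_eq (h : BufSim buf buf') (i len : ℕ) : bufLeak buf' i len = bufLeak buf i len := by
  unfold bufLeak
  congr 1
  funext k
  cases hk : buf.get (i + k) with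
  | none => rw [h.get_eq_none hk]
  | some t =>
    obtain ⟨t', ht', hs⟩ := h.exists_of_some hk
    rw [ht', Option.map_some, Option.map_some, hs.leak_eq]

theorem noFence (h : BufSim buf buf') {i : ℕ} (hf : NoFence buf i) : NoFence buf' i := by
  rintro j t hj ht rfl
  obtain ⟨t', ht', hs⟩ := h.symm.exists_of_some ht
  cases hs
  exact hf j _ hj ht' rfl

theorem noStoreTo (h : BufSim buf buf') {i : ℕ} {a : V} (hn : NoStoreTo buf i a) :
    NoStoreTo buf' i a := by
  intro j t hj ht hst
  obtain ⟨t', ht', hs⟩ := h.symm.exists_of_some ht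
  exact hn j _ hj ht' (hs.storesTo hst)

theorem hazard (h : BufSim buf buf') {i k : ℕ} {a n : V} (hz : Hazard buf i a k n) :
    Hazard buf' i a k n := by
  obtain ⟨hik, r, v, tag, hk, hz⟩ := hz
  obtain ⟨t', ht', hs⟩ := h.exists_of_some hk
  cases hs
  exact ⟨hik, r, _, tag, ht', hz⟩

/-- Rollbacks for a resolved store address go to the same load. -/
theorem hazard_unique (h : BufSim buf buf') {i k k' : ℕ} {a n n' : V}
    (hk : Hazard buf i a k n) (hmin : ∀ m p, m < k → ¬ Hazard buf i a m p)
    (hk' : Hazard buf' i a k' n') (hmin' : ∀ m p, m < k' → ¬ Hazard buf' i a m p) :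
    k = k' ∧ n = n' := by
  obtain rfl : k = k' := by
    rcases lt_trichotomy k k' with hlt | rfl | hlt
    · exact absurd (h.hazard hk) (hmin' _ _ hlt)
    · rfl
    · exact absurd (h.symm.hazard hk') (hmin _ _ hlt)
  obtain ⟨-, r, v, tag, hg, rfl, -⟩ := h.hazard hk
  obtain ⟨-, r', v', tag', hk', rfl, -⟩ := hk'
  cases hg.symm.trans hk'
  exact ⟨rfl, rfl⟩

/-- Related entries have the same destination. So the latest assignment to a register has the same
index on both sides, and the register file is consulted on both sides or on neither. -/
theorem resolves (h : BufSim buf buf') {reg reg' : R → Option (LVal V L)}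
    (hr : ∀ r, LowEqCell (reg r) (reg' r)) {i : ℕ} {rv rv' : Operand (TReg R) V L} {v : LVal V L}
    (ho : OperandSim rv rv') (hv : Resolves buf reg i rv v) :
    ∃ v', Resolves buf' reg' i rv' v' ∧ LowEqVal v v' := by
  cases hv with
  | val => cases ho with | val ho => exact ⟨_, .val _, ho⟩
  | pending j t hj ht hd hlast hv =>
    cases ho
    obtain ⟨t', ht', hs⟩ := h.exists_of_some ht
    obtain ⟨v', hv', hl⟩ := hs.value_some hv
    refine ⟨v', .pending j t' hj ht' (hs.dest_eq.trans hd) (fun k u hjk hki hu => ?_) hv', hl⟩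
    obtain ⟨u', hu', hs'⟩ := h.symm.exists_of_some hu
    rw [← hs'.dest_eq]
    exact hlast k _ hjk hki hu'
  | file hnone hv =>
    cases ho
    obtain ⟨v', hv', hl⟩ := (hr _).exists_of_some hv
    refine ⟨v', .file (fun k u hki hu => ?_) hv', hl⟩
    obtain ⟨u', hu', hs'⟩ := h.symm.exists_of_some hu
    rw [← hs'.dest_eq]
    exact hnone k _ hki hu'

theorem resolvesList (h : BufSim buf buf') {reg reg' : R → Option (LVal V L)}
    (hr : ∀ r, LowEqCell (reg r) (reg' r)) {i : ℕ} {rvs : List (Operand (TReg R) V L)}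
    {vs : List (LVal V L)} (hvs : ResolvesList buf reg i rvs vs) :
    ∃ vs', ResolvesList buf' reg' i rvs vs' ∧ List.Forall₂ LowEqVal vs vs' := by
  induction hvs with
  | nil => exact ⟨[], .nil, .nil⟩
  | cons h1 _ ih =>
    obtain ⟨v', hv', hl⟩ := h.resolves hr (.refl _) h1
    obtain ⟨vs', hvs', hls⟩ := ih
    exact ⟨v' :: vs', .cons hv' hvs', .cons hl hls⟩

end BufSim

/-- Low-equivalence of configurations in the middle of an execution. -/
structure Sim (C C' : Config V L R Op Cond) : Prop where
  reg : ∀ r, LowEqCell (C.reg r) (C'.reg r)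
  mem : ∀ a, LowEqCell (C.mem a) (C'.mem a)
  pc : C.pc = C'.pc
  rsb : C.rsb = C'.rsb
  buf : BufSim C.buf C'.buf

theorem Sim.symm {C C' : Config V L R Op Cond} (h : Sim C C') : Sim C' C :=
  ⟨fun r => (h.reg r).symm, fun a => (h.mem a).symm, h.pc.symm, h.rsb.symm, h.buf.symm⟩

theorem Sim.lowEq {C C' : Config V L R Op Cond} (h : Sim C C') : LowEq C C' :=
  ⟨h.reg, h.mem, h.pc, h.rsb, h.buf.dom_eq⟩

/-- Between empty buffers equality of the domains already says everything about the contents. -/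
theorem LowEq.sim {C C' : Config V L R Op Cond} (h : LowEq C C') (hC : C.buf.dom = ∅) :
    Sim C C' := by
  obtain ⟨h1, h2, h3, h4, h5⟩ := h
  refine ⟨h1, h2, h3, h4, fun i => ?_⟩
  rw [IdxMap.dom_eq_empty_iff.1 hC, IdxMap.dom_eq_empty_iff.1 (h5 ▸ hC)]
  exact .none

theorem Sim.freshIdx_eq {C C' : Config V L R Op Cond} (h : Sim C C') :
    freshIdx C = freshIdx C' := by
  rw [freshIdx, freshIdx, IdxMap.maxIdx, IdxMap.maxIdx, h.buf.dom_eq]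

theorem Sim.minIdx_eq {C C' : Config V L R Op Cond} (h : Sim C C') :
    C.buf.minIdx = C'.buf.minIdx := by
  rw [IdxMap.minIdx, IdxMap.minIdx, h.buf.dom_eq]

/-- In low-equivalent configurations operands resolve to low-equivalent values. -/
theorem Sim.forall₂_lowEqVal {C C' : Config V L R Op Cond} (h : Sim C C') {i : ℕ}
    {rvs : List (Operand (TReg R) V L)} {vs vs' : List (LVal V L)}
    (hv : ResolvesList C.buf C.reg i rvs vs) (hv' : ResolvesList C'.buf C'.reg i rvs vs') :
    List.Forall₂ LowEqVal vs vs' := by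
  obtain ⟨ws, hws, hl⟩ := h.buf.resolvesList h.reg hv
  exact hws.det hv' ▸ hl

theorem Sim.lowEqVal {C C' : Config V L R Op Cond} (h : Sim C C') {i : ℕ}
    {rv rv' : Operand (TReg R) V L} {v v' : LVal V L} (ho : OperandSim rv rv')
    (hv : Resolves C.buf C.reg i rv v) (hv' : Resolves C'.buf C'.reg i rv' v') : LowEqVal v v' := by
  obtain ⟨w, hw, hl⟩ := h.buf.resolves h.reg ho hv
  exact hw.det hv' ▸ hl

end LowEquivalence

/-! ### Two runs with equal traces in lockstep. -/

section Lockstep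

variable {V L R Op Cond : Type*} [SemilatticeSup L] [OrderBot L]
  {M : Machine V R Op Cond} {P : Program V L R Op Cond} {C C₁ C' C₁' : Config V L R Op Cond}

theorem Sim.set (h : Sim C C') (i : ℕ) {t t' : Transient V L R Op Cond}
    (ht : TransientSim t t') :
    Sim { C with buf := C.buf.set i t } { C' with buf := C'.buf.set i t' } :=
  ⟨h.reg, h.mem, h.pc, h.rsb, h.buf.set i ht⟩

theorem Sim.rollback (h : Sim C C') (i : ℕ) (n : V) :
    Sim { C with pc := n, buf := C.buf.restrict (· < i), rsb := C.rsb.restrict (· < i) }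
      { C' with pc := n, buf := C'.buf.restrict (· < i), rsb := C'.rsb.restrict (· < i) } :=
  ⟨h.reg, h.mem, rfl, by rw [h.rsb], h.buf.restrict _⟩

theorem Sim.rollback_set (h : Sim C C') (k i : ℕ) (n : V) {t t' : Transient V L R Op Cond}
    (ht : TransientSim t t') :
    Sim { C with
          pc := n
          buf := (C.buf.restrict (· < k)).set i t
          rsb := C.rsb.restrict (· < k) }
      { C' with
          pc := n
          buf := (C'.buf.restrict (· < k)).set i t'
          rsb := C'.rsb.restrict (· < k) } :=
  ⟨h.reg, h.mem, rfl, by rw [h.rsb], (h.buf.restrict _).set i ht⟩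

theorem Oldest.exists_sim {i : ℕ} {t : Transient V L R Op Cond} (h : Sim C C')
    (hi : Oldest C i t) : ∃ t', Oldest C' i t' ∧ TransientSim t t' := by
  obtain ⟨t', ht', hs⟩ := h.buf.exists_of_some hi.2
  exact ⟨t', ⟨h.minIdx_eq ▸ hi.1, ht'⟩, hs⟩

variable [DecidableEq V] [DecidableEq R]

/-- Fetches in low-equivalent configurations. -/
theorem Sim.step_fetch {d : Directive V} {o o' : List (Obs V L)} (h : Sim C C')
    (hs : Step M P C d o C₁) (hs' : Step M P C' d o' C₁') (hd : d.IsFetch) :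
    o = o' ∧ Sim C₁ C₁' := by
  have hpc := h.pc
  have hrsb := h.rsb
  have hfr := h.freshIdx_eq
  cases hs with
  | op_fetch hP =>
    rw [hpc] at hP
    cases hs' with
    | op_fetch hP' =>
      cases hP.symm.trans hP'
      exact ⟨rfl, h.reg, h.mem, rfl, h.rsb, hfr ▸ h.buf.set _ (.op ..)⟩
    | _ => simp_all
  | br_fetch b hP =>
    rw [hpc] at hP
    cases hs' with
    | br_fetch _ hP' =>
      cases hP.symm.trans hP'
      exact ⟨rfl, h.reg, h.mem, rfl, h.rsb, hfr ▸ h.buf.set _ (.br ..)⟩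
  | jmpi_fetch n' hP =>
    rw [hpc] at hP
    cases hs' with
    | jmpi_fetch _ hP' =>
      cases hP.symm.trans hP'
      exact ⟨rfl, h.reg, h.mem, rfl, h.rsb, hfr ▸ h.buf.set _ (.jmpi ..)⟩
    | _ => simp_all
  | load_fetch hP =>
    rw [hpc] at hP
    cases hs' with
    | load_fetch hP' =>
      cases hP.symm.trans hP'
      exact ⟨rfl, h.reg, h.mem, rfl, h.rsb, hfr ▸ hpc ▸ h.buf.set _ (.load ..)⟩
    | _ => simp_all
  | store_fetch hP =>
    rw [hpc] at hP
    cases hs' with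
    | store_fetch hP' =>
      cases hP.symm.trans hP'
      exact ⟨rfl, h.reg, h.mem, rfl, h.rsb, hfr ▸ h.buf.set _ (.store _ (.refl _))⟩
    | _ => simp_all
  | fence_fetch hP =>
    rw [hpc] at hP
    cases hs' with
    | fence_fetch hP' =>
      cases hP.symm.trans hP'
      exact ⟨rfl, h.reg, h.mem, rfl, h.rsb, hfr ▸ h.buf.set _ .fence⟩
    | _ => simp_all
  | call_fetch hP hi =>
    rw [hpc] at hP
    cases hs' with
    | call_fetch hP' hi' =>
      cases hP.symm.trans hP'
      rw [hfr, ← hi'] at hi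
      subst hi
      exact ⟨rfl, h.reg, h.mem, rfl, by rw [hrsb],
        ((h.buf.set _ .call).set _ (.op ..)).set _ (.store _ (.refl _))⟩
    | _ => simp_all
  | ret_fetch hP ht hi =>
    rw [hpc] at hP
    cases hs' with
    | ret_fetch hP' ht' hi' =>
      rw [hrsb, ht'] at ht
      cases ht
      rw [hfr, ← hi'] at hi
      subst hi
      rw [hpc]
      exact ⟨rfl, h.reg, h.mem, rfl, by rw [hrsb],
        (((h.buf.set _ .ret).set _ (.load ..)).set _ (.op ..)).set _ (.jmpi ..)⟩
    | _ => simp_all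
  | ret_fetch_empty n' hP ht hi =>
    rw [hpc] at hP
    cases hs' with
    | ret_fetch_empty _ hP' ht' hi' =>
      rw [hfr, ← hi'] at hi
      subst hi
      rw [hpc]
      exact ⟨rfl, h.reg, h.mem, rfl, by rw [hrsb],
        (((h.buf.set _ .ret).set _ (.load ..)).set _ (.op ..)).set _ (.jmpi ..)⟩
    | _ => simp_all
  | _ => exact hd.elim

/-- Retirement is possible in a low-equivalent configuration if it is possible. -/
theorem Sim.exists_retire {o : List (Obs V L)} (h : Sim C C') (hs : Step M P C .retire o C₁) :
    ∃ C₁', Step M P C' .retire o C₁' ∧ Sim C₁ C₁' := by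
  cases hs with
  | val_retire hi =>
    obtain ⟨t', hi', hT⟩ := hi.exists_sim h
    cases hT with
    | val _ _ hv =>
      exact ⟨_, .val_retire hi', LowEqCell.update h.reg hv _, h.mem, h.pc, h.rsb,
        h.buf.restrict _⟩
  | jump_retire hi =>
    obtain ⟨t', hi', hT⟩ := hi.exists_sim h
    cases hT
    exact ⟨_, .jump_retire hi', h.reg, h.mem, h.pc, h.rsb, h.buf.restrict _⟩
  | fence_retire hi =>
    obtain ⟨t', hi', hT⟩ := hi.exists_sim h
    cases hT
    exact ⟨_, .fence_retire hi', h.reg, h.mem, h.pc, h.rsb, h.buf.restrict _⟩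
  | store_retire hi =>
    obtain ⟨t', hi', hT⟩ := hi.exists_sim h
    cases hT with
    | store _ ho =>
      cases ho with
      | val hv =>
        exact ⟨_, .store_retire hi', h.reg, LowEqCell.update h.mem hv _, h.pc, h.rsb,
          h.buf.restrict _⟩
  | call_retire hi h1 h2 =>
    obtain ⟨t', hi', hT⟩ := hi.exists_sim h
    obtain ⟨t1', h1', hT1⟩ := h.buf.exists_of_some h1
    obtain ⟨t2', h2', hT2⟩ := h.buf.exists_of_some h2
    cases hT
    cases hT1 with
    | val _ _ hv1 =>
      cases hT2 with
      | store _ ho =>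
        cases ho with
        | val hv =>
          exact ⟨_, .call_retire hi' h1' h2', LowEqCell.update h.reg hv1 _,
            LowEqCell.update h.mem hv _, h.pc, h.rsb, h.buf.restrict _⟩
  | ret_retire hi h1 h2 h3 =>
    obtain ⟨t', hi', hT⟩ := hi.exists_sim h
    obtain ⟨t1', h1', hT1⟩ := h.buf.exists_of_some h1
    obtain ⟨t2', h2', hT2⟩ := h.buf.exists_of_some h2
    obtain ⟨t3', h3', hT3⟩ := h.buf.exists_of_some h3
    cases hT
    cases hT1
    cases hT3
    cases hT2 with
    | val _ _ hv =>
      exact ⟨_, .ret_retire hi' h1' h2' h3', LowEqCell.update h.reg hv _, h.mem, h.pc, h.rsb,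
        h.buf.restrict _⟩

/-- Retirement is deterministic. -/
theorem Step.retire_det {C₂ : Config V L R Op Cond} {o o' : List (Obs V L)}
    (hs : Step M P C .retire o C₁) (hs' : Step M P C .retire o' C₂) : o = o' ∧ C₁ = C₂ := by
  cases hs <;> cases hs' <;> simp_all [Oldest]

/-- The traces of two steps in low-equivalent configurations can be separated. -/
theorem Sim.step_execute {i : ℕ} {o o' O O' : List (Obs V L)} (h : Sim C C')
    (hs : Step M P C (.execute i) o C₁) (hs' : Step M P C' (.execute i) o' C₁')
    (ho : o ++ O = o' ++ O') : o = o' ∧ Sim C₁ C₁' := by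
  cases hs with
  | op_execute hi hf hrv hv =>
    obtain ⟨t', hi', hT⟩ := h.buf.exists_of_some hi
    cases hT
    cases hs' with
    | op_execute hi2 hf' hrv' hv' =>
      cases hi'.symm.trans hi2
      exact ⟨rfl, h.set _ (.val _ _ (lowEqVal_of_eval (h.forall₂_lowEqVal hrv hrv') hv hv'))⟩
    | _ => simp_all
  | br_execute_correct hi hf hrv hb hn =>
    obtain ⟨t', hi', hT⟩ := h.buf.exists_of_some hi
    cases hT
    cases hs' with
    | br_execute_correct hi2 hf' hrv' hb' hn' =>
      cases hi'.symm.trans hi2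
      rw [joinLabels_eq (h.forall₂_lowEqVal hrv hrv')]
      exact ⟨rfl, h.set _ (.jump _)⟩
    -- A leading `rollback` on one side only contradicts the equality of the traces.
    | br_execute_incorrect => simp at ho
    | _ => simp_all
  | br_execute_incorrect hi hf hrv hb hn hne =>
    obtain ⟨t', hi', hT⟩ := h.buf.exists_of_some hi
    cases hT
    cases hs' with
    | br_execute_correct => simp at ho
    | br_execute_incorrect hi2 hf' hrv' hb' hn' =>
      cases hi'.symm.trans hi2
      simp only [List.cons_append, List.nil_append, List.cons.injEq, Obs.jump.injEq,
        Prod.mk.injEq, true_and] at ho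
      obtain ⟨⟨rfl, -⟩, -⟩ := ho
      rw [joinLabels_eq (h.forall₂_lowEqVal hrv hrv')]
      exact ⟨rfl, h.rollback_set _ _ _ (.jump _)⟩
    | _ => simp_all
  | jmpi_execute_correct hi ha =>
    obtain ⟨t', hi', hT⟩ := h.buf.exists_of_some hi
    cases hT
    cases hs' with
    | jmpi_execute_correct hi2 ha' =>
      cases hi'.symm.trans hi2
      simp only [List.cons_append, List.nil_append, List.cons.injEq, Obs.jump.injEq,
        Prod.mk.injEq, true_and] at ho
      obtain ⟨rfl, -⟩ := ho
      exact ⟨rfl, h.set _ (.jump _)⟩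
    | jmpi_execute_incorrect => simp at ho
    | _ => simp_all
  | jmpi_execute_incorrect hi ha hne =>
    obtain ⟨t', hi', hT⟩ := h.buf.exists_of_some hi
    cases hT
    cases hs' with
    | jmpi_execute_correct => simp at ho
    | jmpi_execute_incorrect hi2 ha' =>
      simp only [List.cons_append, List.nil_append, List.cons.injEq, Obs.jump.injEq,
        Prod.mk.injEq, true_and] at ho
      obtain ⟨⟨rfl, rfl⟩, -⟩ := ho
      exact ⟨rfl, h.rollback_set _ _ _ (.jump _)⟩
    | _ => simp_all
  | load_execute_nodep hi ha hn hv =>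
    obtain ⟨t', hi', hT⟩ := h.buf.exists_of_some hi
    cases hT
    cases hs' with
    | load_execute_nodep hi2 ha' hn' hv' =>
      cases hi'.symm.trans hi2
      simp only [List.cons_append, List.nil_append, List.cons.injEq, Obs.read.injEq,
        Prod.mk.injEq] at ho
      -- The observed address is the same on both sides, so related memories are read at the same
      -- cell.
      obtain ⟨⟨rfl, rfl⟩, -⟩ := ho
      exact ⟨rfl, h.set _ (.val _ _ (lowEqCell_some.1 (hv ▸ hv' ▸ h.mem _)))⟩
    | load_execute_forward => simp at ho
    | _ => simp_all
  | load_execute_forward hi ha hji hj hlast =>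
    obtain ⟨t', hi', hT⟩ := h.buf.exists_of_some hi
    cases hT
    cases hs' with
    | load_execute_nodep => simp at ho
    | load_execute_forward hi2 ha' hji' hj' hlast' =>
      cases hi'.symm.trans hi2
      simp only [List.cons_append, List.nil_append, List.cons.injEq, Obs.fwd.injEq,
        Prod.mk.injEq] at ho
      obtain ⟨⟨rfl, rfl⟩, -⟩ := ho
      rename_i j _ _ j' _ _
      obtain ⟨u, hu, hU⟩ := h.buf.exists_of_some hj
      obtain ⟨u', hu', hU'⟩ := h.buf.symm.exists_of_some hj'
      -- Each side forwards from its latest store to the observed address. Related buffers have the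
      -- same resolved addresses, so a later store on one side would be one on the other side too.
      rcases lt_trichotomy j j' with hlt | rfl | hlt
      · exact absurd (hU'.storesTo ⟨_, _, rfl⟩) (hlast _ _ hlt hji' hu')
      · cases hu.symm.trans hj'
        cases hU with
        | store _ hU =>
          cases hU with
          | val hv => exact ⟨rfl, h.set _ (.val _ _ hv)⟩
      · exact absurd (hU.storesTo ⟨_, _, rfl⟩) (hlast' _ _ hlt hji hu)
    | _ => simp_all
  | load_execute_addr_ok hi ha hj hsa hb =>
    obtain ⟨t', hi', hT⟩ := h.buf.exists_of_some hi
    cases hT with | loadPartial _ _ _ _ hT =>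
    cases hs' with
    | load_execute_addr_ok hi2 ha' hj' hsa' hb' =>
      cases hi'.symm.trans hi2
      simp only [List.cons_append, List.nil_append, List.cons.injEq, Obs.fwd.injEq,
        Prod.mk.injEq] at ho
      obtain ⟨⟨rfl, rfl⟩, -⟩ := ho
      exact ⟨rfl, h.set _ (.val _ _ hT)⟩
    | load_execute_addr_hazard => simp at ho
    | load_execute_mem_match => simp at ho
    | load_execute_mem_hazard => simp at ho
    | _ => simp_all
  | load_execute_addr_hazard hi ha hz =>
    obtain ⟨t', hi', hT⟩ := h.buf.exists_of_some hi
    cases hT with | loadPartial _ _ _ _ hT =>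
    cases hs' with
    | load_execute_addr_ok => simp at ho
    | load_execute_addr_hazard hi2 =>
      cases hi'.symm.trans hi2
      simp only [List.cons_append, List.nil_append, List.cons.injEq, Obs.fwd.injEq,
        Prod.mk.injEq, true_and] at ho
      obtain ⟨⟨rfl, rfl⟩, -⟩ := ho
      exact ⟨rfl, h.rollback _ _⟩
    | load_execute_mem_match => simp at ho
    | load_execute_mem_hazard => simp at ho
    | _ => simp_all
  | load_execute_mem_match hi ha hj hn hv =>
    obtain ⟨t', hi', hT⟩ := h.buf.exists_of_some hi
    cases hT with | loadPartial _ _ _ _ hT =>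
    cases hs' with
    | load_execute_addr_ok => simp at ho
    | load_execute_addr_hazard => simp at ho
    | load_execute_mem_match hi2 =>
      cases hi'.symm.trans hi2
      simp only [List.cons_append, List.nil_append, List.cons.injEq, Obs.read.injEq,
        Prod.mk.injEq] at ho
      obtain ⟨⟨rfl, rfl⟩, -⟩ := ho
      exact ⟨rfl, h.set _ (.val _ _ hT)⟩
    | load_execute_mem_hazard => simp at ho
    | _ => simp_all
  | load_execute_mem_hazard hi ha hj hn hv hne =>
    obtain ⟨t', hi', hT⟩ := h.buf.exists_of_some hi
    cases hT with | loadPartial _ _ _ _ hT =>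
    cases hs' with
    | load_execute_addr_ok => simp at ho
    | load_execute_addr_hazard => simp at ho
    | load_execute_mem_match => simp at ho
    | load_execute_mem_hazard hi2 =>
      cases hi'.symm.trans hi2
      simp only [List.cons_append, List.nil_append, List.cons.injEq, Obs.read.injEq,
        Prod.mk.injEq, true_and] at ho
      obtain ⟨⟨rfl, rfl⟩, -⟩ := ho
      exact ⟨rfl, h.rollback _ _⟩
    | _ => simp_all

theorem Sim.step_executeAddr {i : ℕ} {o o' O O' : List (Obs V L)} (h : Sim C C')
    (hs : Step M P C (.executeAddr i) o C₁) (hs' : Step M P C' (.executeAddr i) o' C₁')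
    (ho : o ++ O = o' ++ O') : o = o' ∧ Sim C₁ C₁' := by
  cases hs with
  | store_execute_addr_ok hi ha hok =>
    obtain ⟨t', hi', hT⟩ := h.buf.exists_of_some hi
    cases hT with | store _ hT =>
    cases hs' with
    | store_execute_addr_ok hi2 =>
      cases hi'.symm.trans hi2
      simp only [List.cons_append, List.nil_append, List.cons.injEq, Obs.fwd.injEq,
        Prod.mk.injEq] at ho
      obtain ⟨⟨rfl, rfl⟩, -⟩ := ho
      exact ⟨rfl, h.set _ (.store _ hT)⟩
    | store_execute_addr_hazard => simp at ho
  | store_execute_addr_hazard hi ha hk hmin =>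
    obtain ⟨t', hi', hT⟩ := h.buf.exists_of_some hi
    cases hT with | store _ hT =>
    cases hs' with
    | store_execute_addr_ok => simp at ho
    | store_execute_addr_hazard hi2 ha' hk' hmin' =>
      cases hi'.symm.trans hi2
      simp only [List.cons_append, List.nil_append, List.cons.injEq, Obs.fwd.injEq,
        Prod.mk.injEq, true_and] at ho
      obtain ⟨⟨rfl, rfl⟩, -⟩ := ho
      obtain ⟨rfl, rfl⟩ := h.buf.hazard_unique hk hmin hk' hmin'
      exact ⟨rfl, h.rollback_set _ _ _ (.store _ hT)⟩

/-- Two steps under the same directive in low-equivalent configurations, with traces that agree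
together with the traces that follow, yield equal observations and low-equivalent
configurations. -/
theorem Sim.step {d : Directive V} {o o' O O' : List (Obs V L)} (h : Sim C C')
    (hs : Step M P C d o C₁) (hs' : Step M P C' d o' C₁') (ho : o ++ O = o' ++ O') :
    o = o' ∧ Sim C₁ C₁' := by
  cases d with
  | fetch => exact h.step_fetch hs hs' trivial
  | fetchBranch b => exact h.step_fetch hs hs' trivial
  | fetchTarget n => exact h.step_fetch hs hs' trivial
  | execute i => exact h.step_execute hs hs' ho
  | executeAddr i => exact h.step_executeAddr hs hs' ho
  | executeValue i =>
    cases hs with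
    | store_execute_value hi hf hv =>
      obtain ⟨t', hi', hT⟩ := h.buf.exists_of_some hi
      cases hT with | store _ hT =>
      cases hs' with
      | store_execute_value hi2 hf' hv' =>
        cases hi'.symm.trans hi2
        exact ⟨rfl, h.set _ (.store _ (.val (h.lowEqVal hT hv hv')))⟩
  | executeFwd i j =>
    cases hs with
    | load_execute_guess hi hf hji hj =>
      obtain ⟨t', hi', hT⟩ := h.buf.exists_of_some hi
      obtain ⟨u, hu, hU⟩ := h.buf.exists_of_some hj
      cases hT
      cases hU with | store _ hU =>
      cases hU with | val hU =>
      cases hs' with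
      | load_execute_guess hi2 hf' hji' hj' =>
        cases hi'.symm.trans hi2
        cases hu.symm.trans hj'
        exact ⟨rfl, h.set _ (.loadPartial _ _ _ _ hU)⟩
  | retire =>
    obtain ⟨C₂, hs2, hS⟩ := h.exists_retire hs
    obtain ⟨rfl, rfl⟩ := hs2.retire_det hs'
    exact ⟨rfl, hS⟩

end Lockstep

/-! ### From equal speculative traces to equal program-order leakage. -/

section Chain

variable {V L R Op Cond : Type*} [SemilatticeSup L] [OrderBot L]
  {M : Machine V R Op Cond} {P : Program V L R Op Cond}

theorem numRetired_cons_retire (D : List (Directive V)) :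
    numRetired (.retire :: D) = numRetired D + 1 := by
  exact List.countP_cons_of_pos rfl

theorem numRetired_cons_of_ne {d : Directive V} (hd : d ≠ .retire) (D : List (Directive V)) :
    numRetired (d :: D) = numRetired D := by
  cases d <;> simp_all [numRetired, Directive.isRetire]

theorem correct_of_isInitial {C : Config V L R Op Cond} (h : C.buf.dom = ∅) :
    Correct M P C C.pc :=
  ⟨1, le_rfl, fun k _ => IdxMap.dom_eq_empty_iff.1 h k,
    .done (fun k _ => IdxMap.dom_eq_empty_iff.1 h k) rfl⟩

variable [DecidableEq V] [DecidableEq R]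

/-- `k` instructions executed in program order from `p`, in two register files and memories, with
the same addresses and jump targets. -/
inductive Chain (M : Machine V R Op Cond) (P : Program V L R Op Cond) :
    ℕ → (R → Option (LVal V L)) → (V → Option (LVal V L)) → (R → Option (LVal V L)) →
      (V → Option (LVal V L)) → V → Prop
  | zero (reg mem reg' mem' p) : Chain M P 0 reg mem reg' mem' p
  | succ {k reg mem reg' mem' reg₁ mem₁ reg₁' mem₁' l p n}
      (h : ArchStep M P reg mem p l reg₁ mem₁ n) (h' : ArchStep M P reg' mem' p l reg₁' mem₁' n)
      (rest : Chain M P k reg₁ mem₁ reg₁' mem₁' n) : Chain M P (k + 1) reg mem reg' mem' p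

theorem Chain.symm {k : ℕ} {reg reg' : R → Option (LVal V L)} {mem mem' : V → Option (LVal V L)}
    {p : V} (h : Chain M P k reg mem reg' mem' p) : Chain M P k reg' mem' reg mem p := by
  induction h with
  | zero => exact .zero ..
  | succ h h' _ ih => exact .succ h' h ih

/-- Two low-equivalent runs with equal traces retire the same instructions, with the same addresses
and jump targets, as an execution in program order. -/
theorem chain_of_run {C C₁ : Config V L R Op Cond} {D : List (Directive V)} {O : List (Obs V L)}
    (h : Run M P C D O C₁) {C' C₁' : Config V L R Op Cond} (h' : Run M P C' D O C₁')
    (hs : Sim C C') {p : V} (hc : Correct M P C p) (hc' : Correct M P C' p) :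
    Chain M P (numRetired D) C.reg C.mem C'.reg C'.mem p := by
  induction h generalizing C' p with
  | nil => exact .zero ..
  | @cons C C₂ C₁ d D o O hstep hrun ih =>
    generalize hO : o ++ O = O₂ at h'
    cases h' with
    | @cons _ C₂' _ _ _ o' O' hstep' hrun' =>
      obtain ⟨rfl, hs'⟩ := hs.step hstep hstep' hO
      obtain rfl := List.append_cancel_left hO
      by_cases hd : d = .retire
      · subst hd
        obtain ⟨i, srcs, n, hf, hlo, hi, ha, hc₁⟩ := hc.retire hstep
        obtain ⟨i', srcs', n', hf', hlo', hi', ha', hc₁'⟩ := hc'.retire hstep'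
        -- Related buffers have the same domain, hence the same oldest index.
        obtain rfl : i = i' := by
          rw [← IdxMap.minIdx_eq hlo hi, ← IdxMap.minIdx_eq hlo' hi', hs.minIdx_eq]
        -- Both groups stem from the instruction at `p`, so they have the same length, and related
        -- buffers reveal the same values on it.
        rw [hs.buf.bufLeak_eq, ← hf.length_eq hf'] at ha'
        obtain rfl := ha.next_eq ha'
        rw [numRetired_cons_retire]
        exact .succ ha ha' (ih hrun' hs' hc₁ hc₁')
      · obtain ⟨h1, h2⟩ := hstep.reg_mem_eq hd
        obtain ⟨h1', h2'⟩ := hstep'.reg_mem_eq hd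
        rw [numRetired_cons_of_ne hd, ← h1, ← h2, ← h1', ← h2']
        exact ih hrun' hs' (hc.step hstep hd) (hc'.step hstep' hd)

end Chain

/-! ### Program-order steps carried out by the machine. -/

section SeqExistence

variable {V L R Op Cond : Type*} [DecidableEq V] [DecidableEq R] [SemilatticeSup L] [OrderBot L]
  {M : Machine V R Op Cond} {P : Program V L R Op Cond} {C : Config V L R Op Cond}

theorem SeqRun.append {C C₁ C₂ : Config V L R Op Cond} {D D' : List (Directive V)}
    {O O' : List (Obs V L)} (h : SeqRun M P C D O C₁) (h' : SeqRun M P C₁ D' O' C₂) :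
    SeqRun M P C (D ++ D') (O ++ O') C₂ := by
  induction h with
  | nil => exact h'
  | cons hf hs _ ih =>
    rw [List.append_assoc]
    exact .cons hf hs (ih h')

/-- A step that is not a fetch, followed by a sequential run. -/
theorem SeqRun.cons_of_not_isFetch {C C₁ C₂ : Config V L R Op Cond} {d : Directive V}
    {D : List (Directive V)} {o O : List (Obs V L)} (hs : Step M P C d o C₁) (hd : ¬ d.IsFetch)
    (h : SeqRun M P C₁ D O C₂) : SeqRun M P C (d :: D) (o ++ O) C₂ :=
  .cons (absurd · hd) hs h

/-- Sequential execution of a fetched `ret`. -/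
theorem exists_seqRun_ret {w u : LVal V L} {a v n' q : V}
    (h1 : C.buf.get 1 = some .ret)
    (h2 : C.buf.get 2 = some (.load .ret [.reg (.arch M.rsp)] q))
    (h3 : C.buf.get 3 = some (.op (.arch M.rsp) M.pred [.reg (.arch M.rsp)]))
    (h4 : C.buf.get 4 = some (.jmpi [.reg .ret] C.pc))
    (hn : ∀ k, k < 1 ∨ 4 < k → C.buf.get k = none)
    (hsp : C.reg M.rsp = some w) (ha : M.addr [w.1] = some a) (hu : C.mem a = some u)
    (hv : M.evalOp M.pred [w.1] = some v) (hn' : M.addr [u.1] = some n') :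
    ∃ D O C₁, SeqRun M P C D O C₁ ∧ numRetired D = 1 ∧ C₁.buf.dom = ∅ ∧
      C₁.reg = Function.update C.reg M.rsp (some (v, joinLabels [w])) ∧ C₁.mem = C.mem ∧
      C₁.pc = n' := by
  have hk : ∀ k t, C.buf.get k = some t → k = 1 ∧ t = .ret ∨ k = 2 ∨ k = 3 ∨ k = 4 := by
    intro k t hk
    by_contra hne
    have : k ≠ 1 := by rintro rfl; simp_all
    rw [hn k (by omega)] at hk
    cases hk
  have s2 : Step M P C (.execute 2) _ _ := .load_execute_nodep h2
    ⟨fun k t hk2 ht => by rcases hk k t ht with h | h | h | h <;> simp_all, _,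
      resolvesList_singleton.2 ⟨_, rfl, .file (fun k t hk2 ht => by
        rcases hk k t ht with h | h | h | h <;> simp_all [Transient.dest]) hsp⟩, ha, rfl⟩
    (fun k t hk2 ht => by
      rcases hk k t ht with h | h | h | h <;> simp_all [Transient.StoresTo]) hu
  generalize hC₂ : Config.mk C.reg C.mem C.pc _ C.rsb = C₂ at s2
  have g : ∀ k, C₂.buf.get k =
      if k = 2 then some (.val .ret u (some ⟨⊥, a, q⟩)) else C.buf.get k := by
    intro k; rw [← hC₂, IdxMap.get_set]
  obtain ⟨e1, e2, e3⟩ : C₂.reg = C.reg ∧ C₂.mem = C.mem ∧ C₂.pc = C.pc := by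
    simp [← hC₂]
  have s3 : Step M P C₂ (.execute 3) _ _ := .op_execute (by simp [g]; exact h3)
    (fun k t hk2 ht => by
      simp only [g] at ht; split_ifs at ht
      · cases ht; simp
      · rcases hk k t ht with h | h | h | h <;> simp_all)
    (resolvesList_singleton.2 ⟨w, rfl, .file (fun k t hk2 ht => by
      simp only [g] at ht; split_ifs at ht
      · cases ht; simp [Transient.dest]
      · rcases hk k t ht with h | h | h | h <;> simp_all [Transient.dest]) (e1 ▸ hsp)⟩) hv
  generalize hC₃ : Config.mk C₂.reg C₂.mem C₂.pc _ C₂.rsb = C₃ at s3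
  have g3 : ∀ k, C₃.buf.get k =
      if k = 3 then some (.val (.arch M.rsp) (v, joinLabels [w]) none) else C₂.buf.get k := by
    intro k; rw [← hC₃, IdxMap.get_set]
  obtain ⟨f1, f2, f3⟩ : C₃.reg = C.reg ∧ C₃.mem = C.mem ∧ C₃.pc = C.pc := by
    simp [← hC₃, e1, e2, e3]
  have ha4 : ResolvesAddr M C₃ 4 [.reg .ret] (n', joinLabels [u]) := by
    refine ⟨fun k t hk2 ht => ?_, [u], resolvesList_singleton.2 ⟨u, rfl, .pending 2
      (.val .ret u (some ⟨⊥, a, q⟩)) (by omega) (by simp [g3, g]) rfl (fun k t h1 h2 ht => ?_) rfl⟩,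
      hn', rfl⟩
    · simp only [g3, g] at ht; split_ifs at ht
      · cases ht; simp
      · cases ht; simp
      · rcases hk k t ht with h | h | h | h <;> simp_all
    · obtain rfl : k = 3 := by omega
      simp [g3] at ht
      subst ht
      simp [Transient.dest]
  -- The predicted return point may be right or wrong. The jump is the last entry, so a rollback
  -- removes no other entry and both rules leave the same buffer.
  obtain ⟨o, C₄, s4, g4, f4⟩ : ∃ o C₄, Step M P C₃ (.execute 4) o C₄ ∧
      (∀ k, C₄.buf.get k = if k = 4 then some (.jump n') else C₃.buf.get k) ∧
      C₄.reg = C.reg ∧ C₄.mem = C.mem ∧ C₄.pc = n' := by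
    have h4' : C₃.buf.get 4 = some (.jmpi [.reg .ret] C.pc) := by simp [g3, g, h4]
    by_cases hne : n' = C.pc
    · subst hne
      exact ⟨_, _, .jmpi_execute_correct h4' ha4, fun k => by simp, f1, f2, f3⟩
    · refine ⟨_, _, .jmpi_execute_incorrect h4' ha4 hne, fun k => ?_, f1, f2, rfl⟩
      simp only [IdxMap.get_set, IdxMap.get_restrict]
      split_ifs with h5 h6
      · rfl
      · rfl
      · rw [g3, g, if_neg (by omega), if_neg (by omega), hn k (by omega)]
  refine ⟨_, _, _, .cons_of_not_isFetch s2 id (.cons_of_not_isFetch s3 id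
    (.cons_of_not_isFetch s4 id (.cons_of_not_isFetch (.ret_retire (oldest_one ?_ ?_) (v₁ := u)
      (tag₁ := some ⟨⊥, a, q⟩) (v₂ := (v, joinLabels [w])) (tag₂ := none) (n' := n') ?_ ?_ ?_) id
        (.nil _)))), rfl, ?_, ?_, f4.2.1, f4.2.2⟩
  · simp [g4, g3, g, hn]
  · simp [g4, g3, g, h1]
  · simp [g4, g3, g]
  · simp [g4, g3]
  · simp [g4]
  · rw [IdxMap.dom_eq_empty_iff]
    intro k
    simp only [IdxMap.get_restrict, g4, g3, g]
    split_ifs <;> first | rfl | omega | exact hn k (by omega)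
  · simp [f4.1]

/-- Sequential execution of one instruction. -/
theorem ArchStep.exists_seqRun {l : List V} {reg₁ : R → Option (LVal V L)}
    {mem₁ : V → Option (LVal V L)} {n : V} (h : ArchStep M P C.reg C.mem C.pc l reg₁ mem₁ n)
    (hC : C.buf.dom = ∅) : ∃ D O C₁, SeqRun M P C D O C₁ ∧ numRetired D = 1 ∧ C₁.buf.dom = ∅ ∧
      C₁.reg = reg₁ ∧ C₁.mem = mem₁ ∧ C₁.pc = n := by
  have hn := IdxMap.dom_eq_empty_iff.1 hC
  have hfr : freshIdx C = 1 := by rw [freshIdx, IdxMap.maxIdx_of_dom_eq_empty hC]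
  have h0 : ∀ (t : Transient V L R Op Cond), ∀ k < 1, (C.buf.set 1 t).get k = none := by
    intro t k hk; simp [hn, hk.ne]
  have hnf : ∀ t : Transient V L R Op Cond, NoFence (C.buf.set 1 t) 1 := by
    intro t k u hk hu; simp [hn, hk.ne] at hu
  cases h with
  | fence hP =>
    have s1 := Step.fence_fetch (M := M) hP
    rw [hfr] at s1
    refine ⟨_, _, _, .cons (fun _ => hC) s1 (.cons_of_not_isFetch
      (.fence_retire (oldest_one (h0 _ 0 one_pos) rfl)) id (.nil _)), rfl, ?_, rfl, rfl, rfl⟩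
    simp [IdxMap.dom_eq_empty_iff, hn]
  | op hP hrv hv =>
    have s1 := Step.op_fetch (M := M) hP
    rw [hfr] at s1
    refine ⟨_, _, _, .cons (fun _ => hC) s1 (.cons_of_not_isFetch
      (.op_execute (i := 1) rfl (hnf _) ((resolvesList_iff_archResolves (h0 _)).2 hrv) hv) id
      (.cons_of_not_isFetch (.val_retire (oldest_one ?_ rfl)) id (.nil _))), rfl, ?_, rfl, rfl, rfl⟩
    · simp [hn]
    · simp +contextual [IdxMap.dom_eq_empty_iff, hn]
  | @br _ _ _ _ _ b _ hP hrv hb hb' =>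
    -- The guess is the actual outcome of the condition, so no rollback occurs.
    have s1 := Step.br_fetch (M := M) b hP
    rw [hfr] at s1
    refine ⟨_, _, _, .cons (fun _ => hC) s1 (.cons_of_not_isFetch
      (.br_execute_correct (i := 1) rfl (hnf _) ((resolvesList_iff_archResolves (h0 _)).2 hrv) hb
        rfl) id
      (.cons_of_not_isFetch (.jump_retire (oldest_one ?_ rfl)) id (.nil _))), rfl, ?_, rfl, rfl, hb'⟩
    · simp [hn]
    · simp +contextual [IdxMap.dom_eq_empty_iff, hn]
  | jmpi hP hrv ha =>
    have s1 := Step.jmpi_fetch (M := M) n hP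
    rw [hfr] at s1
    refine ⟨_, _, _, .cons (fun _ => hC) s1 (.cons_of_not_isFetch
      (.jmpi_execute_correct (i := 1) rfl
        ⟨hnf _, _, (resolvesList_iff_archResolves (h0 _)).2 hrv, ha, rfl⟩) id
      (.cons_of_not_isFetch (.jump_retire (oldest_one ?_ rfl)) id (.nil _))), rfl, ?_, rfl, rfl, rfl⟩
    · simp [hn]
    · simp +contextual [IdxMap.dom_eq_empty_iff, hn]
  | load hP hrv ha hv =>
    have s1 := Step.load_fetch (M := M) hP
    rw [hfr] at s1
    refine ⟨_, _, _, .cons (fun _ => hC) s1 (.cons_of_not_isFetch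
      (.load_execute_nodep (i := 1) rfl
        ⟨hnf _, _, (resolvesList_iff_archResolves (h0 _)).2 hrv, ha, rfl⟩ ?_ hv) id
      (.cons_of_not_isFetch (.val_retire (oldest_one ?_ rfl)) id (.nil _))), rfl, ?_, rfl, rfl, rfl⟩
    · intro k t hk ht
      simp [hn, hk.ne] at ht
    · simp [hn]
    · simp +contextual [IdxMap.dom_eq_empty_iff, hn]
  | @store rv rvs _ _ _ _ hP hval hrv ha =>
    have s1 := Step.store_fetch (M := M) hP
    rw [hfr] at s1
    have hval' := (resolvesList_iff_archResolves (rvs := [rv])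
      (h0 (.store rv.lift (.unresolved (rvs.map Operand.lift))))).2 hval
    obtain ⟨_, e, hval'⟩ := resolvesList_singleton.1 hval'
    cases e
    have h0' : ∀ (t t' : Transient V L R Op Cond), ∀ k < 1,
        ((C.buf.set 1 t).set 1 t').get k = none := by
      intro t t' k hk; simp [hn, hk.ne]
    refine ⟨_, _, _, .cons (fun _ => hC) s1 (.cons_of_not_isFetch
      (.store_execute_value (i := 1) rfl (hnf _) hval') id (.cons_of_not_isFetch
      (.store_execute_addr_ok (i := 1) rfl
        ⟨?_, _, (resolvesList_iff_archResolves (h0' _ _)).2 hrv, ha, rfl⟩ ?_) id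
      (.cons_of_not_isFetch (.store_retire (oldest_one ?_ rfl)) id (.nil _)))), rfl, ?_, rfl, rfl,
      rfl⟩
    · intro k t hk ht
      simp [hn, hk.ne] at ht
    · rintro k m ⟨hk, r, v, tag, h, -⟩
      simp [hn, hk.ne'] at h
    · simp [hn]
    · simp +contextual [IdxMap.dom_eq_empty_iff, hn]
  | call hP hsp hv ha =>
    have s1 := Step.call_fetch (M := M) hP hfr.symm
    refine ⟨_, _, _, .cons (fun _ => hC) s1 (.cons_of_not_isFetch
      (.op_execute (i := 2) rfl ?_
        (resolvesList_singleton.2 ⟨_, rfl, .file ?_ hsp⟩) hv) id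
      (.cons_of_not_isFetch
      (.store_execute_addr_ok (i := 3) rfl
        ⟨?_, _, resolvesList_singleton.2 ⟨_, rfl, .pending 2 _ (by omega) rfl rfl
          (fun k _ _ _ => by omega) rfl⟩, ha, rfl⟩ ?_) id
      (.cons_of_not_isFetch (.call_retire (oldest_one ?_ rfl) rfl rfl) id (.nil _)))), rfl, ?_, rfl,
      rfl, rfl⟩
    · intro k t hk ht
      simp [hn] at ht
      grind
    · intro k t hk ht
      simp [hn] at ht
      grind [Transient.dest]
    · intro k t hk ht
      simp [hn] at ht
      grind
    · rintro k m ⟨hk, r, v, tag, h, -⟩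
      simp [hn] at h
      grind
    · simp [hn]
    · simp +contextual [IdxMap.dom_eq_empty_iff, hn]
      grind
  | ret hP hsp ha hu hv hn' =>
    obtain ⟨d, n₀, hd, s1⟩ : ∃ d n₀, d ≠ .retire ∧ Step M P C d [] { C with
        pc := n₀
        buf := (((C.buf.set 1 .ret).set 2 (.load .ret [.reg (.arch M.rsp)] C.pc)).set 3
          (.op (.arch M.rsp) M.pred [.reg (.arch M.rsp)])).set 4 (.jmpi [.reg .ret] n₀)
        rsb := C.rsb.set 1 .pop } := by
      -- A nonempty return stack dictates the prediction, right or wrong; only an empty one leaves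
      -- the guess free.
      cases ht : rsbTop C.rsb with
      | none => exact ⟨.fetchTarget n, n, by simp, .ret_fetch_empty n hP ht hfr.symm⟩
      | some n₀ => exact ⟨.fetch, n₀, by simp, .ret_fetch hP ht hfr.symm⟩
    obtain ⟨D, O, C₁, hrun, hD, h⟩ := exists_seqRun_ret (P := P) (C := { C with
        pc := n₀
        buf := (((C.buf.set 1 .ret).set 2 (.load .ret [.reg (.arch M.rsp)] C.pc)).set 3
          (.op (.arch M.rsp) M.pred [.reg (.arch M.rsp)])).set 4 (.jmpi [.reg .ret] n₀)
        rsb := C.rsb.set 1 .pop }) rfl rfl rfl rfl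
      (fun k hk => by simp only [IdxMap.get_set, hn]; grind) hsp ha hu hv hn'
    refine ⟨_, _, C₁, .cons (fun _ => hC) s1 hrun, ?_, h⟩
    rw [numRetired_cons_of_ne hd, hD]

end SeqExistence

/-! ### The buffer during a sequential execution. -/

section SingleGroup

variable {V L R Op Cond : Type*} [SemilatticeSup L] [OrderBot L]
  {M : Machine V R Op Cond} {P : Program V L R Op Cond} {C C₁ : Config V L R Op Cond}

theorem EntryOK.dest_eq {buf : IdxMap (Transient V L R Op Cond)} {reg mem : _ → Option (LVal V L)}
    {k : ℕ} {s t : Transient V L R Op Cond} (h : EntryOK M buf reg mem k s t) :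
    t.dest = s.dest := by
  cases h <;> rfl

/-- No instruction has both a load and a store among its entries: a `call` only stores, a `ret` only
loads. So in a sequential execution nothing is forwarded or predicted, and no rollback goes to a
load. -/
theorem Fetched.not_store_of_load {p n q : V} {srcs : List (Transient V L R Op Cond)}
    (h : Fetched M P p srcs n) {m m' : ℕ} {r : TReg R} {rvs : List (Operand (TReg R) V L)}
    (hm : srcs[m]? = some (.load r rvs q)) (rv : Operand (TReg R) V L) (sa : StoreAddr V L R) :
    srcs[m']? ≠ some (.store rv sa) := by
  intro hm'
  cases h <;> rcases m with _ | _ | _ | _ | m <;> simp at hm <;>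
    rcases m' with _ | _ | _ | _ | m' <;> simp at hm'

/-- The buffer of `C` holds exactly the entries `srcs` of one instruction, in some correct stage of
their execution, without value predictions. -/
structure InGroup (M : Machine V R Op Cond) (P : Program V L R Op Cond)
    (C : Config V L R Op Cond) (p : V) (srcs : List (Transient V L R Op Cond)) (n : V) :
    Prop where
  fetched : Fetched M P p srcs n
  entry : ∀ k s, srcs[k]? = some s → Entry M C (1 + k) s
  get : ∀ k, k < 1 ∨ 1 + srcs.length ≤ k → C.buf.get k = none
  pc : C.pc = n
  noPartial : ∀ k r rvs v j q, C.buf.get k ≠ some (.loadPartial r rvs v j q)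

variable {p n : V} {srcs : List (Transient V L R Op Cond)}

theorem InGroup.exists_src (h : InGroup M P C p srcs n) {i : ℕ} {t : Transient V L R Op Cond}
    (hi : C.buf.get i = some t) :
    ∃ m s, i = 1 + m ∧ srcs[m]? = some s ∧ EntryOK M C.buf C.reg C.mem i s t := by
  have h1 : ¬ (i < 1 ∨ 1 + srcs.length ≤ i) := fun hn => by simp [h.get i hn] at hi
  push Not at h1
  obtain ⟨m, rfl⟩ := Nat.exists_eq_add_of_le h1.1
  have hm : srcs[m]? = some srcs[m] := List.getElem?_eq_getElem _
  exact ⟨m, _, rfl, hm, (h.entry m _ hm).entryOK hi⟩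

theorem InGroup.dom_ne_empty (h : InGroup M P C p srcs n) : C.buf.dom ≠ ∅ := by
  intro hd
  exact (h.entry 0 _ (List.getElem?_eq_getElem h.fetched.length_pos)).get_ne_none
    (IdxMap.dom_eq_empty_iff.1 hd _)

/-- All stages of an entry have the same destination, so it is enough to inspect the entries as
fetched. -/
theorem InGroup.resolves_arch (h : InGroup M P C p srcs n) {i : ℕ} {r : R} {v : LVal V L}
    (hd : ∀ m s, 1 + m < i → srcs[m]? = some s → s.dest ≠ some (.arch r))
    (hv : Resolves C.buf C.reg i (.reg (.arch r)) v) : C.reg r = some v := by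
  refine (resolves_arch_iff fun k t hk ht => ?_).1 hv
  obtain ⟨m, s, rfl, hm, hok⟩ := h.exists_src ht
  rw [hok.dest_eq]
  exact hd m s hk hm

theorem InGroup.not_store_of_load (h : InGroup M P C p srcs n) {i k : ℕ}
    (hk : ∀ s, Entry M C k s → ∃ r rvs q, s = .load r rvs q)
    (hk' : C.buf.get k ≠ none) (rv : Operand (TReg R) V L) (sa : StoreAddr V L R) :
    C.buf.get i ≠ some (.store rv sa) := by
  intro hi
  obtain ⟨t, ht⟩ := Option.ne_none_iff_exists'.1 hk'
  obtain ⟨m, s, rfl, hm, -⟩ := h.exists_src ht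
  obtain ⟨r, rvs, q, rfl⟩ := hk _ (h.entry m s hm)
  obtain ⟨m', s', rfl, hm', hok'⟩ := h.exists_src hi
  cases hok' <;> exact h.fetched.not_store_of_load hm _ _ hm'

variable [DecidableEq V] [DecidableEq R]

/-- A prediction needs a store and a load in the same group. -/
theorem InGroup.eq_executeFwd_elim (h : InGroup M P C p srcs n) {i j : ℕ} {o : List (Obs V L)}
    (hs : Step M P C (.executeFwd i j) o C₁) : False := by
  cases hs with
  | load_execute_guess hi hf hji hj =>
    obtain ⟨m, s, rfl, hm, hok⟩ := h.exists_src hi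
    obtain ⟨m', s', rfl, hm', hok'⟩ := h.exists_src hj
    cases hok
    cases hok' <;> exact h.fetched.not_store_of_load hm _ _ hm'

theorem Step.noPartial {d : Directive V} {o : List (Obs V L)} (h : Step M P C d o C₁)
    (hd : ∀ i j, d ≠ .executeFwd i j)
    (hn : ∀ k r rvs v j q, C.buf.get k ≠ some (.loadPartial r rvs v j q)) (k r rvs v j q) :
    C₁.buf.get k ≠ some (.loadPartial r rvs v j q) := by
  have hn' := hn k r rvs v j q
  cases h <;> simp only [IdxMap.get_set, IdxMap.get_restrict, ne_eq] at * <;> grind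

/-- Execute steps stay in the group. -/
theorem InGroup.step {d : Directive V} {o : List (Obs V L)} (h : InGroup M P C p srcs n)
    (hs : Step M P C d o C₁) (hf : ¬ d.IsFetch) (hd : d ≠ .retire) :
    ∃ srcs' n', InGroup M P C₁ p srcs' n' := by
  have hfwd : ∀ i j, d ≠ .executeFwd i j := by
    rintro i j rfl
    exact h.eq_executeFwd_elim hs
  have hnp := hs.noPartial hfwd h.noPartial
  rcases hs.of_execute hf hd with hr | ⟨i, t, t', hr⟩ | ⟨k, hr⟩
  · exact ⟨srcs, n, h.fetched, fun k s hk => hr.entry _ _ (h.entry k s hk),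
      fun k hk => hr.get k (h.get k hk), hr.pc.trans h.pc, hnp⟩
  · obtain ⟨m, s, rfl, hm, -⟩ := h.exists_src hr.get_self
    obtain rfl := hr.src s (h.entry m s hm)
    obtain ⟨hl, hf'⟩ := hr.retargets _ _ _ _ h.fetched hm
    refine ⟨_, _, hf', fun k s' hk => ?_, fun k hk => hr.get k (h.get k ?_), rfl, hnp⟩
    · by_cases hkm : k = m
      · subst hkm
        rw [List.getElem?_set_self (by omega)] at hk
        cases hk
        exact hr.entry_self (h.entry _ _ hm)
      · have hlt := (List.getElem?_eq_some_iff.1 hk).1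
        rw [List.length_set] at hlt
        rw [List.getElem?_set_ne (Ne.symm hkm)] at hk
        exact hr.entry _ _ (by omega) (h.entry k s' hk)
    · rwa [List.length_set] at hk
  -- A rollback to a load is caused by a predicted value, which the group does not contain, or by a
  -- store, which does not occur beside a load.
  · rcases hr.cause with ⟨r, rvs, v, j, q, hk⟩ | ⟨i, rv, sa, hi⟩
    · exact absurd hk (h.noPartial _ _ _ _ _ _)
    · refine absurd hi (h.not_store_of_load (k := k) (fun s hs => ?_) hr.get_self rv sa)
      obtain ⟨r, rvs, hs⟩ := hr.src s hs
      exact ⟨r, rvs, _, hs⟩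

theorem InGroup.of_fetch {d : Directive V} {o : List (Obs V L)} (hC : C.buf.dom = ∅)
    (hs : Step M P C d o C₁) (hd : d.IsFetch) : ∃ srcs n, InGroup M P C₁ C.pc srcs n := by
  obtain ⟨srcs, hf, hreg, hmem, -, hb⟩ := hs.of_isFetch hd
  have hn := IdxMap.dom_eq_empty_iff.1 hC
  have hfr : freshIdx C = 1 := by rw [freshIdx, IdxMap.maxIdx_of_dom_eq_empty hC]
  rw [hfr] at hb
  refine ⟨srcs, _, hf, fun k s hk => hf.entry (fun m s hm => ?_) hk, fun k hk => ?_, rfl,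
    hs.noPartial (by rintro i j rfl; exact hd) (by simp [hn])⟩
  · rw [hb, if_neg (by omega), Nat.add_sub_cancel_left, hm]
  · rw [hb]
    split_ifs
    · exact hn k
    · exact List.getElem?_eq_none (by omega)

/-- A group is one whole instruction, so its retirement empties the buffer and is one step in
program order. -/
theorem InGroup.retire {o : List (Obs V L)} (h : InGroup M P C p srcs n)
    (hs : Step M P C .retire o C₁) :
    (∃ l, ArchStep M P C.reg C.mem p l C₁.reg C₁.mem n) ∧ C₁.buf.dom = ∅ ∧ C₁.pc = n := by
  obtain ⟨ha, hr⟩ := hs.retire_group (fun j hj => h.get j (.inl hj)) h.fetched h.entry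
  refine ⟨⟨_, ha⟩, IdxMap.dom_eq_empty_iff.2 fun k => ?_, hr.pc.trans h.pc⟩
  rw [hr.get]
  split_ifs
  · rfl
  · exact h.get k (by omega)

/-! ### The values that the entries of a group compute -/

section Values

variable {l : List V} {reg₁ : R → Option (LVal V L)} {mem₁ : V → Option (LVal V L)} {n₁ : V} {i : ℕ}
  {rvs : List (Operand (TReg R) V L)} {vs : List (LVal V L)}

/-- No earlier entry of the group assigns a register that the operation reads. So its operands come
from the register file and are those of the program-order step, which has evaluated them. -/
theorem InGroup.evalOp (h : InGroup M P C p srcs n) (ha : ArchStep M P C.reg C.mem p l reg₁ mem₁ n₁)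
    {r : TReg R} {o : Op} (hi : C.buf.get i = some (.op r o rvs))
    (hrv : ResolvesList C.buf C.reg i rvs vs) : ∃ v, M.evalOp o (vs.map Prod.fst) = some v := by
  obtain ⟨m, s, rfl, hm, hok⟩ := h.exists_src hi
  cases hok
  have hrsp := fun v => h.resolves_arch (i := 1 + m) (r := M.rsp) (v := v)
  have hf := h.fetched
  cases hf with
  | op hP =>
    rcases m with _ | m <;> simp at hm
    obtain ⟨rfl, rfl, rfl⟩ := hm
    cases ha with
    | op hP' hrv' hv =>
      cases hP.symm.trans hP'
      cases ((resolvesList_iff_archResolves fun j hj => h.get j (.inl hj)).1 hrv).det hrv'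
      exact ⟨_, hv⟩
    | _ => simp_all
  | call hP =>
    rcases m with _ | _ | _ | m <;> simp at hm
    obtain ⟨rfl, rfl, rfl⟩ := hm
    obtain ⟨w, rfl, hw⟩ := resolvesList_singleton.1 hrv
    have hw' := hrsp w (by
      rintro (_ | m) s hm hs
      · cases hs; simp [Transient.dest]
      · omega) hw
    cases ha <;> simp_all
  | ret n' hP =>
    rcases m with _ | _ | _ | _ | m <;> simp at hm
    obtain ⟨rfl, rfl, rfl⟩ := hm
    obtain ⟨w, rfl, hw⟩ := resolvesList_singleton.1 hrv
    have hw' := hrsp w (by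
      rintro (_ | _ | m) s hm hs
      · cases hs; simp [Transient.dest]
      · cases hs; simp [Transient.dest]
      · omega) hw
    cases ha <;> simp_all
  | _ => rcases m with _ | m <;> simp at hm

theorem InGroup.evalCond (h : InGroup M P C p srcs n)
    (ha : ArchStep M P C.reg C.mem p l reg₁ mem₁ n₁) {c : Cond} {n₀ nTrue nFalse : V}
    (hi : C.buf.get i = some (.br c rvs n₀ nTrue nFalse))
    (hrv : ResolvesList C.buf C.reg i rvs vs) :
    ∃ b, M.evalCond c (vs.map Prod.fst) = some b ∧ l = [if b then nTrue else nFalse] := by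
  obtain ⟨m, s, rfl, hm, hok⟩ := h.exists_src hi
  cases hok
  have hf := h.fetched
  cases hf with
  | br b hP =>
    rcases m with _ | m <;> simp at hm
    obtain ⟨rfl, rfl, rfl, rfl, rfl⟩ := hm
    cases ha with
    | br hP' hrv' hb hn =>
      cases hP.symm.trans hP'
      cases ((resolvesList_iff_archResolves fun j hj => h.get j (.inl hj)).1 hrv).det hrv'
      exact ⟨_, hb, by rw [hn]⟩
    | _ => simp_all
  | _ => rcases m with _ | _ | _ | _ | m <;> simp at hm

/-- The address is the first revealed value; for a `ret` the target of the jump follows it. -/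
theorem InGroup.load_addr (h : InGroup M P C p srcs n)
    (ha : ArchStep M P C.reg C.mem p l reg₁ mem₁ n₁) {r : TReg R} {q : V}
    (hi : C.buf.get i = some (.load r rvs q)) (hrv : ResolvesList C.buf C.reg i rvs vs) :
    ∃ a v, M.addr (vs.map Prod.fst) = some a ∧ C.mem a = some v ∧ l.head? = some a := by
  obtain ⟨m, s, rfl, hm, hok⟩ := h.exists_src hi
  cases hok
  have hrsp := fun v => h.resolves_arch (i := 1 + m) (r := M.rsp) (v := v)
  have hf := h.fetched
  cases hf with
  | load hP =>
    rcases m with _ | m <;> simp at hm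
    obtain ⟨rfl, rfl, rfl⟩ := hm
    cases ha with
    | load hP' hrv' ha hv =>
      cases hP.symm.trans hP'
      cases ((resolvesList_iff_archResolves fun j hj => h.get j (.inl hj)).1 hrv).det hrv'
      exact ⟨_, _, ha, hv, rfl⟩
    | _ => simp_all
  | ret n' hP =>
    rcases m with _ | _ | _ | _ | m <;> simp at hm
    obtain ⟨rfl, rfl, rfl⟩ := hm
    obtain ⟨w, rfl, hw⟩ := resolvesList_singleton.1 hrv
    have hw' := hrsp w (by
      rintro (_ | m) s hm hs
      · cases hs; simp [Transient.dest]
      · omega) hw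
    cases ha with
    | ret hP' hsp ha hu hv hn =>
      obtain rfl := Option.some.inj (hsp.symm.trans hw')
      exact ⟨_, _, ha, hu, rfl⟩
    | _ => simp_all
  | _ => rcases m with _ | _ | _ | m <;> simp at hm

/-- In a `call` the address operand is the result of the `succ` operation before it, which the
program-order step computes too. -/
theorem InGroup.store_addr (h : InGroup M P C p srcs n)
    (ha : ArchStep M P C.reg C.mem p l reg₁ mem₁ n₁) {rv : Operand (TReg R) V L}
    (hi : C.buf.get i = some (.store rv (.unresolved rvs)))
    (hrv : ResolvesList C.buf C.reg i rvs vs) :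
    ∃ a, M.addr (vs.map Prod.fst) = some a ∧ l = [a] := by
  obtain ⟨m, s, rfl, hm, hok⟩ := h.exists_src hi
  obtain ⟨rv₀, rfl⟩ : ∃ rv₀, s = .store rv₀ (.unresolved rvs) := by
    cases hok with
    | refl => exact ⟨_, rfl⟩
    | store hv ha =>
      rcases ha with ha | ⟨_, _, _, _, _, ha⟩
      · cases ha; exact ⟨_, rfl⟩
      · cases ha
  have hf := h.fetched
  cases hf with
  | store hP =>
    rcases m with _ | m <;> simp at hm
    obtain ⟨rfl, rfl⟩ := hm
    cases ha with
    | store hP' hval hrv' ha =>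
      cases hP.symm.trans hP'
      cases ((resolvesList_iff_archResolves fun j hj => h.get j (.inl hj)).1 hrv).det hrv'
      exact ⟨_, ha, rfl⟩
    | _ => simp_all
  | call hP =>
    rcases m with _ | _ | _ | m <;> simp at hm
    obtain ⟨rfl, rfl⟩ := hm
    obtain ⟨w, rfl, hw⟩ := resolvesList_singleton.1 hrv
    obtain ⟨⟨t, ht, hok₁⟩, -⟩ := h.entry 1 _ rfl
    have hval := hw.value_eq (by omega) ht hok₁.dest_eq (fun k u hk1 hk2 _ => by omega)
    cases hok₁ with
    | refl => simp [Transient.value] at hval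
    | op hrv₁ hv =>
      simp only [Transient.value, Option.some.injEq] at hval
      subst hval
      obtain ⟨x, rfl, hx⟩ := resolvesList_singleton.1 hrv₁
      have hx' := h.resolves_arch (by
        rintro (_ | m) s hm hs
        · cases hs; simp [Transient.dest]
        · omega) hx
      cases ha <;> simp_all
  | _ => rcases m with _ | _ | _ | _ | m <;> simp at hm

/-- The jump of a `ret` reads the temporary register. Since the group contains no predicted values,
this value was read from memory, at the address that the program-order step uses. The target is the
last revealed value. -/
theorem InGroup.jmpi_addr (h : InGroup M P C p srcs n)
    (ha : ArchStep M P C.reg C.mem p l reg₁ mem₁ n₁) {n₀ : V}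
    (hi : C.buf.get i = some (.jmpi rvs n₀)) (hrv : ResolvesList C.buf C.reg i rvs vs) :
    ∃ n', M.addr (vs.map Prod.fst) = some n' ∧ l.getLast? = some n' := by
  obtain ⟨m, s, rfl, hm, hok⟩ := h.exists_src hi
  cases hok
  have hf := h.fetched
  cases hf with
  | jmpi n' hP =>
    rcases m with _ | m <;> simp at hm
    obtain ⟨rfl, rfl⟩ := hm
    cases ha with
    | jmpi hP' hrv' ha =>
      cases hP.symm.trans hP'
      cases ((resolvesList_iff_archResolves fun j hj => h.get j (.inl hj)).1 hrv).det hrv'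
      exact ⟨_, ha, rfl⟩
    | _ => simp_all
  | ret n' hP =>
    rcases m with _ | _ | _ | _ | m <;> simp at hm
    obtain ⟨rfl, rfl⟩ := hm
    obtain ⟨w, rfl, hw⟩ := resolvesList_singleton.1 hrv
    obtain ⟨⟨t, ht, hok₁⟩, -⟩ := h.entry 1 _ rfl
    have hval := hw.value_eq (by omega) ht hok₁.dest_eq (fun k u hk1 hk2 hu => by
      obtain rfl : k = 1 + 2 := by omega
      rw [((h.entry 2 _ rfl).entryOK hu).dest_eq]
      simp [Transient.dest])
    cases hok₁ with
    | refl => simp [Transient.value] at hval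
    | loadPartial => exact absurd ht (h.noPartial _ _ _ _ _ _)
    | loadVal hrv₁ ha₁ hl =>
      simp only [Transient.value, Option.some.injEq] at hval
      subst hval
      have hm := hl.mem_eq fun j _ rv sa => h.not_store_of_load (k := 1 + 1) (fun s hs => by
        cases hs.entryOK ht with
        | refl hs => exact hs.elim
        | loadVal => exact ⟨_, _, _, rfl⟩) (by simp [ht]) rv sa
      obtain ⟨x, rfl, hx⟩ := resolvesList_singleton.1 hrv₁
      have hx' := h.resolves_arch (by
        rintro (_ | m) s hm hs
        · cases hs; simp [Transient.dest]
        · omega) hx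
      cases ha <;> simp_all
  | _ => rcases m with _ | _ | _ | m <;> simp at hm

end Values

end SingleGroup

/-! ### Replaying sequential executions in low-equivalent configurations. -/

section Progress

variable {V L R Op Cond : Type*} [DecidableEq V] [DecidableEq R] [SemilatticeSup L] [OrderBot L]
  {M : Machine V R Op Cond} {P : Program V L R Op Cond} {C C₁ C' : Config V L R Op Cond}

/-- A fetch that is possible in a configuration is possible in low-equivalent ones. -/
theorem Sim.exists_fetch {d : Directive V} {o : List (Obs V L)} (h : Sim C C')
    (hs : Step M P C d o C₁) (hd : d.IsFetch) : ∃ C₁', Step M P C' d o C₁' := by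
  cases hs with
  | op_fetch hP => exact ⟨_, .op_fetch (h.pc ▸ hP)⟩
  | br_fetch b hP => exact ⟨_, .br_fetch b (h.pc ▸ hP)⟩
  | jmpi_fetch n hP => exact ⟨_, .jmpi_fetch n (h.pc ▸ hP)⟩
  | load_fetch hP => exact ⟨_, .load_fetch (h.pc ▸ hP)⟩
  | store_fetch hP => exact ⟨_, .store_fetch (h.pc ▸ hP)⟩
  | fence_fetch hP => exact ⟨_, .fence_fetch (h.pc ▸ hP)⟩
  | call_fetch hP => exact ⟨_, .call_fetch (h.pc ▸ hP) rfl⟩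
  | ret_fetch hP ht => exact ⟨_, .ret_fetch (h.pc ▸ hP) (h.rsb ▸ ht) rfl⟩
  | ret_fetch_empty n hP ht => exact ⟨_, .ret_fetch_empty n (h.pc ▸ hP) (h.rsb ▸ ht) rfl⟩
  | _ => exact hd.elim

section

variable {p n n' m m' : V} {srcs srcs' : List (Transient V L R Op Cond)} {l : List V}
  {reg₁ reg₁' : R → Option (LVal V L)} {mem₁ mem₁' : V → Option (LVal V L)}

/-- If an instruction has the same addresses and targets in two low-equivalent configurations, then
the execute steps that are possible for it in one of them are possible in the other, with the
same observations. -/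
theorem Sim.exists_execute {d : Directive V} {o : List (Obs V L)} (h : Sim C C')
    (hg : InGroup M P C p srcs n) (hg' : InGroup M P C' p srcs' n')
    (ha : ArchStep M P C.reg C.mem p l reg₁ mem₁ m)
    (ha' : ArchStep M P C'.reg C'.mem p l reg₁' mem₁' m')
    (hs : Step M P C d o C₁) (hf : ¬ d.IsFetch) (hd : d ≠ .retire) :
    ∃ C₁', Step M P C' d o C₁' := by
  cases hs with
  | op_execute hi hnf hrv hv =>
    obtain ⟨t', hi', hT⟩ := h.buf.exists_of_some hi
    cases hT
    obtain ⟨vs', hrv', -⟩ := h.buf.resolvesList h.reg hrv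
    obtain ⟨v', hv'⟩ := hg'.evalOp ha' hi' hrv'
    exact ⟨_, .op_execute hi' (h.buf.noFence hnf) hrv' hv'⟩
  | br_execute_correct hi hnf hrv hb hn =>
    obtain ⟨t', hi', hT⟩ := h.buf.exists_of_some hi
    cases hT
    obtain ⟨vs', hrv', hl⟩ := h.buf.resolvesList h.reg hrv
    obtain ⟨b₁, hb₁, rfl⟩ := hg.evalCond ha hi hrv
    obtain ⟨b', hb', hl'⟩ := hg'.evalCond ha' hi' hrv'
    cases hb.symm.trans hb₁
    rw [joinLabels_eq hl]
    -- The conditions may evaluate differently if both branches lead to the same point; the shared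
    -- leakage equates the targets, and this suffices.
    exact ⟨_, .br_execute_correct hi' (h.buf.noFence hnf) hrv' hb'
      ((List.singleton_inj.1 hl').symm.trans hn)⟩
  | br_execute_incorrect hi hnf hrv hb hn hne =>
    obtain ⟨t', hi', hT⟩ := h.buf.exists_of_some hi
    cases hT
    obtain ⟨vs', hrv', hl⟩ := h.buf.resolvesList h.reg hrv
    obtain ⟨b₁, hb₁, rfl⟩ := hg.evalCond ha hi hrv
    obtain ⟨b', hb', hl'⟩ := hg'.evalCond ha' hi' hrv'
    cases hb.symm.trans hb₁
    rw [joinLabels_eq hl]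
    exact ⟨_, .br_execute_incorrect hi' (h.buf.noFence hnf) hrv' hb'
      ((List.singleton_inj.1 hl').symm.trans hn) hne⟩
  | jmpi_execute_correct hi hra =>
    obtain ⟨hnf, vs, hrv, hv, hlab⟩ := hra
    obtain ⟨t', hi', hT⟩ := h.buf.exists_of_some hi
    cases hT
    obtain ⟨vs', hrv', hl⟩ := h.buf.resolvesList h.reg hrv
    obtain ⟨a, hv₁, hla⟩ := hg.jmpi_addr ha hi hrv
    obtain ⟨a', hv', hla'⟩ := hg'.jmpi_addr ha' hi' hrv'
    cases hv.symm.trans hv₁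
    cases hla.symm.trans hla'
    exact ⟨_, .jmpi_execute_correct hi'
      ⟨h.buf.noFence hnf, vs', hrv', hv', hlab.trans (joinLabels_eq hl)⟩⟩
  | jmpi_execute_incorrect hi hra hne =>
    obtain ⟨hnf, vs, hrv, hv, hlab⟩ := hra
    obtain ⟨t', hi', hT⟩ := h.buf.exists_of_some hi
    cases hT
    obtain ⟨vs', hrv', hl⟩ := h.buf.resolvesList h.reg hrv
    obtain ⟨a, hv₁, hla⟩ := hg.jmpi_addr ha hi hrv
    obtain ⟨a', hv', hla'⟩ := hg'.jmpi_addr ha' hi' hrv'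
    cases hv.symm.trans hv₁
    cases hla.symm.trans hla'
    exact ⟨_, .jmpi_execute_incorrect hi'
      ⟨h.buf.noFence hnf, vs', hrv', hv', hlab.trans (joinLabels_eq hl)⟩ hne⟩
  | load_execute_nodep hi hra hst hmem =>
    obtain ⟨hnf, vs, hrv, hv, hlab⟩ := hra
    obtain ⟨t', hi', hT⟩ := h.buf.exists_of_some hi
    cases hT
    obtain ⟨vs', hrv', hl⟩ := h.buf.resolvesList h.reg hrv
    obtain ⟨a, -, hv₁, -, hla⟩ := hg.load_addr ha hi hrv
    obtain ⟨a', u', hv', hmem', hla'⟩ := hg'.load_addr ha' hi' hrv'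
    cases hv.symm.trans hv₁
    cases hla.symm.trans hla'
    exact ⟨_, .load_execute_nodep hi'
      ⟨h.buf.noFence hnf, vs', hrv', hv', hlab.trans (joinLabels_eq hl)⟩
      (h.buf.noStoreTo hst) hmem'⟩
  | load_execute_forward hi hra hji hj =>
    obtain ⟨k, s, rfl, hk, hok⟩ := hg.exists_src hi
    obtain ⟨k', s', rfl, hk', hok'⟩ := hg.exists_src hj
    cases hok
    cases hok' <;> exact absurd hk' (hg.fetched.not_store_of_load hk _ _)
  | load_execute_guess hi hnf hji hj =>
    exact (hg.eq_executeFwd_elim (.load_execute_guess hi hnf hji hj)).elim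
  | load_execute_addr_ok hi => exact absurd hi (hg.noPartial _ _ _ _ _ _)
  | load_execute_addr_hazard hi => exact absurd hi (hg.noPartial _ _ _ _ _ _)
  | load_execute_mem_match hi => exact absurd hi (hg.noPartial _ _ _ _ _ _)
  | load_execute_mem_hazard hi => exact absurd hi (hg.noPartial _ _ _ _ _ _)
  | store_execute_value hi hnf hv =>
    obtain ⟨t', hi', hT⟩ := h.buf.exists_of_some hi
    cases hT with | store _ hT =>
    obtain ⟨v', hv', -⟩ := h.buf.resolves h.reg hT hv
    exact ⟨_, .store_execute_value hi' (h.buf.noFence hnf) hv'⟩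
  | store_execute_addr_ok hi hra hok =>
    obtain ⟨hnf, vs, hrv, hv, hlab⟩ := hra
    obtain ⟨t', hi', hT⟩ := h.buf.exists_of_some hi
    cases hT with | store _ hT =>
    obtain ⟨vs', hrv', hl⟩ := h.buf.resolvesList h.reg hrv
    obtain ⟨a, hv₁, rfl⟩ := hg.store_addr ha hi hrv
    obtain ⟨a', hv', hla'⟩ := hg'.store_addr ha' hi' hrv'
    cases hv.symm.trans hv₁
    cases hla'
    exact ⟨_, .store_execute_addr_ok hi'
      ⟨h.buf.noFence hnf, vs', hrv', hv', hlab.trans (joinLabels_eq hl)⟩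
      fun k q hz => hok k q (h.buf.symm.hazard hz)⟩
  | store_execute_addr_hazard hi hra hz hmin =>
    obtain ⟨hnf, vs, hrv, hv, hlab⟩ := hra
    obtain ⟨t', hi', hT⟩ := h.buf.exists_of_some hi
    cases hT with | store _ hT =>
    obtain ⟨vs', hrv', hl⟩ := h.buf.resolvesList h.reg hrv
    obtain ⟨a, hv₁, rfl⟩ := hg.store_addr ha hi hrv
    obtain ⟨a', hv', hla'⟩ := hg'.store_addr ha' hi' hrv'
    cases hv.symm.trans hv₁
    cases hla'
    exact ⟨_, .store_execute_addr_hazard hi'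
      ⟨h.buf.noFence hnf, vs', hrv', hv', hlab.trans (joinLabels_eq hl)⟩
      (h.buf.hazard hz) fun k q hk hz => hmin k q hk (h.buf.symm.hazard hz)⟩
  | _ => first | exact absurd trivial hf | exact absurd rfl hd

end

/-- Without entries in the reorder buffer, fetches are the only steps. -/
theorem Step.isFetch_of_dom_eq_empty {d : Directive V} {o : List (Obs V L)}
    (hs : Step M P C d o C₁) (hC : C.buf.dom = ∅) : d.IsFetch := by
  have hn := IdxMap.dom_eq_empty_iff.1 hC
  cases hs <;> first | trivial | simp_all [Oldest]

/-- An instruction that is in flight is retired before the execution terminates. -/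
theorem InGroup.numRetired_pos {C₂ : Config V L R Op Cond} {D : List (Directive V)}
    {O : List (Obs V L)} {p n : V} {srcs : List (Transient V L R Op Cond)}
    (hg : InGroup M P C p srcs n) (h : SeqRun M P C D O C₂) (hC₂ : C₂.buf.dom = ∅) :
    0 < numRetired D := by
  induction h generalizing srcs n with
  | nil => exact absurd hC₂ hg.dom_ne_empty
  | @cons C C₁ C₂ d D o O hf hs _ ih =>
    by_cases hd : d = .retire
    · subst hd
      rw [numRetired_cons_retire]
      omega
    · rw [numRetired_cons_of_ne hd]
      obtain ⟨srcs', n', hg'⟩ := hg.step hs (fun hd' => hg.dom_ne_empty (hf hd')) hd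
      exact ih hg' hC₂

/-- The configuration is about to fetch the instruction at `p`, or executes it. -/
def AtInstr (M : Machine V R Op Cond) (P : Program V L R Op Cond) (C : Config V L R Op Cond)
    (p : V) : Prop :=
  C.buf.dom = ∅ ∧ C.pc = p ∨ ∃ srcs n, InGroup M P C p srcs n

/-- Sequential executions can be replayed in low-equivalent configurations, with the same trace,
if program-order execution has the same addresses and targets in both. -/
theorem Sim.exists_seqRun {C₂ : Config V L R Op Cond} {D : List (Directive V)}
    {O : List (Obs V L)} (h : SeqRun M P C D O C₂) (hC₂ : C₂.buf.dom = ∅) (hS : Sim C C') {p : V}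
    (hat : AtInstr M P C p) (hat' : AtInstr M P C' p)
    (hch : Chain M P (numRetired D) C.reg C.mem C'.reg C'.mem p) :
    ∃ C₂', SeqRun M P C' D O C₂' ∧ Sim C₂ C₂' := by
  induction h generalizing C' p with
  | nil => exact ⟨C', .nil _, hS⟩
  | @cons C C₁ C₂ d D o O hf hs hrun ih =>
    have hf' : d.IsFetch → C'.buf.dom = ∅ := fun hd => hS.buf.dom_eq ▸ hf hd
    suffices ∃ C₁' q, Step M P C' d o C₁' ∧ Sim C₁ C₁' ∧ AtInstr M P C₁ q ∧ AtInstr M P C₁' q ∧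
        Chain M P (numRetired D) C₁.reg C₁.mem C₁'.reg C₁'.mem q by
      obtain ⟨C₁', q, hs', hS', h1, h1', hch'⟩ := this
      obtain ⟨C₂', hrun', hS₂⟩ := ih hC₂ hS' h1 h1' hch'
      exact ⟨C₂', .cons hf' hs' hrun', hS₂⟩
    by_cases hd : d.IsFetch
    · have hdr : d ≠ .retire := by rintro rfl; exact hd
      obtain ⟨C₁', hs'⟩ := hS.exists_fetch hs hd
      obtain ⟨-, hS'⟩ := hS.step (O := []) (O' := []) hs hs' rfl
      have hpc : C.pc = p := by
        rcases hat with ⟨-, e⟩ | ⟨srcs, n, hg⟩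
        · exact e
        · exact absurd (hf hd) hg.dom_ne_empty
      obtain ⟨e1, e2⟩ := hs.reg_mem_eq hdr
      obtain ⟨e1', e2'⟩ := hs'.reg_mem_eq hdr
      refine ⟨C₁', p, hs', hS', .inr ?_, .inr ?_, ?_⟩
      · exact hpc ▸ InGroup.of_fetch (hf hd) hs hd
      · exact hpc ▸ hS.pc ▸ InGroup.of_fetch (hf' hd) hs' hd
      · rwa [e1, e2, e1', e2', ← numRetired_cons_of_ne hdr]
    · have hne : C.buf.dom ≠ ∅ := fun he => hd (hs.isFetch_of_dom_eq_empty he)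
      obtain ⟨srcs, n, hg⟩ := hat.resolve_left fun e => hne e.1
      obtain ⟨srcs', n', hg'⟩ := hat'.resolve_left fun e => hne (hS.buf.dom_eq ▸ e.1)
      -- The instruction in flight has yet to retire, so the chain is not used up and provides its
      -- program-order step on both sides.
      have hpos := hg.numRetired_pos (.cons hf hs hrun) hC₂
      generalize hN : numRetired (d :: D) = N at *
      cases hch with
      | zero => omega
      | @succ N _ _ _ _ reg₁ mem₁ reg₁' mem₁' l _ m ha ha' rest =>
        by_cases hdr : d = .retire
        · subst hdr
          obtain ⟨C₁', hs', hS'⟩ := hS.exists_retire hs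
          obtain ⟨⟨l₁, hr⟩, he, hpc⟩ := hg.retire hs
          obtain ⟨⟨l₁', hr'⟩, he', hpc'⟩ := hg'.retire hs'
          -- The retirement is the step recorded in the chain, which advances on both sides.
          obtain ⟨rfl, rfl, rfl⟩ := ha.det hr
          obtain ⟨rfl, rfl, rfl⟩ := ha'.det hr'
          rw [numRetired_cons_retire] at hN
          cases hN
          exact ⟨C₁', _, hs', hS', .inl ⟨he, hpc⟩, .inl ⟨he', hpc'⟩, rest⟩
        · obtain ⟨C₁', hs'⟩ := hS.exists_execute hg hg' ha ha' hs hd hdr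
          obtain ⟨-, hS'⟩ := hS.step (O := []) (O' := []) hs hs' rfl
          obtain ⟨e1, e2⟩ := hs.reg_mem_eq hdr
          obtain ⟨e1', e2'⟩ := hs'.reg_mem_eq hdr
          -- The instruction is still in flight: registers and memory are unchanged, and the same
          -- link of the chain serves its remaining steps.
          refine ⟨C₁', p, hs', hS', .inr (hg.step hs hd hdr), .inr (hg'.step hs' hd hdr), ?_⟩
          rw [e1, e2, e1', e2', ← numRetired_cons_of_ne hdr D, hN]
          exact .succ ha ha' rest

/-- Program-order execution can be carried out by the machine. -/
theorem Chain.exists_seqRun {k : ℕ} {reg reg' : R → Option (LVal V L)}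
    {mem mem' : V → Option (LVal V L)} {p : V} (h : Chain M P k reg mem reg' mem' p)
    (hC : C.buf.dom = ∅) (hreg : C.reg = reg) (hmem : C.mem = mem) (hpc : C.pc = p) :
    ∃ D O C₂, numRetired D = k ∧ SeqRun M P C D O C₂ ∧ C₂.buf.dom = ∅ := by
  induction h generalizing C with
  | zero => exact ⟨[], [], C, rfl, .nil _, hC⟩
  | succ ha _ _ ih =>
    subst hreg hmem hpc
    obtain ⟨D, O, C₁, hrun, hD, he, h1, h2, h3⟩ := ha.exists_seqRun hC
    obtain ⟨D', O', C₂, hD', hrun', he'⟩ := ih he h1 h2 h3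
    refine ⟨_, _, C₂, ?_, hrun.append hrun', he'⟩
    rw [numRetired, List.countP_append, ← numRetired, ← numRetired, hD, hD', add_comm]

theorem SeqExec.exists_of_lowEq {C₂ : Config V L R Op Cond} {D : List (Directive V)}
    {O : List (Obs V L)} (h : SeqExec M P C D O C₂) (hS : Sim C C')
    (hch : Chain M P (numRetired D) C.reg C.mem C'.reg C'.mem C.pc) :
    ∃ C₂', SeqExec M P C' D O C₂' ∧ LowEq C₂ C₂' := by
  obtain ⟨hC, hrun, hC₂⟩ := h
  have hC' : C'.buf.dom = ∅ := hS.buf.dom_eq ▸ hC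
  obtain ⟨C₂', hrun', hS'⟩ := Sim.exists_seqRun hrun hC₂ hS (.inl ⟨hC, rfl⟩)
    (.inl ⟨hC', hS.pc.symm⟩) hch
  exact ⟨C₂', ⟨hC', hrun', hS'.buf.dom_eq.symm.trans hC₂⟩, hS'.lowEq⟩

end Progress

end SpecCT

/-! ### The proposition. -/

theorem mainTheorem3 {V L R Op Cond : Type*} [DecidableEq V] [DecidableEq R]
    [Lattice L] [OrderBot L]
    (M : SpecCT.Machine V R Op Cond) (P : SpecCT.Program V L R Op Cond)
    (C : SpecCT.Config V L R Op Cond) (D : List (SpecCT.Directive V))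
    (hC : C.IsInitial)
    (hD : SpecCT.WellFormed M P D C)
    (hsct : SpecCT.SpeculativeConstantTime M P D C)
    (hterm : ∃ O C₁, SpecCT.Run M P C D O C₁ ∧ C₁.IsTerminal) :
    SpecCT.SequentiallyConstantTime M P (SpecCT.numRetired D) C := by
  open SpecCT in
  obtain ⟨O, C₁, hrun, -⟩ := hterm
  have chain : ∀ C', LowEq C C' → Chain M P (numRetired D) C.reg C.mem C'.reg C'.mem C.pc := by
    intro C' hl
    -- Speculative constant-time enters here: a run from `C'` with the same trace.
    obtain ⟨_, C₁', hrun', -, rfl⟩ := (hsct C' hl).1 O C₁ hrun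
    have hS := hl.sim hC
    exact chain_of_run hrun hrun' hS (correct_of_isInitial hC)
      (hS.pc ▸ correct_of_isInitial (hS.buf.dom_eq ▸ hC))
  have hrefl : LowEq C C := ⟨fun _ => ⟨rfl, fun _ => rfl⟩, fun _ => ⟨rfl, fun _ => rfl⟩, rfl, rfl,
    rfl⟩
  refine ⟨?_, fun C' hl D' hD' => ⟨fun O' C₂ h => ?_, fun O' C₂' h => ?_⟩⟩
  -- The chain of `C` with itself is its execution in program order.
  · obtain ⟨D', O', C₂, hD', hrun', hC₂⟩ := (chain C hrefl).exists_seqRun hC rfl rfl rfl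
    exact ⟨D', O', C₂, hD', hC, hrun', hC₂⟩
  · obtain ⟨C₂', h', hl'⟩ := h.exists_of_lowEq (hl.sim hC) (hD' ▸ chain C' hl)
    exact ⟨O', C₂', h', hl', rfl⟩
  · have hS := hl.sim hC
    obtain ⟨C₂, h', hl'⟩ := h.exists_of_lowEq hS.symm (hD' ▸ hS.pc ▸ (chain C' hl).symm)
    obtain ⟨h1, h2, h3, h4, h5⟩ := hl'
    exact ⟨O', C₂, h', ⟨fun r => (h1 r).symm, fun a => (h2 a).symm, h3.symm, h4.symm, h5.symm⟩,
      rfl⟩
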